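/- \textbf{Model.} Fix $T\ge 2$ spells. A unit has an initial duration $Y_0\in\mathbb R$, durations $Y_1,\dots,Y_T>0$, covariates $X_1,\dots,X_T\in\mathbb R^d$ and a latent heterogeneity $A\in\mathbb R$; write $Y^t=(Y_0,\dots,Y_t)$, $X^t=(X_1,\dots,X_t)$. Let $\theta=(\alpha,\beta,\gamma)\in\Theta\subset\mathbb R^q\times\mathbb R^d\times\mathbb R$ and let $\lambda_\alpha$ be a known parametric family of baseline hazards which, for every $\theta\in\Theta$, is measurable, positive on $(0,\infty)$, with $\Lambda_\alpha(y)=\int_0^y\lambda_\alpha(u)\,du<\infty$ for $y>0$ and $\Lambda_\alpha(y)\to\infty$ as $y\to\infty$. Put $\rho_\theta(y_t,y_{t-1},x_t)=\Lambda_\alpha(y_t)e^{\gamma y_{t-1}+x_t'\beta}$ and $$f_\theta(y_t\mid y_{t-1},x_t,a)=\lambda_\alpha(y_t)\,e^{\gamma y_{t-1}+x_t'\beta+a}\exp\!\big(-\rho_\theta(y_t,y_{t-1},x_t)e^{a}\big),\qquad y_t>0 .$$ A nuisance parameter $\omega=(g,\pi,\nu)\in\Omega$ consists of densities $g(x_t\mid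 y^{t-1},x^{t-1},a)$ for $t=2,\dots,T$ (with respect to fixed $\sigma$-finite measures), $\pi(a\mid y_0,x_1)$ (with respect to Lebesgue measure) and $\nu(y_0,x_1)$ (with respect to a fixed $\sigma$-finite measure). All $\omega\in\Omega$ have a common support: the sets where $g(\cdot\mid y^{t-1},x^{t-1},a)$, $\pi(\cdot\mid y_0,x_1)$ and $\nu$ are positive do not depend on $\omega$, and the first does not depend on $a$. Otherwise $\omega$ is unrestricted. The likelihood of the observed data is $$\ell(\theta,\omega\mid y^T,x^T)=\int\prod_{t=1}^Tf_\theta(y_t\mid y_{t-1},x_t,a)\prod_{t=2}^Tg(x_t\mid y^{t-1},x^{t-1},a)\,\pi(a\mid y_0,x_1)\,\nu(y_0,x_1)\,da .$$ \textbf{Tangent set.} Fix $\theta\in\Theta$ and $\omega\in\Omega$; expectations are under $(\theta,\omega)$. A regular submodel is a path $\eta\mapsto\omega_\eta\in\Omega$, $\eta\in\mathbb R$, with $\omega_0=\omega$, along which $\ell^{1/2}(\theta,\omega_\eta\mid\cdot)$ is differentiable in quadratic mean at $\eta=0$ with square-integrable score $S^\eta$ and $E[(S^\eta)^2]>0$.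 For $L\ge 0$, $\mathcal T_{\theta,\omega,L}$ is the mean-square closure of the linear span of all $c\,S^\eta$, $c\in\mathbb R^L$, over regular submodels; $\mathcal T^\perp_{\theta,\omega,L}$ is its orthocomplement in the Hilbert space of mean-zero square-integrable $\mathbb R^L$-valued functions of $(Y^T,X^T)$ with inner product $E[s_1's_2]$; $\Pi(\cdot\mid\mathcal T^\perp_{\theta,\omega,L})$ is the orthogonal projection of square-integrable functions onto it. Let $$P_t=\rho_\theta(Y_t,Y_{t-1},X_t),\qquad \widetilde P_t=\frac{P_t}{\sum_{s=t}^TP_s}\ (1\le t\le T-1),\qquad \overline P=\sum_{t=1}^TP_t,\qquad \widetilde P^{t}=(\widetilde P_1,\dots,\widetilde P_t),$$ and for a function $\varphi$ of $(Y^T,X^T)$ let $$R[\varphi]=\sum_{t=1}^{T-1}\Big(E[\varphi\mid Y_0,\widetilde P^{t},\overline P,X^t]-E[\varphi\mid Y_0,\widetilde P^{t-1},\overline P,X^t]\Big).$$ \textbf{Lemma (MPH projection).} (a) For every $L$ and every square-integrable mean-zero $\mathbb R^L$-valued $\varphi(Y^T,X^T)$, $\Pi(\varphi\mid\mathcal T^\perp_{\theta,\omega,L})=R[\varphi]$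 almost surely. (b) Let $\theta$ be an interior point of $\Theta$, let $K=q+d+1$, and suppose that $\theta'\mapsto\ell^{1/2}(\theta',\omega\mid\cdot)$ is differentiable in quadratic mean at $\theta$ with square-integrable score $S^\theta$. Then $E[S^\theta]=0$, and the efficient score $\phi^{\rm eff}_{\theta,\omega}=\Pi(S^\theta\mid\mathcal T^\perp_{\theta,\omega,K})$ equals $R[S^\theta]$ almost surely. (c) Fix evaluation points $(y_i,y_i^-,x_i)$, $i=1,\dots,L$. Let $\mu\in\mathbb R^L$ be the vector of average structural hazards $\mu_i=E[\lambda_\alpha(y_i)e^{x_i'\beta+\gamma y_i^-+A}]$, and let $\varphi$ have components $\varphi_i=\lambda_\alpha(y_i)e^{x_i'\beta+\gamma y_i^-}\,\frac{T-1}{\overline P}$. If $E[e^{A}]<\infty$, then $\varphi$ is integrable, $E[\varphi]=\mu$, and $R[\varphi]=0$ almost surely. If $T\ge 3$ and $E[e^{2A}]<\infty$, then $\varphi$ is square-integrable, $\Pi(\varphi\mid\mathcal T^\perp_{\theta,\omega,L})=0$, and so the efficient moment function $\varphi-\Pi(\varphi\mid\mathcal T^\perp_{\theta,\omega,L})$ for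 $\mu$ is $\varphi$ itself; moreover $\varphi-\mu\in\mathcal T_{\theta,\omega,L}$. -/

import Mathlib

open MeasureTheory Set Filter Topology

noncomputable section

namespace MPH

/-- Covariate space `ℝ^d`. -/
abbrev Cov (d : ℕ) : Type := Fin d → ℝ

/-- Index set of the coordinates of `θ = (α, β, γ)`, with `α ∈ ℝ^q`, `β ∈ ℝ^d`, `γ ∈ ℝ`. -/
abbrev ParamIdx (q d : ℕ) : Type := Fin q ⊕ Fin d ⊕ Unit

/-- The parameter space `ℝ^K`, `K = q + d + 1`, with its Euclidean norm. -/
abbrev Param (q d : ℕ) : Type := EuclideanSpace ℝ (ParamIdx q d)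

def Param.alpha {q d : ℕ} (θ : Param q d) : Fin q → ℝ := fun i => θ (Sum.inl i)
def Param.beta {q d : ℕ} (θ : Param q d) : Fin d → ℝ := fun i => θ (Sum.inr (Sum.inl i))
def Param.gamma {q d : ℕ} (θ : Param q d) : ℝ := θ (Sum.inr (Sum.inr ()))

/-- Observed data of one unit over `T = n + 1` spells:
`((y₀, x₁), (y₁, …, y_T), (x₂, …, x_T))`. -/
abbrev Obs (n d : ℕ) : Type := (ℝ × Cov d) × (Fin (n + 1) → ℝ) × (Fin n → Cov d)

/-- All durations `(y₀, y₁, …, y_T)`; the index is the period. -/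
def Obs.y {n d : ℕ} (o : Obs n d) : Fin (n + 2) → ℝ := Fin.cons o.1.1 o.2.1

/-- All covariates `(x₁, …, x_T)`; index `t` stands for period `t + 1`. -/
def Obs.x {n d : ℕ} (o : Obs n d) : Fin (n + 1) → Cov d := Fin.cons o.1.2 o.2.2

/-- The observed past `(y^{t-1}, x^{t-1}) = ((y₀, …, y_{t-1}), (x₁, …, x_{t-1}))` on which the
covariate of period `t = j + 2` may depend. -/
abbrev Past (d j : ℕ) : Type := (Fin (j + 2) → ℝ) × (Fin (j + 1) → Cov d)

def Obs.past {n d : ℕ} (o : Obs n d) (j : Fin n) : Past d j.val :=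
  (fun s => o.y (Fin.castLE (by omega) s), fun s => o.x (Fin.castLE (by omega) s))

/-- The known ingredients of the model: the parameter set, the parametric family of baseline
hazards, the dominating measures with respect to which the densities of `(y₀, x₁)` and of
`x₂, …, x_T` are taken, and the supports common to all nuisance parameters. The heterogeneity `a`
has a density with respect to Lebesgue measure. -/
structure Model (n q d : ℕ) where
  Θ : Set (Param q d)
  /-- `haz α y` is the baseline hazard `λ_α(y)`. -/
  haz : (Fin q → ℝ) → ℝ → ℝ
  haz_meas : ∀ θ ∈ Θ, Measurable (haz θ.alpha)
  haz_pos : ∀ θ ∈ Θ, ∀ y : ℝ, 0 < y → 0 < haz θ.alpha y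
  haz_int : ∀ θ ∈ Θ, ∀ y : ℝ, 0 < y → IntegrableOn (haz θ.alpha) (Ioc 0 y)
  haz_top : ∀ θ ∈ Θ, Tendsto (fun y : ℝ => ∫ u in (0 : ℝ)..y, haz θ.alpha u) atTop atTop
  m₀ : Measure (ℝ × Cov d)
  m₀_sigmaFinite : SigmaFinite m₀
  mX : Fin n → Measure (Cov d)
  mX_sigmaFinite : ∀ j, SigmaFinite (mX j)
  supp₀ : Set (ℝ × Cov d)
  suppX : (j : Fin n) → Past d j.val → Set (Cov d)
  suppA : ℝ × Cov d → Set ℝ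

/-- A nuisance parameter `ω = (g, π, ν)`: feedback process, heterogeneity distribution and
distribution of the initial condition. Apart from the common support it is unrestricted. -/
structure Nuisance {n q d : ℕ} (M : Model n q d) where
  /-- `g j (h, a) x` is the conditional density at `x` of the covariate of period `j + 2`, given
  the observed past `h` and the heterogeneity `a`. -/
  g : (j : Fin n) → Past d j.val × ℝ → Cov d → ℝ
  g_meas : ∀ j : Fin n, Measurable (fun p : (Past d j.val × ℝ) × Cov d => g j p.1 p.2)
  g_nonneg : ∀ j p x, 0 ≤ g j p x
  g_pos_iff : ∀ j p x, 0 < g j p x ↔ x ∈ M.suppX j p.1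
  g_one : ∀ j p, ∫⁻ x, ENNReal.ofReal (g j p x) ∂(M.mX j) = 1
  /-- `π c a` is the conditional density at `a` of the heterogeneity, given `(y₀, x₁) = c`. -/
  π : ℝ × Cov d → ℝ → ℝ
  π_meas : Measurable (fun p : (ℝ × Cov d) × ℝ => π p.1 p.2)
  π_nonneg : ∀ c a, 0 ≤ π c a
  π_pos_iff : ∀ c a, 0 < π c a ↔ a ∈ M.suppA c
  π_one : ∀ c, ∫⁻ a, ENNReal.ofReal (π c a) = 1
  /-- The density of the initial condition `(y₀, x₁)`. -/
  ν : ℝ × Cov d → ℝ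
  ν_meas : Measurable ν
  ν_nonneg : ∀ c, 0 ≤ ν c
  ν_pos_iff : ∀ c, 0 < ν c ↔ c ∈ M.supp₀
  ν_one : ∫⁻ c, ENNReal.ofReal (ν c) ∂M.m₀ = 1

variable {n q d : ℕ} (M : Model n q d)

/-- Integrated baseline hazard `Λ_α(y) = ∫₀^y λ_α(u) du`. -/
def Model.Lam (α : Fin q → ℝ) (y : ℝ) : ℝ := ∫ u in (0 : ℝ)..y, M.haz α u

/-- `ρ_θ(y_t, y_{t-1}, x_t) = Λ_α(y_t) exp(γ y_{t-1} + x_t'β)`. -/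
def Model.rho (θ : Param q d) (y ylag : ℝ) (x : Cov d) : ℝ :=
  M.Lam θ.alpha y * Real.exp (θ.gamma * ylag + x ⬝ᵥ θ.beta)

/-- The mixed proportional hazards density `f_θ(y_t | y_{t-1}, x_t, a)`, for `y_t > 0`. -/
def Model.spellDensity (θ : Param q d) (y ylag : ℝ) (x : Cov d) (a : ℝ) : ℝ :=
  M.haz θ.alpha y * Real.exp (θ.gamma * ylag + x ⬝ᵥ θ.beta + a)
    * Real.exp (-(M.rho θ y ylag x * Real.exp a))

/-- Dominating measure for the observed data; spell durations `y₁, …, y_T` live on `(0, ∞)`. -/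
def Model.base : Measure (Obs n d) :=
  M.m₀.prod ((Measure.pi fun _ : Fin (n + 1) => volume.restrict (Ioi (0 : ℝ))).prod
    (Measure.pi M.mX))

variable {M}

/-- Joint density of the observed data and the heterogeneity:
`∏ₜ f_θ(y_t | y_{t-1}, x_t, a) · ∏_{t ≥ 2} g(x_t | y^{t-1}, x^{t-1}, a) · π(a | y₀, x₁) · ν(y₀, x₁)`. -/
def completeDensity (θ : Param q d) (ω : Nuisance M) (o : Obs n d) (a : ℝ) : ℝ :=
  (∏ t : Fin (n + 1), M.spellDensity θ (o.y t.succ) (o.y t.castSucc) (o.x t) a)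
    * (∏ j : Fin n, ω.g j (o.past j, a) (o.x j.succ)) * ω.π o.1 a * ω.ν o.1

/-- The likelihood `ℓ(θ, ω | y^T, x^T)` of the observed data (heterogeneity integrated out). -/
def likelihood (θ : Param q d) (ω : Nuisance M) (o : Obs n d) : ℝ :=
  ∫ a, completeDensity θ ω o a

/-- Joint law of the observed data and the heterogeneity `A` under `(θ, ω)`. -/
def completeLaw (θ : Param q d) (ω : Nuisance M) : Measure (Obs n d × ℝ) :=
  (M.base.prod volume).withDensity fun z => ENNReal.ofReal (completeDensity θ ω z.1 z.2)

/-- Law of the observed data `(Y^T, X^T)` under `(θ, ω)`. -/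
def obsLaw (θ : Param q d) (ω : Nuisance M) : Measure (Obs n d) :=
  (completeLaw θ ω).map Prod.fst

/-! ### Scores, tangent set and projection -/

/-- The path `η ↦ ω η` through `ω 0` is a regular submodel at `(θ, ω 0)` with score `S`: the root
of its likelihood is differentiable in quadratic mean at `η = 0`, with nonzero information. -/
structure IsRegularSubmodel (θ : Param q d) (ω : ℝ → Nuisance M) (S : Obs n d → ℝ) : Prop where
  memLp : MemLp S 2 (obsLaw θ (ω 0))
  dqm : Tendsto (fun η : ℝ => ∫⁻ o, ENNReal.ofReal
      (((√(likelihood θ (ω η) o) - √(likelihood θ (ω 0) o)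
        - η / 2 * S o * √(likelihood θ (ω 0) o)) / η) ^ 2) ∂M.base) (𝓝[≠] 0) (𝓝 0)
  info_pos : 0 < ∫ o, S o ^ 2 ∂(obsLaw θ (ω 0))

/-- `S` is the score for `θ` at `(θ, ω)`: the derivative in quadratic mean of the root likelihood
in `θ` satisfies `∂√ℓ = (1/2) S √ℓ`. -/
structure IsThetaScore (θ : Param q d) (ω : Nuisance M) (S : Obs n d → Param q d) : Prop where
  memLp : MemLp S 2 (obsLaw θ ω)
  dqm : Tendsto (fun h : Param q d => ∫⁻ o, ENNReal.ofReal
      (((√(likelihood (θ + h) ω o) - √(likelihood θ ω o)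
        - inner ℝ h (S o) / 2 * √(likelihood θ ω o)) / ‖h‖) ^ 2) ∂M.base) (𝓝[≠] 0) (𝓝 0)

variable (ι : Type) [Fintype ι]

/-- Square-integrable `ℝ^ι`-valued functions of the observed data, with inner product
`⟨s₁, s₂⟩ = E[s₁' s₂]`. -/
abbrev L2 (θ : Param q d) (ω : Nuisance M) : Type :=
  Lp (EuclideanSpace ℝ ι) 2 (obsLaw θ ω)

/-- The constant functions in `L2`. Being orthogonal to them means having mean zero. -/
def constants (θ : Param q d) (ω : Nuisance M) : Submodule ℝ (L2 ι θ ω) where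
  carrier := {f | ∃ c : EuclideanSpace ℝ ι, f =ᵐ[obsLaw θ ω] fun _ => c}
  zero_mem' := ⟨0, Lp.coeFn_zero _ _ _⟩
  add_mem' := by
    rintro f g ⟨c, hc⟩ ⟨e, he⟩
    refine ⟨c + e, ?_⟩
    filter_upwards [Lp.coeFn_add f g, hc, he] with o h1 h2 h3
    rw [h1, Pi.add_apply, h2, h3]
  smul_mem' := by
    rintro r f ⟨c, hc⟩
    refine ⟨r • c, ?_⟩
    filter_upwards [Lp.coeFn_smul r f, hc] with o h1 h2
    rw [h1, Pi.smul_apply, h2]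

/-- The nonparametric tangent set at `(θ, ω)`: the mean-square closure of the `ℝ^ι`-valued linear
combinations of the scores of regular submodels through `ω`. -/
def tangentSet (θ : Param q d) (ω : Nuisance M) : Submodule ℝ (L2 ι θ ω) :=
  (Submodule.span ℝ {f : L2 ι θ ω | ∃ (path : ℝ → Nuisance M) (S : Obs n d → ℝ)
      (c : EuclideanSpace ℝ ι), path 0 = ω ∧ IsRegularSubmodel θ path S ∧
        f =ᵐ[obsLaw θ ω] fun o => S o • c}).topologicalClosure

/-- The orthocomplement of the tangent set within the mean-zero square-integrable functions. -/
def tangentOrtho (θ : Param q d) (ω : Nuisance M) : Submodule ℝ (L2 ι θ ω) :=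
  (constants ι θ ω ⊔ tangentSet ι θ ω)ᗮ

instance (θ : Param q d) (ω : Nuisance M) : (tangentOrtho ι θ ω).HasOrthogonalProjection :=
  haveI : CompleteSpace (tangentOrtho ι θ ω) :=
    (Submodule.isClosed_orthogonal (constants ι θ ω ⊔ tangentSet ι θ ω)).completeSpace_coe
  inferInstance

variable {ι}

/-- `Π(φ | 𝒯^⊥)`: the orthogonal projection of a square-integrable `φ`. -/
def projOrtho {θ : Param q d} {ω : Nuisance M} {φ : Obs n d → EuclideanSpace ℝ ι}
    (hφ : MemLp φ 2 (obsLaw θ ω)) : L2 ι θ ω :=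
  (tangentOrtho ι θ ω).starProjection (hφ.toLp φ)

/-- The efficient score for `θ`: the projection on `𝒯^⊥` of the score for `θ`. -/
def efficientScore {θ : Param q d} {ω : Nuisance M} {S : Obs n d → Param q d}
    (hS : IsThetaScore θ ω S) : L2 (ParamIdx q d) θ ω :=
  projOrtho hS.memLp

/-- The efficient moment function `φ - Π(φ | 𝒯^⊥)` for an average effect `E[φ]`. -/
def efficientMoment {θ : Param q d} {ω : Nuisance M} {φ : Obs n d → EuclideanSpace ℝ ι}
    (hφ : MemLp φ 2 (obsLaw θ ω)) : L2 ι θ ω :=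
  hφ.toLp φ - projOrtho hφ

/-! ### The within-between transformation -/

variable (M)

/-- `P_t = ρ_θ(Z_t)`; index `t` stands for period `t + 1`. -/
def Model.P (θ : Param q d) (o : Obs n d) (t : Fin (n + 1)) : ℝ :=
  M.rho θ (o.y t.succ) (o.y t.castSucc) (o.x t)

/-- `P̃_t = P_t / ∑_{s ≥ t} P_s`. -/
def Model.Ptilde (θ : Param q d) (o : Obs n d) (t : Fin (n + 1)) : ℝ :=
  M.P θ o t / ∑ s ∈ Finset.univ.filter (fun s => t ≤ s), M.P θ o s

/-- `P̄ = ∑_t P_t`. -/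
def Model.Pbar (θ : Param q d) (o : Obs n d) : ℝ := ∑ t, M.P θ o t

/-- The σ-algebra generated by `(Y₀, P̃_1, …, P̃_k, P̄, X_1, …, X_m)`. -/
abbrev Model.info (θ : Param q d) (k m : ℕ) : MeasurableSpace (Obs n d) :=
  MeasurableSpace.comap
    (fun o : Obs n d =>
      (o.y 0, (fun s : {s : Fin (n + 1) // s.val < k} => M.Ptilde θ o s), M.Pbar θ o,
        (fun s : {s : Fin (n + 1) // s.val < m} => o.x s)))
    inferInstance

variable {M}

/-- `∑_{t=1}^{T-1} (E[φ | Y₀, P̃^t, P̄, X^t] - E[φ | Y₀, P̃^{t-1}, P̄, X^t])`, the expectations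
being taken under `(θ, ω)`; here `T - 1 = n` and `t = j + 1`. -/
def projFormula (θ : Param q d) (ω : Nuisance M) (φ : Obs n d → EuclideanSpace ℝ ι)
    (o : Obs n d) : EuclideanSpace ℝ ι :=
  ∑ j : Fin n, (((obsLaw θ ω)[φ | M.info θ (j.val + 1) (j.val + 1)]) o
    - ((obsLaw θ ω)[φ | M.info θ j.val (j.val + 1)]) o)

/-! ### The average structural hazard -/

variable (M)

/-- The hazard `λ_α(y) exp(x'β + γ y₋ + a)` at fixed values `(y, y₋, x)`. -/
def Model.hazard (θ : Param q d) (y ylag : ℝ) (x : Cov d) (a : ℝ) : ℝ :=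
  M.haz θ.alpha y * Real.exp (x ⬝ᵥ θ.beta + θ.gamma * ylag + a)

variable {M}

/-- The average structural hazard `E[λ_α(y) exp(x'β + γ y₋ + A)]`. -/
def averageHazard (θ : Param q d) (ω : Nuisance M) (y ylag : ℝ) (x : Cov d) : ℝ :=
  ∫ z, M.hazard θ y ylag x z.2 ∂(completeLaw θ ω)

variable (M)

/-- The vector of moment functions `λ_α(y) exp(x'β + γ y₋) (T - 1) / P̄` for the average structural
hazards at the evaluation points `(y i, y₋ i, x i)`; here `T - 1 = n`. -/
def Model.hazardMoment (θ : Param q d) (y ylag : ι → ℝ) (x : ι → Cov d) (o : Obs n d) :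
    EuclideanSpace ℝ ι :=
  WithLp.toLp 2 fun i =>
    M.haz θ.alpha (y i) * Real.exp (x i ⬝ᵥ θ.beta + θ.gamma * ylag i) * ((n : ℝ) / M.Pbar θ o)

end MPH

end

/-! Write T = n + 1. Everything rests on one fact: given A = a and the past, P_t is exponential with
rate e^a, whatever the past was and however the covariates were generated. Working backwards in t,
the remaining sum P_{k+1} + ... + P_T is then gamma with shape T - k and rate e^a
(`lintegral_tau_tailP`), and P̃_{k+1} is Beta(1, T - k - 1), independent of the past, of A and of
that sum (`lintegral_tau_tailP_Ptilde`). The beta law contains neither A nor the nuisance parameter;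
the gamma law depends on the past and on A only through the rate e^a.

Call I(k, m) the information (Y₀, P̃^k, P̄, X^m). The operator R is a sum of differences of
conditional expectations, hence self-adjoint. So R is the orthogonal projection on 𝒯^⊥ as soon as it
annihilates constants and scores (which puts its range in 𝒯^⊥) and is the identity on 𝒯^⊥
(`projOrtho_eq`).

Scores are annihilated. I(j+1, j+1) is I(j, j+1) together with P̃_{j+1}. For bounded ψ, the variable
ψ(I(j+1, j+1)) minus its average over the beta law has mean zero under every nuisance parameter, so
its mean has zero derivative along any regular path. Quadratic-mean differentiability turns this
into orthogonality to the score (`integral_mul_score_eq_zero`), that is E[S | I(j+1, j+1)] = E[S |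
I(j, j+1)] (`condExp_submodel_score`).

R is the identity on 𝒯^⊥. Let s have mean zero and be orthogonal to all scores. Bounded
multiplicative tilts of ν, π and g are regular submodels, and orthogonality to their scores says
that E[s | A, Y₀, X_1] = 0 and that E[s | A, past, X_{j+2}] does not depend on X_{j+2}. These
statements involve the latent A. They become statements about observables by completeness: E[s |
I(j, j+1)] is a function of the past and of the remaining sum, its average over the gamma law with
rate e^a is E[s | A, past] (the invariant `MatchesPast`), and gamma laws with rates e^a, a in a set
of positive measure, are complete by uniqueness of the Laplace transform
(`ae_eq_zero_of_integral_gden_eq_zero`). Descending from j = T - 1, where I(T-1, T) determines the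
data, one gets E[s | I(j+1, j+2)] = E[s | I(j+1, j+1)] at each step (`aeDetermined_condExp`), and
E[s | I(0, 1)] = 0 at the bottom (`condExp_info_zero`). The sum R[s] therefore telescopes to s
(`eq_sum_of_orthScores`).

The score for θ has mean zero because the likelihood integrates to one on a neighbourhood of θ. The
hazard moment is a function of P̄, which belongs to every I(k, m), so R annihilates it. As P̄ is
gamma with shape T given A, E[1/P̄ | A] = e^A/(T-1) and, for T ≥ 3, E[1/P̄² | A] =
e^{2A}/((T-1)(T-2)). The centred moment has mean zero and lies in the kernel of R, hence in the
double orthocomplement of the scores, which is 𝒯. -/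

namespace MPH
open scoped ENNReal

/-! ### Integrated hazards -/

/-- A baseline hazard on `(0, ∞)`: measurable, positive, with finite and divergent integral. -/
structure IsHazard (l : ℝ → ℝ) : Prop where
  meas : Measurable l
  pos : ∀ y : ℝ, 0 < y → 0 < l y
  int : ∀ y : ℝ, 0 < y → IntegrableOn l (Ioc 0 y)
  top : Tendsto (fun y : ℝ => ∫ u in (0 : ℝ)..y, l u) atTop atTop

namespace IsHazard

variable {l : ℝ → ℝ}

lemma measurable_integral (hl : Measurable l) :
    Measurable fun y : ℝ => ∫ u in (0 : ℝ)..y, l u := by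
  have h1 : Measurable fun y : ℝ => ∫ u, (Ioc 0 y).indicator l u := by
    have hm : Measurable (Function.uncurry fun (y u : ℝ) => (Ioc 0 y).indicator l u) := by
      have : (Function.uncurry fun (y u : ℝ) => (Ioc 0 y).indicator l u)
          = {p : ℝ × ℝ | 0 < p.2 ∧ p.2 ≤ p.1}.indicator fun p => l p.2 := by
        ext ⟨y, u⟩
        simp [Function.uncurry, indicator]
      rw [this]
      exact (hl.comp measurable_snd).indicator
        ((measurableSet_lt measurable_const measurable_snd).inter
          (measurableSet_le measurable_snd measurable_fst))
    exact hm.stronglyMeasurable.integral_prod_right.measurable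
  have h2 : Measurable fun y : ℝ => ∫ u, (Ioc y 0).indicator l u := by
    have hm : Measurable (Function.uncurry fun (y u : ℝ) => (Ioc y 0).indicator l u) := by
      have : (Function.uncurry fun (y u : ℝ) => (Ioc y 0).indicator l u)
          = {p : ℝ × ℝ | p.1 < p.2 ∧ p.2 ≤ 0}.indicator fun p => l p.2 := by
        ext ⟨y, u⟩
        simp [Function.uncurry, indicator]
      rw [this]
      exact (hl.comp measurable_snd).indicator
        ((measurableSet_lt measurable_fst measurable_snd).inter
          (measurableSet_le measurable_snd measurable_const))
    exact hm.stronglyMeasurable.integral_prod_right.measurable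
  have : (fun y : ℝ => ∫ u in (0 : ℝ)..y, l u)
      = fun y => (∫ u, (Ioc 0 y).indicator l u) - ∫ u, (Ioc y 0).indicator l u := by
    ext y
    rw [intervalIntegral, integral_indicator measurableSet_Ioc,
      integral_indicator measurableSet_Ioc]
  rw [this]
  exact h1.sub h2

variable (h : IsHazard l)
include h

lemma intervalIntegrable {a b : ℝ} (ha : 0 ≤ a) (hb : 0 ≤ b) :
    IntervalIntegrable l volume a b := by
  have h0 : ∀ c : ℝ, 0 ≤ c → IntervalIntegrable l volume 0 c := by
    intro c hc
    rcases hc.eq_or_lt with rfl | hc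
    · exact IntervalIntegrable.refl
    · exact (intervalIntegrable_iff_integrableOn_Ioc_of_le hc.le).2 (h.int c hc)
  exact (h0 a ha).symm.trans (h0 b hb)

lemma integral_sub {a b : ℝ} (ha : 0 ≤ a) (hb : 0 ≤ b) :
    (∫ u in (0 : ℝ)..b, l u) - ∫ u in (0 : ℝ)..a, l u = ∫ u in a..b, l u :=
  intervalIntegral.integral_interval_sub_left (h.intervalIntegrable le_rfl hb)
    (h.intervalIntegrable le_rfl ha)

lemma strictMonoOn : StrictMonoOn (fun y : ℝ => ∫ u in (0 : ℝ)..y, l u) (Ici 0) := by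
  intro a ha b hb hab
  have := h.integral_sub ha hb
  have hp : 0 < ∫ u in a..b, l u :=
    intervalIntegral.intervalIntegral_pos_of_pos_on (h.intervalIntegrable ha hb)
      (fun x hx => h.pos x (lt_of_le_of_lt ha hx.1)) hab
  simp only
  linarith

lemma integral_pos {y : ℝ} (hy : 0 < y) : 0 < ∫ u in (0 : ℝ)..y, l u := by
  have := h.strictMonoOn (mem_Ici.2 le_rfl) hy.le hy
  simpa using this

lemma exists_eq {p : ℝ} (hp : 0 ≤ p) : ∃ y : ℝ, 0 ≤ y ∧ ∫ u in (0 : ℝ)..y, l u = p := by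
  obtain ⟨Y, hY0, hY⟩ := ((eventually_ge_atTop (1 : ℝ)).and (h.top.eventually_ge_atTop p)).exists
  have hY1 : (0 : ℝ) ≤ Y := by linarith
  have hc : ContinuousOn (fun y : ℝ => ∫ u in (0 : ℝ)..y, l u) (Icc 0 Y) := by
    have := intervalIntegral.continuousOn_primitive_interval (μ := volume) (f := l) (a := 0)
      (b := Y) (by
        rw [uIcc_of_le hY1, integrableOn_Icc_iff_integrableOn_Ioc]
        exact h.int Y (by linarith))
    rwa [uIcc_of_le hY1] at this
  obtain ⟨y, hy, hyp⟩ := intermediate_value_Icc hY1 hc (show p ∈ _ from ⟨by simpa using hp, hY⟩)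
  exact ⟨y, hy.1, hyp⟩

/-- The integrated hazard has a measurable left inverse on `[0, ∞)`. -/
lemma exists_leftInverse : ∃ v : ℝ → ℝ, Measurable v ∧
    ∀ y : ℝ, 0 ≤ y → v (∫ u in (0 : ℝ)..y, l u) = y := by
  have hne : ∀ p : ℝ, 0 ≤ p → {y : ℝ | 0 ≤ y ∧ ∫ u in (0 : ℝ)..y, l u ≤ p}.Nonempty :=
    fun p hp => ⟨0, le_rfl, by simpa using hp⟩
  have hbd : ∀ p : ℝ, BddAbove {y : ℝ | 0 ≤ y ∧ ∫ u in (0 : ℝ)..y, l u ≤ p} := by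
    intro p
    obtain ⟨y, hy, hyp⟩ := h.exists_eq (le_max_right p 0)
    refine ⟨y, fun z hz => ?_⟩
    by_contra! hlt
    have := h.strictMonoOn hy hz.1 hlt
    simp only [hyp] at this
    exact absurd (hz.2.trans (le_max_left p 0)) (not_le.2 this)
  -- The supremum of a sublevel set is monotone in p, hence measurable with no appeal to regularity
  -- of the hazard. For p < 0 the set is empty and the supremum is 0 by convention, which keeps
  -- monotonicity.
  refine ⟨fun p => sSup {y : ℝ | 0 ≤ y ∧ ∫ u in (0 : ℝ)..y, l u ≤ p}, Monotone.measurable ?_, ?_⟩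
  · intro p p' hpp
    rcases lt_or_ge p 0 with hp | hp
    · have : {y : ℝ | 0 ≤ y ∧ ∫ u in (0 : ℝ)..y, l u ≤ p} = ∅ := by
        ext y
        simp only [mem_ofPred_eq, mem_empty_iff_false, iff_false, not_and, not_le]
        intro hy
        have := h.strictMonoOn.monotoneOn (mem_Ici.2 le_rfl) hy hy
        simp at this
        linarith
      simp only [this, Real.sSup_empty]
      exact Real.sSup_nonneg fun y hy => hy.1
    · exact csSup_le_csSup (hbd p') (hne p hp) fun y hy => ⟨hy.1, hy.2.trans hpp⟩
  · intro y hy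
    refine IsGreatest.csSup_eq ⟨⟨hy, le_rfl⟩, fun z hz => ?_⟩
    exact (h.strictMonoOn.le_iff_le hz.1 hy).1 hz.2

/-- The integrated hazard is an increasing bijection of [0, ∞), so the preimage of an interval is
the interval between the preimages of its endpoints, and its mass under the hazard is the difference
of the two values. Working with intervals avoids differentiating an integral of a hazard that is
merely measurable. -/
lemma map_integral :
    ((volume.restrict (Ioi (0 : ℝ))).withDensity fun y => ENNReal.ofReal (l y)).map
      (fun y : ℝ => ∫ u in (0 : ℝ)..y, l u) = volume.restrict (Ioi 0) := by
  symm
  refine Measure.ext_of_Ioc _ _ fun a b hab => ?_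
  have hLm := measurable_integral h.meas
  rw [Measure.map_apply hLm measurableSet_Ioc, Measure.restrict_apply measurableSet_Ioc,
    withDensity_apply _ (hLm measurableSet_Ioc), Measure.restrict_restrict (hLm measurableSet_Ioc)]
  rcases le_or_gt b 0 with hb | hb
  · have e1 : Ioc a b ∩ Ioi 0 = ∅ := by
      ext x; simp only [mem_inter_iff, mem_Ioc, mem_Ioi, mem_empty_iff_false, iff_false]
      rintro ⟨⟨_, h1⟩, h2⟩; linarith
    have e2 : (fun y : ℝ => ∫ u in (0 : ℝ)..y, l u) ⁻¹' Ioc a b ∩ Ioi 0 = ∅ := by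
      ext x; simp only [mem_inter_iff, mem_preimage, mem_Ioc, mem_Ioi, mem_empty_iff_false,
        iff_false]
      rintro ⟨⟨_, h1⟩, h2⟩
      have := h.integral_pos h2
      linarith
    simp [e1, e2]
  · obtain ⟨ya, hya, hya'⟩ := h.exists_eq (le_max_right a 0)
    obtain ⟨yb, hyb, hyb'⟩ := h.exists_eq hb.le
    have e1 : Ioc a b ∩ Ioi 0 = Ioc (max a 0) b := by
      ext x; simp only [mem_inter_iff, mem_Ioc, mem_Ioi, max_lt_iff]; tauto
    have e2 : (fun y : ℝ => ∫ u in (0 : ℝ)..y, l u) ⁻¹' Ioc a b ∩ Ioi 0 = Ioc ya yb := by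
      ext x
      simp only [mem_inter_iff, mem_preimage, mem_Ioc, mem_Ioi]
      constructor
      · rintro ⟨⟨h1, h2⟩, h3⟩
        have hx := h.integral_pos h3
        refine ⟨(h.strictMonoOn.lt_iff_lt hya h3.le).1 ?_,
          (h.strictMonoOn.le_iff_le h3.le hyb).1 ?_⟩
        · simp only [hya']; exact max_lt h1 hx
        · simpa only [hyb'] using h2
      · rintro ⟨h1, h2⟩
        have h3 : 0 < x := lt_of_le_of_lt hya h1
        have q1 := (h.strictMonoOn.lt_iff_lt hya h3.le).2 h1
        have q2 := (h.strictMonoOn.le_iff_le h3.le hyb).2 h2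
        simp only [hya', hyb'] at q1 q2
        exact ⟨⟨lt_of_le_of_lt (le_max_left _ _) q1, q2⟩, h3⟩
    have hyab : ya ≤ yb := by
      refine (h.strictMonoOn.le_iff_le hya hyb).1 ?_
      simp only [hya', hyb']
      exact max_le hab.le hb.le
    have hint := h.intervalIntegrable hya hyb
    rw [e1, e2, Real.volume_Ioc, ← ofReal_integral_eq_lintegral_ofReal
      ((intervalIntegrable_iff_integrableOn_Ioc_of_le hyab).1 hint),
      ← intervalIntegral.integral_of_le hyab, ← h.integral_sub hya hyb, hya', hyb']
    exact (ae_restrict_mem measurableSet_Ioc).mono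
      fun x hx => (h.pos x (lt_of_le_of_lt hya hx.1)).le

/-- The substitution p = Λ(y), dp = λ(y) dy, read off from the pushforward. -/
lemma lintegral_comp {F : ℝ → ℝ≥0∞} (hF : Measurable F) :
    ∫⁻ y in Ioi (0 : ℝ), F (∫ u in (0 : ℝ)..y, l u) * ENNReal.ofReal (l y)
      = ∫⁻ p in Ioi (0 : ℝ), F p := by
  conv_rhs => rw [← h.map_integral]
  have hLm := measurable_integral h.meas
  rw [lintegral_map hF hLm]
  refine Eq.trans ?_ (lintegral_withDensity_eq_lintegral_mul _ h.meas.ennreal_ofReal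
    (hF.comp hLm)).symm
  simp [mul_comm]

end IsHazard

/-! ### Gamma and beta densities -/

/-- Scaling of the half line. -/
lemma lintegral_Ioi_comp_mul {c : ℝ} (hc : 0 < c) {F : ℝ → ℝ≥0∞} (hF : Measurable F) :
    ∫⁻ p in Ioi (0 : ℝ), F p = ENNReal.ofReal c * ∫⁻ b in Ioi (0 : ℝ), F (b * c) := by
  have hm : Measurable fun p => (Ioi (0 : ℝ)).indicator F p := hF.indicator measurableSet_Ioi
  rw [← lintegral_indicator measurableSet_Ioi, ← lintegral_indicator measurableSet_Ioi]
  have h := Real.smul_map_volume_mul_right hc.ne'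
  conv_lhs => rw [← h, lintegral_smul_measure, lintegral_map hm (measurable_mul_const c)]
  rw [abs_of_pos hc, smul_eq_mul]
  congr 1
  refine lintegral_congr fun b => ?_
  by_cases hb : 0 < b
  · simp [indicator, hb, mul_pos hb hc]
  · have : ¬ 0 < b * c := by rw [mul_pos_iff_of_pos_right hc]; exact hb
    simp [indicator, hb, this]

/-- Density on `(0, ∞)` of the gamma distribution with shape `m + 1` and rate `eᵃ`. -/
noncomputable def gden (m : ℕ) (a q : ℝ) : ℝ≥0∞ :=
  ENNReal.ofReal (Real.exp a ^ (m + 1) * (q ^ m / m.factorial) * Real.exp (-(q * Real.exp a)))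

/-- Density on `(0, 1)` of the beta distribution with parameters `1` and `m + 1`. -/
noncomputable def bden (m : ℕ) (b : ℝ) : ℝ≥0∞ := ENNReal.ofReal ((m + 1) * (1 - b) ^ m)

/-- The beta distribution with parameters `1` and `m + 1`. -/
noncomputable def betaLaw (m : ℕ) : Measure ℝ :=
  (volume.restrict (Ioo (0 : ℝ) 1)).withDensity (bden m)

lemma measurable_gden (m : ℕ) : Measurable fun z : ℝ × ℝ => gden m z.1 z.2 := by
  unfold gden; fun_prop

@[fun_prop]
lemma _root_.Measurable.gden {α : Type*} [MeasurableSpace α] {m : ℕ} {f g : α → ℝ}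
    (hf : Measurable f) (hg : Measurable g) : Measurable fun x => MPH.gden m (f x) (g x) :=
  (measurable_gden m).comp (hf.prodMk hg)

lemma measurable_bden (m : ℕ) : Measurable (bden m) := by
  unfold bden; fun_prop

lemma gden_ne_top (m : ℕ) (a q : ℝ) : gden m a q ≠ ⊤ := ENNReal.ofReal_ne_top

/-- If `P` is exponential and `Q` an independent gamma variable with the same rate, then
`P / (P + Q)` is beta, independent of the gamma variable `P + Q`. -/
lemma lintegral_gden_gden (m : ℕ) (a : ℝ) {F : ℝ → ℝ → ℝ≥0∞}
    (hF : Measurable (Function.uncurry F)) :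
    ∫⁻ p in Ioi (0 : ℝ), ∫⁻ q in Ioi (0 : ℝ), F p (p + q) * gden m a q * gden 0 a p
      = ∫⁻ w in Ioi (0 : ℝ), (∫⁻ b, F (b * w) w ∂(betaLaw m)) * gden (m + 1) a w := by
  have hF' : ∀ {f g : ℝ × ℝ → ℝ}, Measurable f → Measurable g →
      Measurable fun z => F (f z) (g z) := fun hf hg => hF.comp (hf.prodMk hg)
  have hF1 : ∀ {f g : ℝ → ℝ}, Measurable f → Measurable g →
      Measurable fun z => F (f z) (g z) := fun hf hg => hF.comp (hf.prodMk hg)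
  have h1 : ∀ p : ℝ, ∫⁻ q in Ioi (0 : ℝ), F p (p + q) * gden m a q * gden 0 a p
      = ∫⁻ w, (Ioi p).indicator (fun w => F p w * gden m a (w - p) * gden 0 a p) w := by
    intro p
    rw [← lintegral_indicator measurableSet_Ioi,
      -- Substitute w = p + q for fixed p, so that the sum becomes an integration variable.
      ← lintegral_sub_right_eq_self (fun q => (Ioi (0 : ℝ)).indicator _ q) p]
    refine lintegral_congr fun w => ?_
    simp [indicator]
  simp_rw [h1]
  rw [lintegral_lintegral_swap]
  swap
  · have : (Function.uncurry fun (p w : ℝ) =>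
        (Ioi p).indicator (fun w => F p w * gden m a (w - p) * gden 0 a p) w)
        = {z : ℝ × ℝ | z.1 < z.2}.indicator
            (fun z => F z.1 z.2 * gden m a (z.2 - z.1) * gden 0 a z.1) := by
      ext ⟨p, w⟩; simp [indicator, Function.uncurry]
    rw [this]
    refine (Measurable.indicator ?_ (measurableSet_lt measurable_fst measurable_snd)).aemeasurable
    exact ((hF' measurable_fst measurable_snd).mul (by fun_prop)).mul (by fun_prop)
  rw [← lintegral_indicator measurableSet_Ioi]
  refine lintegral_congr fun w => ?_
  by_cases hw : 0 < w
  swap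
  · rw [indicator_of_notMem (by simpa using hw)]
    refine (setLIntegral_congr_fun measurableSet_Ioi fun p hp => ?_).trans (lintegral_zero)
    rw [indicator_of_notMem]
    simp only [mem_Ioi, not_lt] at *
    linarith
  rw [indicator_of_mem (by simpa using hw)]
  have hm1 : Measurable fun p => (Ioi p).indicator
      (fun w => F p w * gden m a (w - p) * gden 0 a p) w := by
    have : (fun p => (Ioi p).indicator (fun w => F p w * gden m a (w - p) * gden 0 a p) w)
        = (Iio w).indicator (fun p => F p w * gden m a (w - p) * gden 0 a p) := by
      ext p; simp [indicator]
    rw [this]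
    refine Measurable.indicator ?_ measurableSet_Iio
    exact ((hF1 measurable_id measurable_const).mul (by fun_prop)).mul (by fun_prop)
  -- Substitute p = b w for fixed w; the constraint p < w becomes b < 1.
  rw [lintegral_Ioi_comp_mul hw hm1, betaLaw, lintegral_withDensity_eq_lintegral_mul _
    (measurable_bden m) (hF1 (by fun_prop) measurable_const),
    ← lintegral_const_mul' _ _ ENNReal.ofReal_ne_top, ← lintegral_mul_const' _ _ (gden_ne_top _ _ _),
    ← lintegral_indicator measurableSet_Ioi, ← lintegral_indicator measurableSet_Ioo]
  refine lintegral_congr fun b => ?_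
  by_cases hb : 0 < b
  swap
  · rw [indicator_of_notMem (by simpa using hb), indicator_of_notMem (by simp; intro h; exact absurd h hb)]
  rw [indicator_of_mem (by simpa using hb)]
  by_cases hb1 : b < 1
  swap
  · have : ¬ b * w < w := by
      rw [not_lt]; nlinarith
    rw [indicator_of_notMem (s := Ioo (0 : ℝ) 1) (by simp; intro _; linarith),
      indicator_of_notMem (by simpa using this), mul_zero]
  have : b * w < w := by nlinarith
  rw [indicator_of_mem (s := Ioo (0 : ℝ) 1) ⟨hb, hb1⟩, indicator_of_mem (by simpa using this)]
  -- The exponentials multiply to e^{-w e^a} and the powers to w^{m+1} (1 - b)^m. The factor m + 1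
  -- of the beta density is what turns 1/m! into 1/(m+1)!.
  have key : ENNReal.ofReal w * gden m a (w - b * w) * gden 0 a (b * w)
      = bden m b * gden (m + 1) a w := by
    unfold gden bden
    have hbw : 0 ≤ 1 - b := by linarith
    have hww : 0 ≤ w - b * w := by linarith
    rw [← ENNReal.ofReal_mul hw.le, ← ENNReal.ofReal_mul (by positivity),
      ← ENNReal.ofReal_mul (by positivity)]
    congr 1
    have e1 : w - b * w = w * (1 - b) := by ring
    have e2 : Real.exp (-(w * Real.exp a))
        = Real.exp (-((w - b * w) * Real.exp a)) * Real.exp (-(b * w * Real.exp a)) := by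
      rw [← Real.exp_add]; congr 1; ring
    rw [e2, Nat.factorial_succ, e1, mul_pow]
    push_cast
    field_simp
    ring
  simp only [Pi.mul_apply]
  calc _ = F (b * w) w * (ENNReal.ofReal w * gden m a (w - b * w) * gden 0 a (b * w)) := by ring
    _ = _ := by rw [key]; ring

lemma lintegral_gden (m : ℕ) (a : ℝ) : ∫⁻ q in Ioi (0 : ℝ), gden m a q = 1 := by
  have h := ProbabilityTheory.lintegral_gammaPDF_eq_one (a := m + 1) (r := Real.exp a)
    (by positivity) (Real.exp_pos a)
  rw [← h, ← lintegral_indicator measurableSet_Ioi]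
  refine lintegral_congr_ae ?_
  filter_upwards [compl_mem_ae_iff.2 (measure_singleton (0 : ℝ))] with q hq
  have hq : q ≠ 0 := hq
  rcases lt_or_gt_of_ne hq with hq | hq
  · rw [indicator_of_notMem (by simpa using hq.le), ProbabilityTheory.gammaPDF_of_neg hq]
  · rw [indicator_of_mem (by simpa using hq), ProbabilityTheory.gammaPDF_of_nonneg hq.le, gden]
    congr 1
    rw [Real.Gamma_nat_eq_factorial]
    have e1 : Real.exp a ^ ((m : ℝ) + 1) = Real.exp a ^ (m + 1) := by
      rw [← Real.rpow_natCast]; push_cast; rfl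
    have e2 : q ^ ((m : ℝ) + 1 - 1) = q ^ m := by
      rw [add_sub_cancel_right, Real.rpow_natCast]
    rw [e1, e2, mul_comm q]
    ring

end MPH

namespace MPH
open scoped ENNReal
open ProbabilityTheory

/-! ### Uniqueness of the Laplace transform -/

lemma integrableOn_mul_exp_of_le {v : ℝ → ℝ} (hv : Measurable v) {s t : ℝ} (hst : s ≤ t)
    (h : IntegrableOn (fun q => v q * Real.exp (t * q)) (Ioi 0)) :
    IntegrableOn (fun q => v q * Real.exp (s * q)) (Ioi 0) := by
  refine Integrable.mono h (by fun_prop) ?_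
  refine (ae_restrict_mem measurableSet_Ioi).mono fun q hq => ?_
  have hq : 0 < q := hq
  rw [norm_mul, norm_mul, Real.norm_eq_abs (Real.exp _), Real.norm_eq_abs (Real.exp _), Real.abs_exp,
    Real.abs_exp]
  gcongr

/-- The positive and negative parts of v(q) e^{t₀ q} are densities of finite measures whose complex
moment generating functions are analytic on Re z < t₁ - t₀, a half plane containing the imaginary
axis because t₀ < t₁. They agree at points accumulating at 0, hence on the whole half plane; on the
imaginary axis this is equality of characteristic functions, so the two measures coincide and both
parts vanish. -/
lemma ae_eq_zero_of_frequently_integral_mul_exp_eq_zero {v : ℝ → ℝ} (hv : Measurable v)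
    {t₀ t₁ : ℝ} (ht : t₀ < t₁) (hint : IntegrableOn (fun q => v q * Real.exp (t₁ * q)) (Ioi 0))
    (hz : ∃ᶠ t in 𝓝[≠] t₀, ∫ q in Ioi (0 : ℝ), v q * Real.exp (t * q) = 0) :
    ∀ᵐ q ∂(volume.restrict (Ioi (0 : ℝ))), v q = 0 := by
  set w : ℝ → ℝ := fun q => v q * Real.exp (t₀ * q) with hw
  have hwm : Measurable w := by fun_prop
  have hwi : IntegrableOn w (Ioi 0) := integrableOn_mul_exp_of_le hv ht.le hint
  let M : (ℝ → ℝ) → Measure ℝ := fun f =>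
    (volume.restrict (Ioi (0 : ℝ))).withDensity fun q => ENNReal.ofReal (f q)
  have hfin : ∀ {f : ℝ → ℝ}, IntegrableOn f (Ioi 0) → IsFiniteMeasure (M f) := by
    intro f hf
    exact isFiniteMeasure_withDensity_ofReal hf.2
  have : IsFiniteMeasure (M w) := hfin hwi
  have : IsFiniteMeasure (M fun q => -w q) := hfin hwi.neg
  have hexp : ∀ {f : ℝ → ℝ}, Measurable f → (∀ q, |f q| = |w q|) → ∀ s : ℝ, s < t₁ - t₀ →
      Integrable (fun q => max (f q) 0 * Real.exp (s * q)) (volume.restrict (Ioi (0 : ℝ))) := by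
    intro f hf hfw s hs
    have h1 := integrableOn_mul_exp_of_le hv (s := s + t₀) (by linarith) hint
    refine Integrable.mono h1 (by fun_prop) (ae_of_all _ fun q => ?_)
    rw [norm_mul, norm_mul, add_mul, Real.exp_add, norm_mul]
    have h2 : ‖max (f q) 0‖ ≤ ‖v q‖ * ‖Real.exp (t₀ * q)‖ := by
      rw [← norm_mul]
      have := hfw q
      simp only [hw] at this
      rw [Real.norm_eq_abs, Real.norm_eq_abs, ← this, abs_of_nonneg (le_max_right _ _)]
      exact max_le (le_abs_self _) (abs_nonneg _)
    calc _ ≤ ‖v q‖ * ‖Real.exp (t₀ * q)‖ * ‖Real.exp (s * q)‖ := by gcongr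
      _ = _ := by ring
  have hset : ∀ {f : ℝ → ℝ}, Measurable f → (∀ q, |f q| = |w q|) →
      Iio (t₁ - t₀) ⊆ integrableExpSet id (M f) := by
    intro f hf hfw s hs
    change Integrable (fun q => Real.exp (s * id q)) (M f)
    rw [integrable_withDensity_iff_integrable_smul' hf.ennreal_ofReal (by simp)]
    simpa [ENNReal.toReal_ofReal'] using hexp hf hfw s hs
  have hmgf : ∀ {f : ℝ → ℝ}, Measurable f → ∀ s : ℝ, mgf id (M f) s
      = ∫ q in Ioi (0 : ℝ), max (f q) 0 * Real.exp (s * q) := by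
    intro f hf s
    rw [mgf, integral_withDensity_eq_integral_toReal_smul hf.ennreal_ofReal (by simp)]
    simp [ENNReal.toReal_ofReal']
  have hU : ∀ {f : ℝ → ℝ}, Measurable f → (∀ q, |f q| = |w q|) →
      AnalyticOnNhd ℂ (complexMGF id (M f)) {z | z.re < t₁ - t₀} := by
    intro f hf hfw
    refine analyticOnNhd_complexMGF.mono fun z hz => ?_
    exact interior_mono (hset hf hfw) (by rw [interior_Iio]; exact hz)
  have hpre : IsPreconnected {z : ℂ | z.re < t₁ - t₀} :=
    (convex_halfSpace_re_lt _).isPreconnected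
  have hfreq : ∃ᶠ z in 𝓝[≠] (0 : ℂ), complexMGF id (M w) z = complexMGF id (M fun q => -w q) z := by
    have h1 : Tendsto (fun t : ℝ => ((t - t₀ : ℝ) : ℂ)) (𝓝[≠] t₀) (𝓝[≠] 0) := by
      refine tendsto_nhdsWithin_of_tendsto_nhds_of_eventually_within _ ?_ ?_
      · have : Continuous fun t : ℝ => ((t - t₀ : ℝ) : ℂ) := by fun_prop
        have h := this.tendsto t₀
        simp only [sub_self, Complex.ofReal_zero] at h
        exact h.mono_left nhdsWithin_le_nhds
      · filter_upwards [self_mem_nhdsWithin] with t ht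
        simp only [mem_compl_iff, mem_singleton_iff, Complex.ofReal_eq_zero]
        exact sub_ne_zero.2 ht
    have hev : ∀ᶠ t in 𝓝[≠] t₀, t < t₁ :=
      nhdsWithin_le_nhds (Iio_mem_nhds ht)
    refine h1.frequently ((hz.and_eventually hev).mono fun t ht' => ?_)
    obtain ⟨h0, hlt⟩ := ht'
    rw [complexMGF_ofReal, complexMGF_ofReal, hmgf hwm, hmgf (f := fun q => -w q) hwm.neg]
    congr 1
    rw [← sub_eq_zero, ← integral_sub (hexp hwm (fun _ => rfl) (t - t₀) (by linarith))
      (hexp (f := fun q => -w q) hwm.neg (fun _ => abs_neg _) (t - t₀) (by linarith))]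
    refine Eq.trans ?_ h0
    refine integral_congr_ae (ae_of_all _ fun q => ?_)
    have e1 : max (w q) 0 - max (-w q) 0 = w q := by
      rcases le_total (w q) 0 with h | h
      · rw [max_eq_right h, max_eq_left (by linarith)]; ring
      · rw [max_eq_left h, max_eq_right (by linarith)]; ring
    simp only
    rw [← sub_mul, e1, hw]
    simp only
    rw [mul_assoc, ← Real.exp_add]
    congr 2
    ring
  have heq := (hU hwm (fun _ => rfl)).eqOn_of_preconnected_of_frequently_eq
    (hU hwm.neg (fun _ => abs_neg _)) hpre (by simpa using ht) hfreq
  have hMM : M w = M fun q => -w q := by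
    refine Measure.ext_of_charFun ?_
    ext s
    rw [← complexMGF_id_mul_I, ← complexMGF_id_mul_I]
    exact heq (by simpa using ht)
  have h2 := (withDensity_eq_iff hwm.ennreal_ofReal.aemeasurable hwm.neg.ennreal_ofReal.aemeasurable
    (by
      have := measure_ne_top (M w) univ
      simpa [M] using this)).1 hMM
  filter_upwards [h2] with q hq
  have h3 : w q = 0 := by
    have h4 := congrArg ENNReal.toReal hq
    rw [ENNReal.toReal_ofReal', ENNReal.toReal_ofReal'] at h4
    rcases le_total (w q) 0 with h | h
    · rw [max_eq_right h, Pi.neg_apply, max_eq_left (by linarith)] at h4; linarith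
    · rw [max_eq_left h, Pi.neg_apply, max_eq_right (by linarith)] at h4; linarith
  rw [hw] at h3
  exact (mul_eq_zero.1 h3).resolve_right (Real.exp_pos _).ne'

lemma toReal_gden {m : ℕ} {a q : ℝ} (hq : 0 ≤ q) : (gden m a q).toReal
    = Real.exp a ^ (m + 1) * (q ^ m / m.factorial) * Real.exp (-(q * Real.exp a)) := by
  rw [gden, ENNReal.toReal_ofReal (by positivity)]

/-- The family of gamma distributions with rates `eᵃ` is complete as soon as `a` ranges over a set
of positive measure. -/
theorem ae_eq_zero_of_integral_gden_eq_zero {m : ℕ} {w : ℝ → ℝ} (hw : Measurable w) {A : Set ℝ}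
    (hA : volume A ≠ 0) (h : ∀ᵐ a, a ∈ A →
      Integrable (fun q => w q * (gden m a q).toReal) (volume.restrict (Ioi 0)) ∧
        ∫ q in Ioi (0 : ℝ), w q * (gden m a q).toReal = 0) :
    ∀ᵐ q ∂(volume.restrict (Ioi (0 : ℝ))), w q = 0 := by
  set v : ℝ → ℝ := fun q => w q * q ^ m with hv
  have hvm : Measurable v := by fun_prop
  have hform : ∀ a : ℝ, (fun q => w q * (gden m a q).toReal) =ᵐ[volume.restrict (Ioi (0 : ℝ))]
      fun q => (Real.exp a ^ (m + 1) / m.factorial) * (v q * Real.exp (-Real.exp a * q)) := by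
    intro a
    filter_upwards [ae_restrict_mem measurableSet_Ioi] with q hq
    rw [toReal_gden (le_of_lt hq), hv]
    have : -(q * Real.exp a) = -Real.exp a * q := by ring
    rw [this]
    ring
  set E : Set ℝ := {a | IntegrableOn (fun q => v q * Real.exp (-Real.exp a * q)) (Ioi 0) ∧
    ∫ q in Ioi (0 : ℝ), v q * Real.exp (-Real.exp a * q) = 0} with hE
  have hAE : ∀ᵐ a, a ∈ A → a ∈ E := by
    filter_upwards [h] with a ha haA
    obtain ⟨h1, h2⟩ := ha haA
    rw [integrable_congr (hform a)] at h1
    rw [integral_congr_ae (hform a), integral_const_mul] at h2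
    have hc : Real.exp a ^ (m + 1) / (m.factorial : ℝ) ≠ 0 := by positivity
    refine ⟨?_, (mul_eq_zero.1 h2).resolve_left hc⟩
    rw [IntegrableOn]
    have := h1.const_mul (Real.exp a ^ (m + 1) / (m.factorial : ℝ))⁻¹
    simpa only [← mul_assoc, inv_mul_cancel₀ hc, one_mul] using this
  have hE0 : volume E ≠ 0 := fun h0 => hA (by
    refine measure_mono_null_ae ?_ h0
    filter_upwards [hAE] with a ha using ha)
  -- A smaller point b of E is needed to have integrability at -e^b > -e^x, strictly to the right of
  -- the point of accumulation. Requiring it removes at most one point of E.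
  set E' : Set ℝ := {a | a ∈ E ∧ ∃ b ∈ E, b < a} with hE'
  have hsub : (E \ E').Subsingleton := by
    intro a ha b hb
    by_contra hab
    rcases lt_or_gt_of_ne hab with hlt | hlt
    · exact hb.2 ⟨hb.1, a, ha.1, hlt⟩
    · exact ha.2 ⟨ha.1, b, hb.1, hlt⟩
  have hE'0 : volume E' ≠ 0 := fun h0 => hE0 (by
    have h1 : volume (E \ E') = 0 := hsub.measure_zero _
    refine measure_mono_null (t := E' ∪ E \ E') (fun x hx => ?_) (measure_union_null h0 h1)
    by_cases hx' : x ∈ E'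
    · exact Or.inl hx'
    · exact Or.inr ⟨hx, hx'⟩)
  -- A set of positive measure has a point all of whose relative neighbourhoods have positive
  -- measure; since a single point is null, E accumulates there.
  obtain ⟨x, hx, hpos⟩ := exists_mem_forall_mem_nhdsWithin_pos_measure hE'0
  obtain ⟨hxE, b, hbE, hbx⟩ := hx
  have hfr : ∃ᶠ a in 𝓝[≠] x, a ∈ E := by
    rw [frequently_iff]
    intro U hU
    have h1 : U ∪ {x} ∈ 𝓝[E'] x := by
      refine nhdsWithin_le_nhds ?_
      rw [mem_nhdsWithin_iff_eventually] at hU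
      filter_upwards [hU] with y hy
      by_cases hyx : y = x
      · exact Or.inr hyx
      · exact Or.inl (hy hyx)
    have h2 : (U ∪ {x}) ∩ E' ∈ 𝓝[E'] x := inter_mem h1 self_mem_nhdsWithin
    have h3 := hpos _ h2
    by_contra! hcon
    have h4 : (U ∪ {x}) ∩ E' ⊆ {x} := by
      rintro y ⟨hy | hy, hyE⟩
      · exact absurd hyE.1 (hcon y hy)
      · exact hy
    exact absurd (measure_mono_null h4 (measure_singleton x)) h3.ne'
  have hmap : Tendsto (fun a : ℝ => -Real.exp a) (𝓝[≠] x) (𝓝[≠] (-Real.exp x)) := by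
    refine tendsto_nhdsWithin_of_tendsto_nhds_of_eventually_within _ ?_ ?_
    · exact (Real.continuous_exp.neg.tendsto x).mono_left nhdsWithin_le_nhds
    · filter_upwards [self_mem_nhdsWithin] with t ht
      simp only [mem_compl_iff, mem_singleton_iff, neg_inj]
      exact fun he => ht (Real.exp_injective he)
  have hfinal := ae_eq_zero_of_frequently_integral_mul_exp_eq_zero hvm (t₀ := -Real.exp x)
    (t₁ := -Real.exp b) (neg_lt_neg (Real.exp_lt_exp.2 hbx)) hbE.1
    (hmap.frequently (hfr.mono fun a ha => ha.2))
  filter_upwards [hfinal, ae_restrict_mem measurableSet_Ioi] with q hq hq0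
  have hq0 : 0 < q := hq0
  rw [hv] at hq
  exact (mul_eq_zero.1 hq).resolve_right (by positivity)

end MPH

namespace MPH
open scoped ENNReal

variable {n q d : ℕ}

/-! ### Past information -/

lemma Obs.y_zero (o : Obs n d) : o.y 0 = o.1.1 := rfl
lemma Obs.y_succ (o : Obs n d) (i : Fin (n + 1)) : o.y i.succ = o.2.1 i := rfl
lemma Obs.x_zero (o : Obs n d) : o.x 0 = o.1.2 := rfl
lemma Obs.x_succ (o : Obs n d) (j : Fin n) : o.x j.succ = o.2.2 j := rfl

/-- Keeps `y₀, …, y_k` and `x₁, …, x_{m+1}`, and replaces the other coordinates by `0`. -/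
def tau (k m : ℕ) (o : Obs n d) : Obs n d :=
  (o.1, fun i => if i.val < k then o.2.1 i else 0, fun j => if j.val < m then o.2.2 j else 0)

/-- Replaces the duration `y_{i+1}`. -/
def updY (o : Obs n d) (i : Fin (n + 1)) (y : ℝ) : Obs n d :=
  (o.1, Function.update o.2.1 i y, o.2.2)

/-- Replaces the covariate `x_{j+2}`. -/
def updX (o : Obs n d) (j : Fin n) (x : Cov d) : Obs n d :=
  (o.1, o.2.1, Function.update o.2.2 j x)

@[fun_prop]
lemma measurable_tau (k m : ℕ) : Measurable (tau k m : Obs n d → Obs n d) := by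
  unfold tau
  refine measurable_fst.prodMk (Measurable.prodMk ?_ ?_)
  · refine measurable_pi_lambda _ fun i => ?_
    split_ifs <;> fun_prop
  · refine measurable_pi_lambda _ fun i => ?_
    split_ifs <;> fun_prop

lemma measurable_updY (i : Fin (n + 1)) :
    Measurable fun p : Obs n d × ℝ => updY p.1 i p.2 := by
  unfold updY
  refine (measurable_fst.comp measurable_fst).prodMk (Measurable.prodMk ?_ (by fun_prop))
  refine measurable_pi_lambda _ fun i' => ?_
  by_cases h : i' = i
  · subst h; simpa using measurable_snd
  · simp only [Function.update_of_ne h]; fun_prop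

lemma measurable_updX (j : Fin n) :
    Measurable fun p : Obs n d × Cov d => updX p.1 j p.2 := by
  unfold updX
  refine (measurable_fst.comp measurable_fst).prodMk (Measurable.prodMk (by fun_prop) ?_)
  refine measurable_pi_lambda _ fun i' => ?_
  by_cases h : i' = j
  · subst h; simpa using measurable_snd
  · simp only [Function.update_of_ne h]; fun_prop

@[fun_prop]
lemma measurable_y (s : Fin (n + 2)) : Measurable fun o : Obs n d => o.y s := by
  refine Fin.cases ?_ (fun i => ?_) s
  · simp only [Obs.y_zero]; fun_prop
  · simp only [Obs.y_succ]; fun_prop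

@[fun_prop]
lemma measurable_x (s : Fin (n + 1)) : Measurable fun o : Obs n d => o.x s := by
  refine Fin.cases ?_ (fun i => ?_) s
  · simp only [Obs.x_zero]; fun_prop
  · simp only [Obs.x_succ]; fun_prop

@[fun_prop]
lemma measurable_past (j : Fin n) : Measurable fun o : Obs n d => o.past j := by
  unfold Obs.past; fun_prop

lemma tau_y {k m : ℕ} (o : Obs n d) {s : Fin (n + 2)} (hs : s.val ≤ k) :
    (tau k m o).y s = o.y s := by
  refine Fin.cases (fun _ => rfl) (fun i hi => ?_) s hs
  rw [Obs.y_succ, Obs.y_succ, tau]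
  exact if_pos (by simpa using hi)

lemma tau_x {k m : ℕ} (o : Obs n d) {s : Fin (n + 1)} (hs : s.val ≤ m) :
    (tau k m o).x s = o.x s := by
  refine Fin.cases (fun _ => rfl) (fun i hi => ?_) s hs
  rw [Obs.x_succ, Obs.x_succ, tau]
  exact if_pos (by simpa using hi)

lemma tau_past {k m : ℕ} (o : Obs n d) {j : Fin n} (hk : j.val < k) (hm : j.val ≤ m) :
    (tau k m o).past j = o.past j := by
  unfold Obs.past
  refine Prod.ext (funext fun s => ?_) (funext fun s => ?_)
  · have h : (Fin.castLE (by omega : j.val + 2 ≤ n + 2) s).val ≤ k := by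
      simp only [Fin.val_castLE]; omega
    exact tau_y o h
  · have h : (Fin.castLE (by omega : j.val + 1 ≤ n + 1) s).val ≤ m := by
      simp only [Fin.val_castLE]; omega
    exact tau_x o h

lemma tau_tau {k m k' m' : ℕ} (hk : k ≤ k') (hm : m ≤ m') (o : Obs n d) :
    tau k m (tau k' m' o) = tau k m o := by
  unfold tau
  refine Prod.ext rfl (Prod.ext (funext fun i => ?_) (funext fun i => ?_))
  · simp only
    by_cases h : i.val < k
    · rw [if_pos h, if_pos h, if_pos (by omega)]
    · rw [if_neg h, if_neg h]
  · simp only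
    by_cases h : i.val < m
    · rw [if_pos h, if_pos h, if_pos (by omega)]
    · rw [if_neg h, if_neg h]

lemma tau_updY {k m : ℕ} {i : Fin (n + 1)} (h : k ≤ i.val) (o : Obs n d) (y : ℝ) :
    tau k m (updY o i y) = tau k m o := by
  unfold tau updY
  refine Prod.ext rfl (Prod.ext (funext fun i' => ?_) rfl)
  simp only
  by_cases h' : i'.val < k
  · have : i' ≠ i := by rintro rfl; omega
    rw [if_pos h', if_pos h', Function.update_of_ne this]
  · rw [if_neg h', if_neg h']

lemma tau_updX {k m : ℕ} {j : Fin n} (h : m ≤ j.val) (o : Obs n d) (x : Cov d) :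
    tau k m (updX o j x) = tau k m o := by
  unfold tau updX
  refine Prod.ext rfl (Prod.ext rfl (funext fun i' => ?_))
  simp only
  by_cases h' : i'.val < m
  · have : i' ≠ j := by rintro rfl; omega
    rw [if_pos h', if_pos h', Function.update_of_ne this]
  · rw [if_neg h', if_neg h']

lemma updX_self (o : Obs n d) (j : Fin n) : updX o j (o.x j.succ) = o := by
  unfold updX
  rw [Obs.x_succ, Function.update_eq_self]

lemma updX_x (o : Obs n d) (j : Fin n) (x : Cov d) : (updX o j x).x j.succ = x := by
  rw [Obs.x_succ, updX]; simp

lemma updY_y (o : Obs n d) (i : Fin (n + 1)) (y : ℝ) : (updY o i y).y i.succ = y := by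
  rw [Obs.y_succ, updY]; simp

/-- `H` depends only on `y₀, …, y_k` and `x₁, …, x_{m+1}`. -/
def DependsOnPast {β : Type*} (k m : ℕ) (H : Obs n d → β) : Prop := ∀ o, H (tau k m o) = H o

namespace DependsOnPast

variable {β : Type*} {k m : ℕ} {H : Obs n d → β}

lemma updY (h : DependsOnPast k m H) {i : Fin (n + 1)} (hi : k ≤ i.val) (o : Obs n d) (y : ℝ) :
    H (updY o i y) = H o := by
  rw [← h, tau_updY hi, h]

lemma updX (h : DependsOnPast k m H) {j : Fin n} (hj : m ≤ j.val) (o : Obs n d) (x : Cov d) :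
    H (updX o j x) = H o := by
  rw [← h, tau_updX hj, h]

lemma mono (h : DependsOnPast k m H) {k' m' : ℕ} (hk : k ≤ k') (hm : m ≤ m') :
    DependsOnPast k' m' H := fun o => by
  rw [← h, tau_tau hk hm, h]

end DependsOnPast

/-! ### Measurability of the ingredients of the model. -/

variable (M : Model n q d)

instance : SigmaFinite M.m₀ := M.m₀_sigmaFinite
instance (j : Fin n) : SigmaFinite (M.mX j) := M.mX_sigmaFinite j

variable {M} {θ : Param q d}

lemma Model.isHazard (hθ : θ ∈ M.Θ) : IsHazard (M.haz θ.alpha) :=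
  ⟨M.haz_meas θ hθ, M.haz_pos θ hθ, M.haz_int θ hθ, M.haz_top θ hθ⟩

lemma Model.measurable_Lam (hθ : θ ∈ M.Θ) : Measurable (M.Lam θ.alpha) :=
  IsHazard.measurable_integral (M.haz_meas θ hθ)

lemma Model.measurable_rho (hθ : θ ∈ M.Θ) :
    Measurable fun p : ℝ × ℝ × Cov d => M.rho θ p.1 p.2.1 p.2.2 := by
  unfold Model.rho dotProduct
  have := Model.measurable_Lam hθ
  fun_prop

lemma Model.measurable_spellDensity (hθ : θ ∈ M.Θ) :
    Measurable fun p : (ℝ × ℝ × Cov d) × ℝ => M.spellDensity θ p.1.1 p.1.2.1 p.1.2.2 p.2 := by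
  unfold Model.spellDensity dotProduct
  have h1 := M.haz_meas θ hθ
  have h2 := (Model.measurable_rho hθ).comp
    (measurable_fst : Measurable (Prod.fst : (ℝ × ℝ × Cov d) × ℝ → _))
  have h3 : Measurable fun p : (ℝ × ℝ × Cov d) × ℝ => M.rho θ p.1.1 p.1.2.1 p.1.2.2 := h2
  fun_prop

lemma Model.measurable_P (hθ : θ ∈ M.Θ) (t : Fin (n + 1)) : Measurable fun o => M.P θ o t :=
  (Model.measurable_rho hθ).comp
    ((measurable_y t.succ).prodMk ((measurable_y t.castSucc).prodMk (measurable_x t)))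

lemma dependsOnPast_P (θ : Param q d) (t : Fin (n + 1)) :
    DependsOnPast (t.val + 1) t.val fun o : Obs n d => M.P θ o t := by
  intro o
  unfold Model.P
  beta_reduce
  rw [tau_y o (by simp), tau_y o (by simp), tau_x o le_rfl]

/-! ### Factors of the complete density -/

/-- Conditional density of the duration `y_{t+1}`. -/
noncomputable def durDens (M : Model n q d) (θ : Param q d) (t : Fin (n + 1)) (o : Obs n d)
    (a : ℝ) : ℝ≥0∞ :=
  ENNReal.ofReal (M.spellDensity θ (o.y t.succ) (o.y t.castSucc) (o.x t) a)

/-- Conditional density of the covariate `x_{j+2}`. -/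
noncomputable def covDens (ω : Nuisance M) (j : Fin n) (o : Obs n d) (a : ℝ) : ℝ≥0∞ :=
  ENNReal.ofReal (ω.g j (o.past j, a) (o.x j.succ))

/-- The complete density with the conditional densities of `y_{t+1}`, `t ≥ k`, and of `x_{j+2}`,
`j ≥ m`, replaced by densities that do not depend on the past. -/
noncomputable def partDens (θ : Param q d) (ω : Nuisance M) (k m : ℕ) (o : Obs n d) (a : ℝ) :
    ℝ≥0∞ :=
  (∏ t : Fin (n + 1), if t.val < k then durDens M θ t o a else ENNReal.ofReal (Real.exp (-o.2.1 t)))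
    * (∏ j : Fin n, if j.val < m then covDens ω j o a else ENNReal.ofReal (ω.g j 0 (o.2.2 j)))
    * ENNReal.ofReal (ω.π o.1 a) * ENNReal.ofReal (ω.ν o.1)

lemma measurable_durDens (hθ : θ ∈ M.Θ) (t : Fin (n + 1)) :
    Measurable fun z : Obs n d × ℝ => durDens M θ t z.1 z.2 := by
  unfold durDens
  refine Measurable.ennreal_ofReal ?_
  exact (Model.measurable_spellDensity hθ).comp (f := fun z : Obs n d × ℝ =>
    (((z.1.y t.succ, z.1.y t.castSucc, z.1.x t), z.2) : (ℝ × ℝ × Cov d) × ℝ)) (by fun_prop)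

lemma measurable_covDens (ω : Nuisance M) (j : Fin n) :
    Measurable fun z : Obs n d × ℝ => covDens ω j z.1 z.2 := by
  unfold covDens
  refine Measurable.ennreal_ofReal ?_
  exact (ω.g_meas j).comp (f := fun z : Obs n d × ℝ =>
    (((z.1.past j, z.2), z.1.x j.succ) : (Past d j.val × ℝ) × Cov d)) (by fun_prop)

lemma measurable_partDens (hθ : θ ∈ M.Θ) (ω : Nuisance M) (k m : ℕ) :
    Measurable fun z : Obs n d × ℝ => partDens θ ω k m z.1 z.2 := by
  unfold partDens
  refine Measurable.mul (Measurable.mul (Measurable.mul ?_ ?_) ?_) ?_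
  · refine Finset.measurable_fun_prod _ fun t _ => ?_
    split_ifs
    · exact measurable_durDens hθ t
    · fun_prop
  · refine Finset.measurable_fun_prod _ fun j _ => ?_
    split_ifs
    · exact measurable_covDens ω j
    · exact ((ω.g_meas j).comp (f := fun z : Obs n d × ℝ => ((0 : Past d j.val × ℝ), z.1.2.2 j))
        (by fun_prop)).ennreal_ofReal
  · exact (ω.π_meas.comp (f := fun z : Obs n d × ℝ => (z.1.1, z.2)) (by fun_prop)).ennreal_ofReal
  · exact (ω.ν_meas.comp (f := fun z : Obs n d × ℝ => z.1.1) (by fun_prop)).ennreal_ofReal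

lemma dependsOnPast_durDens (θ : Param q d) (t : Fin (n + 1)) (a : ℝ) :
    DependsOnPast (t.val + 1) t.val fun o : Obs n d => durDens M θ t o a := by
  intro o
  unfold durDens
  beta_reduce
  rw [tau_y o (by simp), tau_y o (by simp), tau_x o le_rfl]

lemma dependsOnPast_covDens (ω : Nuisance M) (j : Fin n) (a : ℝ) :
    DependsOnPast (j.val + 1) (j.val + 1) fun o : Obs n d => covDens ω j o a := by
  intro o
  unfold covDens
  beta_reduce
  rw [tau_past o (by omega) (by omega), tau_x o (by simp)]

/-! ### Integration over one coordinate -/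

/-- Tonelli with the chosen duration innermost: two integrals over the whole sample space agree as
soon as the integrals over that one coordinate agree with all others frozen. -/
lemma lintegral_base_congr_updY {F G : Obs n d → ℝ≥0∞} (hF : Measurable F) (hG : Measurable G)
    (i : Fin (n + 1)) (h : ∀ o, ∫⁻ y in Ioi (0 : ℝ), F (updY o i y)
      = ∫⁻ y in Ioi (0 : ℝ), G (updY o i y)) :
    ∫⁻ o, F o ∂M.base = ∫⁻ o, G o ∂M.base := by
  unfold Model.base
  rw [lintegral_prod _ hF.aemeasurable, lintegral_prod _ hG.aemeasurable]
  refine lintegral_congr fun c => ?_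
  rw [lintegral_prod_symm' (fun z => F (c, z)) (hF.comp measurable_prodMk_left),
    lintegral_prod_symm' (fun z => G (c, z)) (hG.comp measurable_prodMk_left)]
  refine lintegral_congr fun x => ?_
  have hm : Measurable fun y : Fin (n + 1) → ℝ => ((c, (y, x)) : Obs n d) := by fun_prop
  refine lintegral_eq_of_lmarginal_eq {i} (hF.comp hm) (hG.comp hm) ?_
  rw [lmarginal_singleton, lmarginal_singleton]
  ext y
  exact h (c, (y, x))

lemma lintegral_base_congr_updX {F G : Obs n d → ℝ≥0∞} (hF : Measurable F) (hG : Measurable G)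
    (j : Fin n) (h : ∀ o, ∫⁻ x, F (updX o j x) ∂(M.mX j) = ∫⁻ x, G (updX o j x) ∂(M.mX j)) :
    ∫⁻ o, F o ∂M.base = ∫⁻ o, G o ∂M.base := by
  unfold Model.base
  rw [lintegral_prod _ hF.aemeasurable, lintegral_prod _ hG.aemeasurable]
  refine lintegral_congr fun c => ?_
  rw [lintegral_prod (fun z => F (c, z)) (hF.comp measurable_prodMk_left).aemeasurable,
    lintegral_prod (fun z => G (c, z)) (hG.comp measurable_prodMk_left).aemeasurable]
  refine lintegral_congr fun y => ?_
  have hm : Measurable fun x : Fin n → Cov d => ((c, (y, x)) : Obs n d) := by fun_prop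
  refine lintegral_eq_of_lmarginal_eq {j} (hF.comp hm) (hG.comp hm) ?_
  rw [lmarginal_singleton, lmarginal_singleton]
  ext x
  exact h (c, (y, x))

/-- The factors of `partDens` other than the density of `y_{i+1}`. -/
noncomputable def restY (θ : Param q d) (ω : Nuisance M) (i : Fin (n + 1)) (o : Obs n d)
    (a : ℝ) : ℝ≥0∞ :=
  (∏ t ∈ Finset.univ.erase i, if t.val < i.val then durDens M θ t o a
      else ENNReal.ofReal (Real.exp (-o.2.1 t)))
    * (∏ j : Fin n, if j.val < i.val then covDens ω j o a
      else ENNReal.ofReal (ω.g j 0 (o.2.2 j)))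
    * ENNReal.ofReal (ω.π o.1 a) * ENNReal.ofReal (ω.ν o.1)

lemma restY_updY (ω : Nuisance M) (i : Fin (n + 1)) (o : Obs n d) (a y : ℝ) :
    restY θ ω i (updY o i y) a = restY θ ω i o a := by
  unfold restY
  congr 2
  congr 1
  · refine Finset.prod_congr rfl fun t ht => ?_
    have hti : t ≠ i := Finset.ne_of_mem_erase ht
    split_ifs with h
    · exact (dependsOnPast_durDens θ t a).updY (by omega) o y
    · simp [updY, Function.update_of_ne hti]
  · refine Finset.prod_congr rfl fun j _ => ?_
    split_ifs with h
    · exact (dependsOnPast_covDens ω j a).updY (by omega) o y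
    · rfl

lemma partDens_succ_self (ω : Nuisance M) (i : Fin (n + 1)) (o : Obs n d) (a : ℝ) :
    partDens θ ω (i.val + 1) i.val o a = durDens M θ i o a * restY θ ω i o a := by
  unfold partDens restY
  rw [← Finset.mul_prod_erase _ _ (Finset.mem_univ i), if_pos (Nat.lt_succ_self _)]
  have : ∀ t ∈ Finset.univ.erase i, (if t.val < i.val + 1 then durDens M θ t o a
      else ENNReal.ofReal (Real.exp (-o.2.1 t))) = if t.val < i.val then durDens M θ t o a
      else ENNReal.ofReal (Real.exp (-o.2.1 t)) := by
    intro t ht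
    have hti : t.val ≠ i.val := fun h => Finset.ne_of_mem_erase ht (Fin.ext h)
    by_cases h : t.val < i.val
    · rw [if_pos h, if_pos (by omega)]
    · rw [if_neg h, if_neg (by omega)]
  rw [Finset.prod_congr rfl this]
  ring

lemma partDens_self (ω : Nuisance M) (i : Fin (n + 1)) (o : Obs n d) (a : ℝ) :
    partDens θ ω i.val i.val o a = ENNReal.ofReal (Real.exp (-o.2.1 i)) * restY θ ω i o a := by
  unfold partDens restY
  rw [← Finset.mul_prod_erase _ _ (Finset.mem_univ i), if_neg (lt_irrefl _)]
  ring

/-- The factors of `partDens` other than the density of `x_{i+2}`. -/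
noncomputable def restX (θ : Param q d) (ω : Nuisance M) (i : Fin n) (o : Obs n d)
    (a : ℝ) : ℝ≥0∞ :=
  (∏ t : Fin (n + 1), if t.val < i.val + 1 then durDens M θ t o a
      else ENNReal.ofReal (Real.exp (-o.2.1 t)))
    * (∏ j ∈ Finset.univ.erase i, if j.val < i.val then covDens ω j o a
      else ENNReal.ofReal (ω.g j 0 (o.2.2 j)))
    * ENNReal.ofReal (ω.π o.1 a) * ENNReal.ofReal (ω.ν o.1)

lemma restX_updX (ω : Nuisance M) (i : Fin n) (o : Obs n d) (a : ℝ) (x : Cov d) :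
    restX θ ω i (updX o i x) a = restX θ ω i o a := by
  unfold restX
  congr 2
  congr 1
  · refine Finset.prod_congr rfl fun t _ => ?_
    split_ifs with h
    · exact (dependsOnPast_durDens θ t a).updX (by omega) o x
    · rfl
  · refine Finset.prod_congr rfl fun j hj => ?_
    have hji : j ≠ i := Finset.ne_of_mem_erase hj
    split_ifs with h
    · exact (dependsOnPast_covDens ω j a).updX (by omega) o x
    · simp [updX, Function.update_of_ne hji]

lemma partDens_succ_succ (ω : Nuisance M) (i : Fin n) (o : Obs n d) (a : ℝ) :
    partDens θ ω (i.val + 1) (i.val + 1) o a = covDens ω i o a * restX θ ω i o a := by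
  unfold partDens restX
  rw [← Finset.mul_prod_erase _ (fun j : Fin n => if j.val < i.val + 1 then covDens ω j o a
    else ENNReal.ofReal (ω.g j 0 (o.2.2 j))) (Finset.mem_univ i), if_pos (Nat.lt_succ_self _)]
  have : ∀ t ∈ Finset.univ.erase i, (if t.val < i.val + 1 then covDens ω t o a
      else ENNReal.ofReal (ω.g t 0 (o.2.2 t))) = if t.val < i.val then covDens ω t o a
      else ENNReal.ofReal (ω.g t 0 (o.2.2 t)) := by
    intro t ht
    have hti : t.val ≠ i.val := fun h => Finset.ne_of_mem_erase ht (Fin.ext h)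
    by_cases h : t.val < i.val
    · rw [if_pos h, if_pos (by omega)]
    · rw [if_neg h, if_neg (by omega)]
  rw [Finset.prod_congr rfl this]
  ring

lemma partDens_succ_self' (ω : Nuisance M) (i : Fin n) (o : Obs n d) (a : ℝ) :
    partDens θ ω (i.val + 1) i.val o a
      = ENNReal.ofReal (ω.g i 0 (o.2.2 i)) * restX θ ω i o a := by
  unfold partDens restX
  rw [← Finset.mul_prod_erase _ (fun j : Fin n => if j.val < i.val then covDens ω j o a
    else ENNReal.ofReal (ω.g j 0 (o.2.2 j))) (Finset.mem_univ i), if_neg (lt_irrefl _)]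
  ring

end MPH

namespace MPH
open scoped ENNReal

variable {n q d : ℕ} {M : Model n q d} {θ : Param q d}

/-! ### Integrating out one spell at a time. -/

lemma updY_y_of_le (o : Obs n d) (t : Fin (n + 1)) (y : ℝ) {s : Fin (n + 2)} (hs : s.val ≤ t.val) :
    (updY o t y).y s = o.y s := by
  rw [← tau_y (k := t.val) (m := 0) _ hs, tau_updY le_rfl, tau_y _ hs]

lemma updY_x (o : Obs n d) (t : Fin (n + 1)) (y : ℝ) (s : Fin (n + 1)) :
    (updY o t y).x s = o.x s := rfl

lemma updX_past (o : Obs n d) (j : Fin n) (x : Cov d) : (updX o j x).past j = o.past j := by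
  rw [← tau_past (k := j.val + 1) (m := j.val) _ (by omega) le_rfl, tau_updX le_rfl,
    tau_past _ (by omega) le_rfl]

/-- Given the past, `P_t` is exponential with rate `eᵃ`. -/
lemma lintegral_durDens (hθ : θ ∈ M.Θ) (t : Fin (n + 1)) (o : Obs n d) (a : ℝ) {F : ℝ → ℝ≥0∞}
    (hF : Measurable F) :
    ∫⁻ y in Ioi (0 : ℝ), F (M.P θ (updY o t y) t) * durDens M θ t (updY o t y) a
      = ∫⁻ p in Ioi (0 : ℝ), F p * gden 0 a p := by
  unfold Model.P durDens
  simp only [updY_y, updY_x, updY_y_of_le o t _ (show t.castSucc.val ≤ t.val from le_rfl)]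
  set e : ℝ := θ.gamma * o.y t.castSucc + o.x t ⬝ᵥ θ.beta with he
  have hc : 0 < Real.exp e := Real.exp_pos e
  have hmF' : Measurable fun p : ℝ => F (p * Real.exp e)
      * ENNReal.ofReal (Real.exp (e + a) * Real.exp (-(p * Real.exp e * Real.exp a))) :=
    (hF.comp (by fun_prop)).mul (by fun_prop)
  have h1 := (Model.isHazard hθ).lintegral_comp hmF'
  have hmG : Measurable fun p : ℝ => F p * gden 0 a p := hF.mul (by fun_prop)
  -- P_t is Λ(y) times the positive constant e^e fixed by the past: first the substitution p = Λ(y),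
  -- then a rescaling of the half line by e^e.
  rw [lintegral_Ioi_comp_mul hc hmG, ← lintegral_const_mul' _ _ ENNReal.ofReal_ne_top]
  refine Eq.trans ?_ (h1.trans ?_)
  · refine setLIntegral_congr_fun measurableSet_Ioi fun y hy => ?_
    have hy' := M.haz_pos θ hθ y hy
    simp only [Model.rho, Model.Lam, Model.spellDensity]
    rw [← he, mul_assoc (F _), ← ENNReal.ofReal_mul (by positivity)]
    congr 2
    ring
  · refine lintegral_congr fun p => ?_
    rw [gden, mul_left_comm, ← ENNReal.ofReal_mul hc.le, Real.exp_add e a]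
    congr 2
    simp only [zero_add, pow_one, pow_zero, Nat.factorial_zero, Nat.cast_one, div_one, mul_one]
    ring

lemma lintegral_durDens_one (hθ : θ ∈ M.Θ) (t : Fin (n + 1)) (o : Obs n d) (a : ℝ) :
    ∫⁻ y in Ioi (0 : ℝ), durDens M θ t (updY o t y) a = 1 := by
  have := lintegral_durDens hθ t o a (F := fun _ => 1) measurable_const
  simpa [lintegral_gden] using this

lemma lintegral_exp_neg : ∫⁻ y in Ioi (0 : ℝ), ENNReal.ofReal (Real.exp (-y)) = 1 := by
  simpa [gden] using lintegral_gden 0 0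

lemma covDens_updX (ω : Nuisance M) (j : Fin n) (o : Obs n d) (a : ℝ) (x : Cov d) :
    covDens ω j (updX o j x) a = ENNReal.ofReal (ω.g j (o.past j, a) x) := by
  unfold covDens
  rw [updX_past, updX_x]

lemma measurable_partDens_left (hθ : θ ∈ M.Θ) (ω : Nuisance M) (k m : ℕ) (a : ℝ) :
    Measurable fun o => partDens θ ω k m o a :=
  (measurable_partDens hθ ω k m).comp (f := fun o : Obs n d => (o, a)) (by fun_prop)

lemma measurable_updY_right (o : Obs n d) (i : Fin (n + 1)) : Measurable fun y => updY o i y :=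
  (measurable_updY i).comp (f := fun y : ℝ => (o, y)) (by fun_prop)

lemma measurable_updX_right (o : Obs n d) (j : Fin n) : Measurable fun x => updX o j x :=
  (measurable_updX j).comp (f := fun x : Cov d => (o, x)) (by fun_prop)

lemma measurable_durDens_updY (hθ : θ ∈ M.Θ) (i : Fin (n + 1)) (o : Obs n d) (a : ℝ) :
    Measurable fun y => durDens M θ i (updY o i y) a :=
  (measurable_durDens hθ i).comp (f := fun y : ℝ => (updY o i y, a))
    ((measurable_updY_right o i).prodMk measurable_const)

lemma measurable_g (ω : Nuisance M) (j : Fin n) (p : Past d j.val × ℝ) :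
    Measurable fun x => ENNReal.ofReal (ω.g j p x) :=
  ((ω.g_meas j).comp (f := fun x : Cov d => (p, x)) (by fun_prop)).ennreal_ofReal

/-- The two densities differ only in the factor for y_{i+1}, which is either the model density or
the standard exponential. Both integrate to one, and nothing else in the integrand involves y_{i+1}:
later factors of `partDens` ignore the past by construction. -/
lemma lintegral_mul_partDens_self (hθ : θ ∈ M.Θ) (ω : Nuisance M) (a : ℝ) (i : Fin (n + 1))
    {H : Obs n d → ℝ≥0∞} (hH : Measurable H) (hd : DependsOnPast i.val i.val H) :
    ∫⁻ o, H o * partDens θ ω (i.val + 1) i.val o a ∂M.base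
      = ∫⁻ o, H o * partDens θ ω i.val i.val o a ∂M.base := by
  have hm : ∀ k m, Measurable fun o => partDens θ ω k m o a := fun k m =>
    measurable_partDens_left hθ ω k m a
  refine lintegral_base_congr_updY (hH.mul (hm _ _)) (hH.mul (hm _ _)) i fun o => ?_
  simp only [partDens_succ_self, partDens_self, hd.updY le_rfl, restY_updY]
  have hm1 : Measurable fun y => durDens M θ i (updY o i y) a :=
    measurable_durDens_updY hθ i o a
  have e : ∀ y, (updY o i y).2.1 i = y := fun y => by simp [updY]
  simp only [e]
  have hm2 : Measurable fun y : ℝ => ENNReal.ofReal (Real.exp (-y)) := by fun_prop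
  rw [lintegral_const_mul _ (hm1.mul_const _), lintegral_mul_const _ hm1,
    lintegral_const_mul _ (hm2.mul_const _), lintegral_mul_const _ hm2,
    lintegral_durDens_one hθ, lintegral_exp_neg]

lemma lintegral_mul_partDens_succ (hθ : θ ∈ M.Θ) (ω : Nuisance M) (a : ℝ) (i : Fin n)
    {H : Obs n d → ℝ≥0∞} (hH : Measurable H) (hd : DependsOnPast (i.val + 1) i.val H) :
    ∫⁻ o, H o * partDens θ ω (i.val + 1) (i.val + 1) o a ∂M.base
      = ∫⁻ o, H o * partDens θ ω (i.val + 1) i.val o a ∂M.base := by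
  have hm : ∀ k m, Measurable fun o => partDens θ ω k m o a := fun k m =>
    measurable_partDens_left hθ ω k m a
  refine lintegral_base_congr_updX (hH.mul (hm _ _)) (hH.mul (hm _ _)) i fun o => ?_
  simp only [partDens_succ_succ, partDens_succ_self', hd.updX le_rfl, restX_updX, covDens_updX]
  have hg : ∀ p, Measurable fun x => ENNReal.ofReal (ω.g i p x) := measurable_g ω i
  have e : ∀ x, (updX o i x).2.2 i = x := fun x => by simp [updX]
  simp only [e]
  rw [lintegral_const_mul _ ((hg _).mul_const _), lintegral_mul_const _ (hg _),
    lintegral_const_mul _ ((hg _).mul_const _), lintegral_mul_const _ (hg _), ω.g_one, ω.g_one]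

/-- The conditional densities of the future integrate to one. -/
lemma lintegral_mul_partDens (hθ : θ ∈ M.Θ) (ω : Nuisance M) (a : ℝ) {k : ℕ} (hk : k ≤ n)
    {H : Obs n d → ℝ≥0∞} (hH : Measurable H) (hd : DependsOnPast (k + 1) k H) :
    ∫⁻ o, H o * partDens θ ω (n + 1) n o a ∂M.base
      = ∫⁻ o, H o * partDens θ ω (k + 1) k o a ∂M.base := by
  -- Going down one period removes y_{k+2} first and x_{k+2} second, since the density of the
  -- duration depends on the covariate of its own period and the covariate was drawn before it.
  induction hk using Nat.decreasingInduction with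
  | self => rfl
  | of_succ k hk ih =>
    rw [ih (hd.mono (by omega) (by omega)),
      lintegral_mul_partDens_self hθ ω a ⟨k + 1, by omega⟩ hH (hd.mono (by simp) (by simp)),
      lintegral_mul_partDens_succ hθ ω a ⟨k, hk⟩ hH hd]

lemma lintegral_mul_partDens' (hθ : θ ∈ M.Θ) (ω : Nuisance M) (a : ℝ) {k : ℕ} (hk : k ≤ n)
    {H : Obs n d → ℝ≥0∞} (hH : Measurable H) (hd : DependsOnPast k k H) :
    ∫⁻ o, H o * partDens θ ω (n + 1) n o a ∂M.base
      = ∫⁻ o, H o * partDens θ ω k k o a ∂M.base := by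
  rw [lintegral_mul_partDens hθ ω a hk hH (hd.mono (by omega) le_rfl),
    lintegral_mul_partDens_self hθ ω a ⟨k, by omega⟩ hH hd]

/-! ### The complete law -/

lemma base_pos : ∀ᵐ o ∂M.base, ∀ i, 0 < o.2.1 i := by
  unfold Model.base
  have h1 : ∀ᵐ y ∂(Measure.pi fun _ : Fin (n + 1) => volume.restrict (Ioi (0 : ℝ))),
      ∀ i, 0 < y i := by
    rw [ae_all_iff]
    intro i
    exact (Measure.tendsto_eval_ae_ae (i := i)).eventually (ae_restrict_mem measurableSet_Ioi)
  exact Measure.quasiMeasurePreserving_snd.ae (Measure.quasiMeasurePreserving_fst.ae h1)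

instance : SFinite M.base := by unfold Model.base; infer_instance

lemma ofReal_completeDensity (hθ : θ ∈ M.Θ) (ω : Nuisance M) {o : Obs n d}
    (ho : ∀ i, 0 < o.2.1 i) (a : ℝ) :
    ENNReal.ofReal (completeDensity θ ω o a) = partDens θ ω (n + 1) n o a := by
  have hs : ∀ t : Fin (n + 1), 0 ≤ M.spellDensity θ (o.y t.succ) (o.y t.castSucc) (o.x t) a := by
    intro t
    have := M.haz_pos θ hθ (o.y t.succ) (ho t)
    unfold Model.spellDensity
    positivity
  have hg : ∀ j : Fin n, 0 ≤ ω.g j (o.past j, a) (o.x j.succ) := fun j => ω.g_nonneg _ _ _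
  unfold completeDensity partDens durDens covDens
  simp only [Fin.is_lt, if_true]
  rw [ENNReal.ofReal_mul (mul_nonneg (mul_nonneg (Finset.prod_nonneg fun t _ => hs t)
    (Finset.prod_nonneg fun j _ => hg j)) (ω.π_nonneg _ _)),
    ENNReal.ofReal_mul (mul_nonneg (Finset.prod_nonneg fun t _ => hs t)
    (Finset.prod_nonneg fun j _ => hg j)),
    ENNReal.ofReal_mul (Finset.prod_nonneg fun t _ => hs t),
    ENNReal.ofReal_prod_of_nonneg fun t _ => hs t, ENNReal.ofReal_prod_of_nonneg fun j _ => hg j]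

lemma completeDensity_nonneg (hθ : θ ∈ M.Θ) (ω : Nuisance M) {o : Obs n d}
    (ho : ∀ i, 0 < o.2.1 i) (a : ℝ) : 0 ≤ completeDensity θ ω o a := by
  have hs : ∀ t : Fin (n + 1), 0 ≤ M.spellDensity θ (o.y t.succ) (o.y t.castSucc) (o.x t) a := by
    intro t
    have := M.haz_pos θ hθ (o.y t.succ) (ho t)
    unfold Model.spellDensity
    positivity
  have hg : ∀ j : Fin n, 0 ≤ ω.g j (o.past j, a) (o.x j.succ) := fun j => ω.g_nonneg _ _ _
  exact mul_nonneg (mul_nonneg (mul_nonneg (Finset.prod_nonneg fun t _ => hs t)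
    (Finset.prod_nonneg fun j _ => hg j)) (ω.π_nonneg _ _)) (ω.ν_nonneg _)

lemma measurable_completeDensity (hθ : θ ∈ M.Θ) (ω : Nuisance M) :
    Measurable fun z : Obs n d × ℝ => completeDensity θ ω z.1 z.2 := by
  unfold completeDensity
  refine Measurable.mul (Measurable.mul (Measurable.mul ?_ ?_) ?_) ?_
  · refine Finset.measurable_fun_prod _ fun t _ => ?_
    exact (Model.measurable_spellDensity hθ).comp (f := fun z : Obs n d × ℝ =>
      (((z.1.y t.succ, z.1.y t.castSucc, z.1.x t), z.2) : (ℝ × ℝ × Cov d) × ℝ)) (by fun_prop)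
  · refine Finset.measurable_fun_prod _ fun j _ => ?_
    exact (ω.g_meas j).comp (f := fun z : Obs n d × ℝ =>
      (((z.1.past j, z.2), z.1.x j.succ) : (Past d j.val × ℝ) × Cov d)) (by fun_prop)
  · exact ω.π_meas.comp (f := fun z : Obs n d × ℝ => (z.1.1, z.2)) (by fun_prop)
  · exact ω.ν_meas.comp (f := fun z : Obs n d × ℝ => z.1.1) (by fun_prop)

lemma completeLaw_eq (hθ : θ ∈ M.Θ) (ω : Nuisance M) : completeLaw θ ω
    = (M.base.prod volume).withDensity fun z => partDens θ ω (n + 1) n z.1 z.2 := by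
  unfold completeLaw
  refine withDensity_congr_ae ?_
  filter_upwards [Measure.quasiMeasurePreserving_fst.ae (base_pos (M := M))] with z hz
  exact ofReal_completeDensity hθ ω hz z.2

lemma lintegral_completeLaw (hθ : θ ∈ M.Θ) (ω : Nuisance M) {F : Obs n d × ℝ → ℝ≥0∞}
    (hF : Measurable F) : ∫⁻ z, F z ∂(completeLaw θ ω)
      = ∫⁻ a, ∫⁻ o, F (o, a) * partDens θ ω (n + 1) n o a ∂M.base := by
  rw [completeLaw_eq hθ, lintegral_withDensity_eq_lintegral_mul _ (measurable_partDens hθ ω _ _) hF,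
    lintegral_prod_symm' _ ((measurable_partDens hθ ω _ _).mul hF)]
  simp only [Pi.mul_apply, mul_comm]

lemma lintegral_pi_prod_eq_one {ι : Type*} [Fintype ι] [DecidableEq ι] {X : ι → Type*}
    [∀ i, MeasurableSpace (X i)] (μ : ∀ i, Measure (X i)) [∀ i, SigmaFinite (μ i)]
    {f : ∀ i, X i → ℝ≥0∞} (hf : ∀ i, Measurable (f i)) (h1 : ∀ i, ∫⁻ x, f i x ∂(μ i) = 1) :
    ∫⁻ x, ∏ i, f i (x i) ∂(Measure.pi μ) = 1 := by
  rcases isEmpty_or_nonempty (∀ i, X i) with he | ⟨⟨x₀⟩⟩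
  · obtain ⟨i, hi⟩ : ∃ i, IsEmpty (X i) := by
      by_contra! hcon
      exact he.elim fun i => (hcon i).some
    have := h1 i
    simp at this
  have key : ∀ s : Finset ι, (∫⋯∫⁻_s, (fun x => ∏ i ∈ s, f i (x i)) ∂μ) = fun _ => 1 := by
    intro s
    induction s using Finset.induction_on with
    | empty => simp
    | insert i s his ih =>
      have hm : Measurable fun x : ∀ i, X i => ∏ i ∈ insert i s, f i (x i) :=
        Finset.measurable_fun_prod _ fun j _ => (hf j).comp (measurable_pi_apply j)
      rw [lmarginal_insert' _ hm his]
      rw [← ih]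
      congr 1
      ext x
      simp only [Finset.prod_insert his, Function.update_self]
      have : ∀ xi, ∏ j ∈ s, f j (Function.update x i xi j) = ∏ j ∈ s, f j (x j) := fun xi =>
        Finset.prod_congr rfl fun j hj => by
          rw [Function.update_of_ne (by rintro rfl; exact his hj)]
      simp only [this]
      rw [lintegral_mul_const _ (hf i), h1, one_mul]
  rw [lintegral_eq_lmarginal_univ x₀, key]

/-- Once every spell and covariate density has been replaced by one that ignores the past, the
complete density is a product and its mass is computed factor by factor. -/
instance isProbabilityMeasure_completeLaw [hθ : Fact (θ ∈ M.Θ)] (ω : Nuisance M) :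
    IsProbabilityMeasure (completeLaw θ ω) := by
  constructor
  rw [← lintegral_one, lintegral_completeLaw hθ.out ω measurable_const]
  have hmg : ∀ j : Fin n, Measurable fun x => ENNReal.ofReal (ω.g j 0 x) := fun j =>
    measurable_g ω j 0
  have hmπ : Measurable fun p : (ℝ × Cov d) × ℝ => ENNReal.ofReal (ω.π p.1 p.2) :=
    ω.π_meas.ennreal_ofReal
  have hmν : Measurable fun c => ENNReal.ofReal (ω.ν c) := ω.ν_meas.ennreal_ofReal
  have h1 : ∀ a, ∫⁻ o, 1 * partDens θ ω (n + 1) n o a ∂M.base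
      = ∫⁻ c, ENNReal.ofReal (ω.π c a) * ENNReal.ofReal (ω.ν c) ∂M.m₀ := by
    intro a
    rw [lintegral_mul_partDens' hθ.out ω a (Nat.zero_le n) measurable_const (fun _ => rfl)]
    unfold Model.base
    have e : ∀ o : Obs n d, 1 * partDens θ ω 0 0 o a
        = (ENNReal.ofReal (ω.π o.1 a) * ENNReal.ofReal (ω.ν o.1))
          * ((∏ t, ENNReal.ofReal (Real.exp (-o.2.1 t)))
            * ∏ j, ENNReal.ofReal (ω.g j 0 (o.2.2 j))) := by
      intro o
      unfold partDens
      simp only [Nat.not_lt_zero, if_false]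
      ring
    have hm1 : Measurable fun y : Fin (n + 1) → ℝ => ∏ t, ENNReal.ofReal (Real.exp (-y t)) := by
      fun_prop
    have hm2 : Measurable fun x : Fin n → Cov d => ∏ j, ENNReal.ofReal (ω.g j 0 (x j)) :=
      Finset.measurable_fun_prod _ fun j _ => (hmg j).comp (measurable_pi_apply j)
    simp only [e]
    rw [lintegral_prod_mul (f := fun c => ENNReal.ofReal (ω.π c a) * ENNReal.ofReal (ω.ν c))
      (g := fun z : (Fin (n + 1) → ℝ) × (Fin n → Cov d) =>
        (∏ t, ENNReal.ofReal (Real.exp (-z.1 t))) * ∏ j, ENNReal.ofReal (ω.g j 0 (z.2 j)))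
      ((hmπ.comp measurable_prodMk_right).mul hmν).aemeasurable
      ((hm1.comp measurable_fst).mul (hm2.comp measurable_snd)).aemeasurable,
      lintegral_prod_mul hm1.aemeasurable hm2.aemeasurable,
      lintegral_pi_prod_eq_one (f := fun _ y => ENNReal.ofReal (Real.exp (-y)))
        (fun _ : Fin (n + 1) => volume.restrict (Ioi (0 : ℝ))) (fun _ => by fun_prop)
        (fun _ => lintegral_exp_neg),
      lintegral_pi_prod_eq_one M.mX hmg (fun j => ω.g_one j 0), mul_one, mul_one]
  simp only [h1]
  rw [lintegral_lintegral_swap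
    (((hmπ.comp measurable_swap).mul (hmν.comp measurable_snd)).aemeasurable)]
  have h2 : ∀ c, ∫⁻ a, ENNReal.ofReal (ω.π c a) * ENNReal.ofReal (ω.ν c)
      = ENNReal.ofReal (ω.ν c) := by
    intro c
    have hm : Measurable fun a => ENNReal.ofReal (ω.π c a) := hmπ.comp measurable_prodMk_left
    rw [lintegral_mul_const _ hm, ω.π_one, one_mul]
  simp only [h2, ω.ν_one]

/-- Comparison of two functions by integrating out the duration `y_{t+1}`. -/
lemma lintegral_completeLaw_congr_dur (hθ : θ ∈ M.Θ) (ω : Nuisance M) (t : Fin (n + 1))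
    {F G : Obs n d × ℝ → ℝ≥0∞} (hF : Measurable F) (hG : Measurable G)
    (hFd : ∀ a, DependsOnPast (t.val + 1) t.val fun o => F (o, a))
    (hGd : ∀ a, DependsOnPast (t.val + 1) t.val fun o => G (o, a))
    (h : ∀ o a, ∫⁻ y in Ioi (0 : ℝ), F (updY o t y, a) * durDens M θ t (updY o t y) a
      = ∫⁻ y in Ioi (0 : ℝ), G (updY o t y, a) * durDens M θ t (updY o t y) a) :
    ∫⁻ z, F z ∂(completeLaw θ ω) = ∫⁻ z, G z ∂(completeLaw θ ω) := by
  rw [lintegral_completeLaw hθ ω hF, lintegral_completeLaw hθ ω hG]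
  refine lintegral_congr fun a => ?_
  have hF' : Measurable fun o => F (o, a) :=
    hF.comp (f := fun o : Obs n d => (o, a)) (by fun_prop)
  have hG' : Measurable fun o => G (o, a) :=
    hG.comp (f := fun o : Obs n d => (o, a)) (by fun_prop)
  have hm : ∀ k m, Measurable fun o => partDens θ ω k m o a := fun k m =>
    measurable_partDens_left hθ ω k m a
  rw [lintegral_mul_partDens hθ ω a (Nat.lt_succ_iff.1 t.2) hF' (hFd a),
    lintegral_mul_partDens hθ ω a (Nat.lt_succ_iff.1 t.2) hG' (hGd a)]
  refine lintegral_base_congr_updY (hF'.mul (hm _ _)) (hG'.mul (hm _ _)) t fun o => ?_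
  simp only [partDens_succ_self, restY_updY, ← mul_assoc]
  have hu : Measurable fun y => updY o t y := measurable_updY_right o t
  have hm1 : Measurable fun y => durDens M θ t (updY o t y) a :=
    measurable_durDens_updY hθ t o a
  have hF2 : Measurable fun y => F (updY o t y, a) * durDens M θ t (updY o t y) a :=
    (hF'.comp hu).mul hm1
  have hG2 : Measurable fun y => G (updY o t y, a) * durDens M θ t (updY o t y) a :=
    (hG'.comp hu).mul hm1
  rw [lintegral_mul_const _ hF2, lintegral_mul_const _ hG2, h]

/-- Comparison of two functions by integrating out the covariate `x_{j+2}`. -/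
lemma lintegral_completeLaw_congr_cov (hθ : θ ∈ M.Θ) (ω : Nuisance M) (j : Fin n)
    {F G : Obs n d × ℝ → ℝ≥0∞} (hF : Measurable F) (hG : Measurable G)
    (hFd : ∀ a, DependsOnPast (j.val + 1) (j.val + 1) fun o => F (o, a))
    (hGd : ∀ a, DependsOnPast (j.val + 1) (j.val + 1) fun o => G (o, a))
    (h : ∀ o a, ∫⁻ x, F (updX o j x, a) * ENNReal.ofReal (ω.g j (o.past j, a) x) ∂(M.mX j)
      = ∫⁻ x, G (updX o j x, a) * ENNReal.ofReal (ω.g j (o.past j, a) x) ∂(M.mX j)) :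
    ∫⁻ z, F z ∂(completeLaw θ ω) = ∫⁻ z, G z ∂(completeLaw θ ω) := by
  rw [lintegral_completeLaw hθ ω hF, lintegral_completeLaw hθ ω hG]
  refine lintegral_congr fun a => ?_
  have hF' : Measurable fun o => F (o, a) :=
    hF.comp (f := fun o : Obs n d => (o, a)) (by fun_prop)
  have hG' : Measurable fun o => G (o, a) :=
    hG.comp (f := fun o : Obs n d => (o, a)) (by fun_prop)
  have hm : ∀ k m, Measurable fun o => partDens θ ω k m o a := fun k m =>
    measurable_partDens_left hθ ω k m a
  rw [lintegral_mul_partDens' hθ ω a (Nat.succ_le_of_lt j.2) hF' (hFd a),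
    lintegral_mul_partDens' hθ ω a (Nat.succ_le_of_lt j.2) hG' (hGd a)]
  refine lintegral_base_congr_updX (hF'.mul (hm _ _)) (hG'.mul (hm _ _)) j fun o => ?_
  simp only [Nat.succ_eq_add_one, partDens_succ_succ, restX_updX, ← mul_assoc, covDens_updX]
  have hu : Measurable fun x => updX o j x := measurable_updX_right o j
  have hm1 : Measurable fun x => ENNReal.ofReal (ω.g j (o.past j, a) x) :=
    measurable_g ω j _
  have hF2 : Measurable fun x => F (updX o j x, a) * ENNReal.ofReal (ω.g j (o.past j, a) x) :=
    (hF'.comp hu).mul hm1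
  have hG2 : Measurable fun x => G (updX o j x, a) * ENNReal.ofReal (ω.g j (o.past j, a) x) :=
    (hG'.comp hu).mul hm1
  rw [lintegral_mul_const _ hF2, lintegral_mul_const _ hG2, h]

end MPH

namespace MPH
open scoped ENNReal

variable {n q d : ℕ} {M : Model n q d} {θ : Param q d}

/-! ### Distribution of the transformed durations -/

/-- `P_{k+1} + ⋯ + P_T`. -/
noncomputable def tailP (M : Model n q d) (θ : Param q d) (k : ℕ) (o : Obs n d) : ℝ :=
  ∑ s ∈ Finset.univ.filter (fun s : Fin (n + 1) => k ≤ s.val), M.P θ o s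

lemma measurable_tailP (hθ : θ ∈ M.Θ) (k : ℕ) : Measurable (tailP M θ k) :=
  Finset.measurable_fun_sum _ fun t _ => Model.measurable_P hθ t

lemma P_tau (t : Fin (n + 1)) {k m : ℕ} (hk : t.val + 1 ≤ k) (hm : t.val ≤ m) (o : Obs n d) :
    M.P θ (tau k m o) t = M.P θ o t := (dependsOnPast_P θ t).mono hk hm o

lemma tailP_zero (o : Obs n d) : tailP M θ 0 o = M.Pbar θ o := by
  simp [tailP, Model.Pbar]

lemma tailP_eq_add (t : Fin (n + 1)) (o : Obs n d) :
    tailP M θ t.val o = M.P θ o t + tailP M θ (t.val + 1) o := by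
  unfold tailP
  have : Finset.univ.filter (fun s : Fin (n + 1) => t.val ≤ s.val)
      = insert t (Finset.univ.filter fun s : Fin (n + 1) => t.val + 1 ≤ s.val) := by
    ext s
    simp only [Finset.mem_filter, Finset.mem_univ, true_and, Finset.mem_insert, Fin.ext_iff]
    omega
  rw [this, Finset.sum_insert (by simp)]

lemma tailP_last (o : Obs n d) : tailP M θ (n + 1) o = 0 := by
  unfold tailP
  refine Finset.sum_eq_zero fun s hs => ?_
  have := s.2
  simp only [Finset.mem_filter, Finset.mem_univ, true_and] at hs
  omega

lemma Ptilde_eq (t : Fin (n + 1)) (o : Obs n d) :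
    M.Ptilde θ o t = M.P θ o t / tailP M θ t.val o := rfl

lemma measurable_Ptilde (hθ : θ ∈ M.Θ) (t : Fin (n + 1)) : Measurable fun o => M.Ptilde θ o t := by
  simp only [Ptilde_eq]
  exact (Model.measurable_P hθ t).div (measurable_tailP hθ _)

lemma P_pos (hθ : θ ∈ M.Θ) {o : Obs n d} (ho : ∀ i, 0 < o.2.1 i) (t : Fin (n + 1)) :
    0 < M.P θ o t :=
  mul_pos ((Model.isHazard hθ).integral_pos (ho t)) (Real.exp_pos _)

lemma tailP_pos (hθ : θ ∈ M.Θ) {o : Obs n d} (ho : ∀ i, 0 < o.2.1 i) {k : ℕ} (hk : k ≤ n) :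
    0 < tailP M θ k o :=
  Finset.sum_pos (fun t _ => P_pos hθ ho t) ⟨Fin.last n, by simpa using hk⟩

/-- The exponential-gamma identity with F = 1 has total mass one on the left and the beta mass times
one on the right, so no beta integral is computed. -/
instance isProbabilityMeasure_betaLaw (m : ℕ) : IsProbabilityMeasure (betaLaw m) := by
  constructor
  have h := lintegral_gden_gden m 0 (F := fun _ _ => 1) measurable_const
  have h0 : ∀ p : ℝ, ∫⁻ q in Ioi (0 : ℝ), 1 * gden m 0 q * gden 0 0 p = gden 0 0 p := by
    intro p
    have hm : Measurable fun q : ℝ => gden m 0 q := by fun_prop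
    simp only [one_mul]
    rw [lintegral_mul_const _ hm, lintegral_gden, one_mul]
  simp only [h0, lintegral_gden, lintegral_one] at h
  have hm : Measurable fun q : ℝ => gden (m + 1) 0 q := by fun_prop
  rw [lintegral_const_mul _ hm, lintegral_gden, mul_one] at h
  exact h.symm

/-- The exponential law of P_t given the past and A, as a statement about expectations: P_t may be
replaced by an independent exponential integration variable. Both sides depend on the data only
through period t, so the later factors of the density integrate out. -/
lemma lintegral_tau_P (hθ : θ ∈ M.Θ) (ω : Nuisance M) (t : Fin (n + 1))
    {F : (Obs n d × ℝ) × ℝ → ℝ≥0∞} (hF : Measurable F) :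
    ∫⁻ z, F ((tau t.val t.val z.1, z.2), M.P θ z.1 t) ∂(completeLaw θ ω)
      = ∫⁻ z, (∫⁻ p in Ioi (0 : ℝ), F ((tau t.val t.val z.1, z.2), p) * gden 0 z.2 p)
        ∂(completeLaw θ ω) := by
  have hP := Model.measurable_P (M := M) hθ t
  refine lintegral_completeLaw_congr_dur hθ ω t
    (F := fun z => F ((tau t.val t.val z.1, z.2), M.P θ z.1 t)) ?_ ?_ ?_ ?_ ?_
  · exact hF.comp (by fun_prop)
  · refine Measurable.lintegral_prod_right' (f := fun w : (Obs n d × ℝ) × ℝ =>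
      F ((tau t.val t.val w.1.1, w.1.2), w.2) * gden 0 w.1.2 w.2) ?_
    exact (hF.comp (by fun_prop)).mul (by fun_prop)
  · intro a o
    beta_reduce
    rw [tau_tau (by omega) le_rfl]
    exact congrArg (fun p => F ((tau t.val t.val o, a), p)) (dependsOnPast_P θ t o)
  · intro a o
    beta_reduce
    rw [tau_tau (by omega) le_rfl]
  · intro o a
    simp only [tau_updY (le_refl t.val)]
    rw [lintegral_durDens hθ t o a (F := fun p => F ((tau t.val t.val o, a), p))
      (hF.comp (by fun_prop)), lintegral_const_mul _ (measurable_durDens_updY hθ t o a),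
      lintegral_durDens_one hθ, mul_one]

/-- The step from k + 1 to k, kept with both P_{k+1} and the remaining sum so as to serve the gamma
law of the sum and the independence of P̃_{k+1}. The sum after period k + 1 is gamma given
everything up to that period, P_{k+1} is exponential given the earlier past, and the
exponential-gamma identity converts the pair into an independent ratio and sum. -/
lemma lintegral_tau_P_tailP_of_succ (hθ : θ ∈ M.Θ) (ω : Nuisance M) {k : ℕ} (hk : k < n)
    (ih : ∀ F : (Obs n d × ℝ) × ℝ → ℝ≥0∞, Measurable F →
      ∫⁻ z, F ((tau (k + 1) (k + 1) z.1, z.2), tailP M θ (k + 1) z.1) ∂(completeLaw θ ω)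
      = ∫⁻ z, (∫⁻ p in Ioi (0 : ℝ), F ((tau (k + 1) (k + 1) z.1, z.2), p)
        * gden (n - (k + 1)) z.2 p) ∂(completeLaw θ ω))
    {F : (Obs n d × ℝ) × ℝ × ℝ → ℝ≥0∞} (hF : Measurable F) :
    ∫⁻ z, F ((tau k k z.1, z.2), M.P θ z.1 ⟨k, by omega⟩, tailP M θ k z.1) ∂(completeLaw θ ω)
      = ∫⁻ z, (∫⁻ w in Ioi (0 : ℝ), (∫⁻ b, F ((tau k k z.1, z.2), b * w, w)
        ∂(betaLaw (n - (k + 1)))) * gden (n - k) z.2 w) ∂(completeLaw θ ω) := by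
  set t : Fin (n + 1) := ⟨k, by omega⟩ with ht
  have hP := Model.measurable_P (M := M) hθ t
  have h1 : ∀ z : Obs n d × ℝ, F ((tau k k z.1, z.2), M.P θ z.1 t, tailP M θ k z.1)
      = (fun w : (Obs n d × ℝ) × ℝ => F ((tau k k w.1.1, w.1.2), M.P θ w.1.1 t,
        M.P θ w.1.1 t + w.2)) ((tau (k + 1) (k + 1) z.1, z.2), tailP M θ (k + 1) z.1) := by
    intro z
    simp only [tau_tau (Nat.le_succ k) (Nat.le_succ k)]
    rw [P_tau (M := M) t le_rfl (Nat.le_succ k), tailP_eq_add t]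
  refine (lintegral_congr h1).trans ((ih (fun w : (Obs n d × ℝ) × ℝ => F ((tau k k w.1.1, w.1.2),
    M.P θ w.1.1 t, M.P θ w.1.1 t + w.2)) (hF.comp (by fun_prop))).trans ?_)
  have h2 : ∀ z : Obs n d × ℝ, (∫⁻ p in Ioi (0 : ℝ), (fun w : (Obs n d × ℝ) × ℝ =>
      F ((tau k k w.1.1, w.1.2), M.P θ w.1.1 t, M.P θ w.1.1 t + w.2))
        ((tau (k + 1) (k + 1) z.1, z.2), p) * gden (n - (k + 1)) z.2 p)
      = (fun w : (Obs n d × ℝ) × ℝ => ∫⁻ p in Ioi (0 : ℝ), F (w.1, w.2, w.2 + p)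
        * gden (n - (k + 1)) w.1.2 p) ((tau k k z.1, z.2), M.P θ z.1 t) := by
    intro z
    simp only [tau_tau (Nat.le_succ k) (Nat.le_succ k)]
    rw [P_tau (M := M) t le_rfl (Nat.le_succ k)]
  rw [lintegral_congr h2]
  have hm : Measurable fun w : (Obs n d × ℝ) × ℝ => ∫⁻ p in Ioi (0 : ℝ), F (w.1, w.2, w.2 + p)
      * gden (n - (k + 1)) w.1.2 p := by
    refine Measurable.lintegral_prod_right' (f := fun v : ((Obs n d × ℝ) × ℝ) × ℝ =>
      F (v.1.1, v.1.2, v.1.2 + v.2) * gden (n - (k + 1)) v.1.1.2 v.2) ?_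
    exact (hF.comp (by fun_prop)).mul (by fun_prop)
  refine (lintegral_tau_P hθ ω t hm).trans (lintegral_congr fun z => ?_)
  have h3 := lintegral_gden_gden (n - (k + 1)) z.2
    (F := fun p w => F ((tau k k z.1, z.2), p, w)) (hF.comp (by fun_prop))
  rw [show n - (k + 1) + 1 = n - k by omega] at h3
  rw [← h3]
  refine lintegral_congr fun p => ?_
  have hm2 : Measurable fun r : ℝ => F ((tau k k z.1, z.2), p, p + r)
      * gden (n - (k + 1)) z.2 r := (hF.comp (by fun_prop)).mul (by fun_prop)
  rw [lintegral_mul_const _ hm2]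

/-- Given the past and `A = a`, `P_{k+1} + ⋯ + P_T` is gamma with rate `eᵃ`. -/
lemma lintegral_tau_tailP (hθ : θ ∈ M.Θ) (ω : Nuisance M) {k : ℕ} (hk : k ≤ n)
    {F : (Obs n d × ℝ) × ℝ → ℝ≥0∞} (hF : Measurable F) :
    ∫⁻ z, F ((tau k k z.1, z.2), tailP M θ k z.1) ∂(completeLaw θ ω)
      = ∫⁻ z, (∫⁻ p in Ioi (0 : ℝ), F ((tau k k z.1, z.2), p) * gden (n - k) z.2 p)
        ∂(completeLaw θ ω) := by
  induction hk using Nat.decreasingInduction generalizing F with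
  | self =>
    have h : ∀ o : Obs n d, tailP M θ n o = M.P θ o (Fin.last n) := by
      intro o
      have := tailP_eq_add (M := M) (θ := θ) (Fin.last n) o
      simpa [tailP_last] using this
    simp only [h, Nat.sub_self]
    exact lintegral_tau_P hθ ω (Fin.last n) hF
  | of_succ k hk ih =>
    have h := lintegral_tau_P_tailP_of_succ hθ ω hk (fun F hF => ih hF)
      (F := fun w => F (w.1, w.2.2)) (hF.comp (by fun_prop))
    simpa using h

/-- `P̃_{k+1}` is beta distributed, independent of the past, of `A` and of `P_{k+1} + ⋯ + P_T`. -/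
lemma lintegral_tau_tailP_Ptilde (hθ : θ ∈ M.Θ) (ω : Nuisance M) {k : ℕ} (hk : k < n)
    {F : ((Obs n d × ℝ) × ℝ) × ℝ → ℝ≥0∞} (hF : Measurable F) :
    ∫⁻ z, F (((tau k k z.1, z.2), tailP M θ k z.1), M.Ptilde θ z.1 ⟨k, by omega⟩)
        ∂(completeLaw θ ω)
      = ∫⁻ z, (∫⁻ b, F (((tau k k z.1, z.2), tailP M θ k z.1), b) ∂(betaLaw (n - (k + 1))))
        ∂(completeLaw θ ω) := by
  have h1 := lintegral_tau_P_tailP_of_succ hθ ω hk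
    (fun F hF => lintegral_tau_tailP hθ ω (Nat.succ_le_of_lt hk) hF)
    (F := fun w => F ((w.1, w.2.2), w.2.1 / w.2.2)) (hF.comp (by fun_prop))
  have hm : Measurable fun v : (Obs n d × ℝ) × ℝ => ∫⁻ b, F (v, b) ∂(betaLaw (n - (k + 1))) :=
    hF.lintegral_prod_right'
  have h2 := lintegral_tau_tailP hθ ω hk.le hm
  simp only [Ptilde_eq]
  refine h1.trans (Eq.trans ?_ h2.symm)
  refine lintegral_congr fun z => setLIntegral_congr_fun measurableSet_Ioi fun w hw => ?_
  have hw : w ≠ 0 := ne_of_gt hw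
  simp only [mul_div_cancel_right₀ _ hw]

/-! ### Resampling a covariate and the common support -/

/-- Redrawing x_{j+2} from its conditional density leaves the joint law of the data up to x_{j+2}
and of A unchanged, so the redrawn point avoids the exceptional set too. The density is positive
exactly on the support, which turns the statement under g into one for almost every x of the support
under the dominating measure. -/
lemma ae_updX (hθ : θ ∈ M.Θ) (ω : Nuisance M) (j : Fin n) {N : Set (Obs n d × ℝ)}
    (hN : MeasurableSet N)
    (h : ∀ᵐ z ∂(completeLaw θ ω), (tau (j.val + 1) (j.val + 1) z.1, z.2) ∈ N) :
    ∀ᵐ z ∂(completeLaw θ ω), ∀ᵐ x ∂(M.mX j), x ∈ M.suppX j (z.1.past j) →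
      (tau (j.val + 1) (j.val + 1) (updX z.1 j x), z.2) ∈ N := by
  set F : Obs n d × ℝ → ℝ≥0∞ := fun z =>
    Nᶜ.indicator 1 (tau (j.val + 1) (j.val + 1) z.1, z.2) with hFdef
  have hind : Measurable (Nᶜ.indicator (1 : Obs n d × ℝ → ℝ≥0∞)) :=
    measurable_one.indicator hN.compl
  have hF : Measurable F := hind.comp (by fun_prop)
  have hu : Measurable fun w : (Obs n d × ℝ) × Cov d => updX w.1.1 j w.2 :=
    (measurable_updX j).comp (f := fun w : (Obs n d × ℝ) × Cov d => (w.1.1, w.2)) (by fun_prop)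
  have hg : Measurable fun w : (Obs n d × ℝ) × Cov d =>
      ENNReal.ofReal (ω.g j (w.1.1.past j, w.1.2) w.2) :=
    ((ω.g_meas j).comp (f := fun w : (Obs n d × ℝ) × Cov d => ((w.1.1.past j, w.1.2), w.2))
      (by fun_prop)).ennreal_ofReal
  have hFG : Measurable fun w : (Obs n d × ℝ) × Cov d => F (updX w.1.1 j w.2, w.1.2)
      * ENNReal.ofReal (ω.g j (w.1.1.past j, w.1.2) w.2) :=
    (hF.comp (hu.prodMk (by fun_prop))).mul hg
  have hG : Measurable fun z : Obs n d × ℝ => ∫⁻ x, F (updX z.1 j x, z.2)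
      * ENNReal.ofReal (ω.g j (z.1.past j, z.2) x) ∂(M.mX j) := hFG.lintegral_prod_right'
  have hupd : ∀ (o : Obs n d) (x x' : Cov d), updX (updX o j x) j x' = updX o j x' := by
    intro o x x'; simp [updX]
  have htau : ∀ (o : Obs n d) (x : Cov d), tau (j.val + 1) (j.val + 1)
      (updX (tau (j.val + 1) (j.val + 1) o) j x) = tau (j.val + 1) (j.val + 1) (updX o j x) := by
    intro o x
    unfold tau updX
    refine Prod.ext rfl (Prod.ext (funext fun i => ?_) (funext fun i => ?_))
    · simp only; split_ifs <;> rfl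
    · simp only
      by_cases hi : i = j
      · subst hi; simp
      · simp only [Function.update_of_ne hi]; split_ifs <;> rfl
  have h0 : ∫⁻ z, F z ∂(completeLaw θ ω) = 0 := by
    rw [lintegral_eq_zero_iff hF]
    filter_upwards [h] with z hz
    simp [F, hz]
  have heq := lintegral_completeLaw_congr_cov hθ ω j hF hG
    (fun a o => by simp only [hFdef, tau_tau le_rfl le_rfl])
    (fun a o => by
      simp only [hFdef, htau]
      rw [tau_past o (by omega) (by omega)])
    (fun o a => by
      simp only [hupd, updX_past]
      rw [lintegral_const_mul _ (measurable_g ω j _), ω.g_one, mul_one])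
  rw [h0] at heq
  have h1 := (lintegral_eq_zero_iff hG).1 heq.symm
  filter_upwards [h1] with z hz
  have hmz : Measurable fun x => F (updX z.1 j x, z.2)
      * ENNReal.ofReal (ω.g j (z.1.past j, z.2) x) :=
    hFG.comp (f := fun x : Cov d => (z, x)) (by fun_prop)
  have hz' := (lintegral_eq_zero_iff hmz).1 hz
  filter_upwards [hz'] with x hx hxs
  have hpos := (ω.g_pos_iff j (z.1.past j, z.2) x).2 hxs
  by_contra hcon
  simp only [hFdef, Pi.zero_apply, mul_eq_zero, ENNReal.ofReal_eq_zero, not_le.2 hpos, or_false]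
    at hx
  rw [indicator_of_mem (by simpa using hcon)] at hx
  exact one_ne_zero hx

lemma completeLaw_absolutelyContinuous (ω : Nuisance M) :
    completeLaw θ ω ≪ M.base.prod volume := withDensity_absolutelyContinuous _ _

lemma obsLaw_absolutelyContinuous (ω : Nuisance M) : obsLaw θ ω ≪ M.base :=
  ((completeLaw_absolutelyContinuous ω).map measurable_fst).trans
    Measure.quasiMeasurePreserving_fst.absolutelyContinuous

lemma obsLaw_pos (ω : Nuisance M) : ∀ᵐ o ∂(obsLaw θ ω), ∀ i, 0 < o.2.1 i :=
  (obsLaw_absolutelyContinuous ω).ae_le base_pos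

lemma completeLaw_ae_of_obsLaw {ω : Nuisance M} {p : Obs n d → Prop}
    (h : ∀ᵐ o ∂(obsLaw θ ω), p o) : ∀ᵐ z ∂(completeLaw θ ω), p z.1 :=
  ae_of_ae_map measurable_fst.aemeasurable h

/-- The observations in the common support. -/
def InSupport (M : Model n q d) (o : Obs n d) : Prop :=
  (∀ i, 0 < o.2.1 i) ∧ o.1 ∈ M.supp₀ ∧ ∀ j, o.x j.succ ∈ M.suppX j (o.past j)

lemma durDens_ne_zero (hθ : θ ∈ M.Θ) {o : Obs n d} (ho : ∀ i, 0 < o.2.1 i) (t : Fin (n + 1))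
    (a : ℝ) : durDens M θ t o a ≠ 0 := by
  have := M.haz_pos θ hθ (o.y t.succ) (ho t)
  rw [durDens, ne_eq, ENNReal.ofReal_eq_zero, not_le]
  unfold Model.spellDensity
  positivity

lemma partDens_ne_zero_iff (hθ : θ ∈ M.Θ) (ω : Nuisance M) {o : Obs n d} (ho : ∀ i, 0 < o.2.1 i)
    (a : ℝ) : partDens θ ω (n + 1) n o a ≠ 0 ↔ InSupport M o ∧ a ∈ M.suppA o.1 := by
  unfold partDens InSupport
  simp only [Fin.is_lt, if_true, ne_eq, mul_eq_zero, not_or, Finset.prod_eq_zero_iff,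
    Finset.mem_univ, true_and, not_exists, durDens_ne_zero hθ ho, covDens, ENNReal.ofReal_eq_zero,
    not_le, ω.g_pos_iff, ω.π_pos_iff, ω.ν_pos_iff, not_false_eq_true, implies_true, ho]
  tauto

lemma ae_inSupport (hθ : θ ∈ M.Θ) (ω : Nuisance M) : ∀ᵐ o ∂(obsLaw θ ω), InSupport M o := by
  have hm : MeasurableSet {o : Obs n d | InSupport M o} := by
    -- The support sets carry no measurability hypothesis; it comes from the densities that are
    -- positive on them. Evaluating g at a = 0 is harmless because its support does not depend on a.
    have : {o : Obs n d | InSupport M o} = (⋂ i, {o : Obs n d | 0 < o.2.1 i})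
        ∩ ({o : Obs n d | 0 < ω.ν o.1}
          ∩ ⋂ j : Fin n, {o : Obs n d | 0 < ω.g j (o.past j, 0) (o.x j.succ)}) := by
      ext o
      simp only [InSupport, mem_ofPred_eq, mem_inter_iff, mem_iInter, ω.g_pos_iff, ω.ν_pos_iff]
    rw [this]
    refine (MeasurableSet.iInter fun i => ?_).inter
      (MeasurableSet.inter ?_ (MeasurableSet.iInter fun j => ?_))
    · exact measurableSet_lt measurable_const (by fun_prop)
    · exact measurableSet_lt measurable_const (ω.ν_meas.comp measurable_fst)
    · exact measurableSet_lt measurable_const ((ω.g_meas j).comp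
        (f := fun o : Obs n d => ((o.past j, (0 : ℝ)), o.x j.succ)) (by fun_prop))
  rw [obsLaw, ae_map_iff measurable_fst.aemeasurable hm, completeLaw_eq hθ,
    ae_withDensity_iff (measurable_partDens hθ ω _ _)]
  filter_upwards [Measure.quasiMeasurePreserving_fst.ae (base_pos (M := M))] with z hz hne
  exact ((partDens_ne_zero_iff hθ ω hz z.2).1 hne).1

/-- What holds almost surely under the complete law holds, for almost every observation, for
almost every `a` in the common support. -/
lemma ae_ae_suppA (hθ : θ ∈ M.Θ) (ω : Nuisance M) {p : Obs n d × ℝ → Prop}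
    (h : ∀ᵐ z ∂(completeLaw θ ω), p z) :
    ∀ᵐ o ∂(obsLaw θ ω), ∀ᵐ a, a ∈ M.suppA o.1 → p (o, a) := by
  rw [completeLaw_eq hθ, ae_withDensity_iff (measurable_partDens hθ ω _ _)] at h
  have h1 := (obsLaw_absolutelyContinuous (θ := θ) ω).ae_le (Measure.ae_ae_of_ae_prod h)
  filter_upwards [h1, ae_inSupport hθ ω] with o ho hs
  filter_upwards [ho] with a ha has
  exact ha ((partDens_ne_zero_iff hθ ω hs.1 a).2 ⟨hs, has⟩)

lemma measurableSet_suppA (ω : Nuisance M) (c : ℝ × Cov d) : MeasurableSet (M.suppA c) := by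
  have : M.suppA c = {a | 0 < ω.π c a} := by ext a; simp [ω.π_pos_iff]
  rw [this]
  exact measurableSet_lt measurable_const (ω.π_meas.comp measurable_prodMk_left)

lemma volume_suppA_ne_zero (ω : Nuisance M) (c : ℝ × Cov d) : volume (M.suppA c) ≠ 0 := by
  intro h0
  have h1 := ω.π_one c
  have : (fun a => ENNReal.ofReal (ω.π c a)) =ᵐ[volume] 0 := by
    filter_upwards [compl_mem_ae_iff.2 h0] with a ha
    have : ¬ 0 < ω.π c a := fun h => ha ((ω.π_pos_iff c a).1 h)
    simpa using this
  rw [lintegral_congr_ae this] at h1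
  simp at h1

end MPH

namespace MPH
open scoped ENNReal

/-! ### Differentiability in quadratic mean -/

/-- If `m` is bounded and its expectation is constant along a path of densities that is
differentiable in quadratic mean, then `m` is orthogonal to the score of the path. -/
lemma integral_mul_score_eq_zero {Ω : Type*} [MeasurableSpace Ω] {μ : Measure Ω}
    {l : ℝ → Ω → ℝ} {l₀ S m : Ω → ℝ} {C : ℝ} (hC : 0 ≤ C)
    (hl0 : ∀ᵐ o ∂μ, 0 ≤ l₀ o) (hl0i : Integrable l₀ μ) (hl01 : ∫ o, l₀ o ∂μ = 1)
    (hl : ∀ᶠ η in 𝓝[≠] (0 : ℝ), (∀ᵐ o ∂μ, 0 ≤ l η o) ∧ Integrable (l η) μ ∧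
      ∫ o, m o * l η o ∂μ = ∫ o, m o * l₀ o ∂μ)
    (hS : AEStronglyMeasurable S μ) (hS2 : Integrable (fun o => S o ^ 2 * l₀ o) μ)
    (hm : AEStronglyMeasurable m μ) (hmC : ∀ o, |m o| ≤ C)
    (hd : Tendsto (fun η : ℝ => ∫⁻ o, ENNReal.ofReal
      (((√(l η o) - √(l₀ o) - η / 2 * S o * √(l₀ o)) / η) ^ 2) ∂μ) (𝓝[≠] 0) (𝓝 0)) :
    ∫ o, m o * S o * l₀ o ∂μ = 0 := by
  set r : ℝ → Ω → ℝ := fun η o => (√(l η o) - √(l₀ o) - η / 2 * S o * √(l₀ o)) / η with hr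
  set K : ℝ := ∫ o, S o ^ 2 * l₀ o / 4 ∂μ with hK
  set X : ℝ := ∫ o, m o * S o * l₀ o ∂μ with hX
  have hmS : Integrable (fun o => m o * S o * l₀ o) μ := by
    refine Integrable.mono' ((hl0i.add hS2).const_mul C)
      ((hm.mul hS).mul hl0i.aestronglyMeasurable) ?_
    filter_upwards [hl0] with o ho
    rw [Real.norm_eq_abs, abs_mul, abs_mul, abs_of_nonneg ho, Pi.add_apply]
    have h1 : |S o| ≤ 1 + S o ^ 2 := by
      rw [← sq_abs]; nlinarith [sq_nonneg (|S o| - 1)]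
    have h2 : |m o| * |S o| ≤ C * (1 + S o ^ 2) := mul_le_mul (hmC o) h1 (abs_nonneg _) hC
    nlinarith
  -- The limit in η is taken for fixed ε; the parameter ε later splits a cross term without the
  -- Cauchy-Schwarz inequality.
  have key : ∀ ε : ℝ, 0 < ε → |X| ≤ C * ε := by
    intro ε hε
    have hR : Tendsto (fun η => (∫⁻ o, ENNReal.ofReal (r η o ^ 2) ∂μ).toReal) (𝓝[≠] 0) (𝓝 0) := by
      exact (ENNReal.tendsto_toReal ENNReal.zero_ne_top).comp hd
    have hη : Tendsto (fun η : ℝ => |η|) (𝓝[≠] 0) (𝓝 0) := by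
      have := (continuous_abs.tendsto (0 : ℝ)).mono_left (nhdsWithin_le_nhds (s := {0}ᶜ))
      simpa using this
    have hlim : Tendsto (fun η => C * (ε⁻¹ * (∫⁻ o, ENNReal.ofReal (r η o ^ 2) ∂μ).toReal + ε
        + 2 * |η| * ((∫⁻ o, ENNReal.ofReal (r η o ^ 2) ∂μ).toReal + K))) (𝓝[≠] 0)
        (𝓝 (C * (ε⁻¹ * 0 + ε + 2 * 0 * (0 + K)))) :=
      tendsto_const_nhds.mul (((tendsto_const_nhds.mul hR).add tendsto_const_nhds).add
        ((tendsto_const_nhds.mul hη).mul (hR.add tendsto_const_nhds)))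
    have hlim' : C * (ε⁻¹ * 0 + ε + 2 * 0 * (0 + K)) = C * ε := by ring
    rw [hlim'] at hlim
    refine ge_of_tendsto hlim ?_
    have hfin : ∀ᶠ η in 𝓝[≠] (0 : ℝ), ∫⁻ o, ENNReal.ofReal (r η o ^ 2) ∂μ < 1 :=
      hd.eventually (gt_mem_nhds one_pos)
    filter_upwards [hl, hfin, self_mem_nhdsWithin] with η hlη hfη hη0
    obtain ⟨hl1, hl2, hl3⟩ := hlη
    have hη0 : η ≠ 0 := hη0
    have hsq : AEStronglyMeasurable (fun o => √(l₀ o)) μ :=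
      Real.continuous_sqrt.comp_aestronglyMeasurable hl0i.aestronglyMeasurable
    have hsqη : AEStronglyMeasurable (fun o => √(l η o)) μ :=
      Real.continuous_sqrt.comp_aestronglyMeasurable hl2.aestronglyMeasurable
    have hrm : AEStronglyMeasurable (r η) μ := by
      simp only [hr, div_eq_mul_inv]
      exact ((hsqη.sub hsq).sub ((hS.const_mul _).mul hsq)).mul_const _
    have hri : Integrable (fun o => r η o ^ 2) μ := by
      refine ⟨hrm.pow 2, ?_⟩
      rw [hasFiniteIntegral_iff_ofReal (ae_of_all _ fun o => sq_nonneg _)]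
      exact hfη.trans ENNReal.one_lt_top
    have hRint : (∫⁻ o, ENNReal.ofReal (r η o ^ 2) ∂μ).toReal = ∫ o, r η o ^ 2 ∂μ :=
      (integral_eq_lintegral_of_nonneg_ae (ae_of_all _ fun o => sq_nonneg _)
        hri.aestronglyMeasurable).symm
    have hmb : ∀ {f : Ω → ℝ}, Integrable f μ → Integrable (fun o => m o * f o) μ := fun hf =>
      hf.bdd_mul hm (ae_of_all _ fun o => by simpa using hmC o)
    have hi3 : Integrable (fun o => m o * l η o - m o * l₀ o) μ := (hmb hl2).sub (hmb hl0i)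
    -- The difference quotient of ∫ m l_η vanishes by hypothesis, so it can be subtracted for free;
    -- the integrand becomes the error of the first-order expansion of m l_η.
    have hX' : X = ∫ o, (m o * S o * l₀ o - η⁻¹ * (m o * l η o - m o * l₀ o)) ∂μ := by
      rw [integral_sub hmS (hi3.const_mul _), integral_const_mul, integral_sub (hmb hl2) (hmb hl0i),
        hl3]
      ring
    have hbound : Integrable (fun o => C * (ε⁻¹ * r η o ^ 2 + ε * l₀ o
        + 2 * |η| * (r η o ^ 2 + S o ^ 2 * l₀ o / 4))) μ :=
      (((hri.const_mul _).add (hl0i.const_mul _)).add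
        ((hri.add (hS2.div_const 4)).const_mul _)).const_mul _
    have hval : ∫ o, C * (ε⁻¹ * r η o ^ 2 + ε * l₀ o
        + 2 * |η| * (r η o ^ 2 + S o ^ 2 * l₀ o / 4)) ∂μ
        = C * (ε⁻¹ * ∫ o, r η o ^ 2 ∂μ + ε + 2 * |η| * ((∫ o, r η o ^ 2 ∂μ) + K)) := by
      have i1 : Integrable (fun o => ε⁻¹ * r η o ^ 2) μ := hri.const_mul _
      have i2 : Integrable (fun o => ε * l₀ o) μ := hl0i.const_mul _
      have i3 : Integrable (fun o => S o ^ 2 * l₀ o / 4) μ := hS2.div_const 4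
      have i4 : Integrable (fun o => r η o ^ 2 + S o ^ 2 * l₀ o / 4) μ := hri.add i3
      have i5 : Integrable (fun o => 2 * |η| * (r η o ^ 2 + S o ^ 2 * l₀ o / 4)) μ :=
        i4.const_mul _
      have i6 : Integrable (fun o => ε⁻¹ * r η o ^ 2 + ε * l₀ o) μ := i1.add i2
      rw [integral_const_mul, integral_add i6 i5, integral_add i1 i2, integral_const_mul,
        integral_const_mul, integral_const_mul, integral_add hri i3, hl01, mul_one]
    rw [hX', hRint, ← hval, ← Real.norm_eq_abs]
    refine norm_integral_le_of_norm_le hbound ?_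
    filter_upwards [hl0, hl1] with o h0 h1
    set u := √(l₀ o) with hu
    set T := S o * u / 2 with hT
    have hu2 : u ^ 2 = l₀ o := Real.sq_sqrt h0
    have hv2 : √(l η o) ^ 2 = l η o := Real.sq_sqrt h1
    -- With r the normalised remainder and T = S u / 2, squaring gives l_η - l₀ = η S l₀ + 2 η r u +
    -- η² (r + T)², so after division by η only 2 r u and η (r + T)² are left to bound.
    have hD : √(l η o) = u + η * (r η o + T) := by
      simp only [hr, hT]
      field_simp
      ring
    have e1 : m o * S o * l₀ o - η⁻¹ * (m o * l η o - m o * l₀ o)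
        = - m o * (2 * r η o * u + η * (r η o + T) ^ 2) := by
      rw [← hv2, hD, ← hu2]
      field_simp
      simp only [hT]
      ring
    have e2 : S o ^ 2 * l₀ o / 4 = T ^ 2 := by
      rw [← hu2, hT]; ring
    rw [e1, e2, Real.norm_eq_abs, abs_mul, abs_neg]
    refine mul_le_mul (hmC o) ?_ (abs_nonneg _) hC
    refine (abs_add_le _ _).trans (add_le_add ?_ ?_)
    · have h3 : |2 * r η o * u| = 2 * |r η o| * u := by
        rw [abs_mul, abs_mul, abs_two, abs_of_nonneg (Real.sqrt_nonneg _)]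
      rw [h3, ← hu2, ← sq_abs (r η o)]
      have h4 := sq_nonneg (|r η o| - ε * u)
      -- Completing the square: 2|r| u ≤ r²/ε + ε u², where ∫ r² tends to 0 and ∫ u² = 1.
      have h5 : ε⁻¹ * |r η o| ^ 2 + ε * u ^ 2 - 2 * |r η o| * u
          = ε⁻¹ * (|r η o| - ε * u) ^ 2 := by field_simp; ring
      have h6 : 0 ≤ ε⁻¹ * (|r η o| - ε * u) ^ 2 := by positivity
      linarith
    · rw [abs_mul, abs_of_nonneg (sq_nonneg (r η o + T))]
      have : (r η o + T) ^ 2 ≤ 2 * (r η o ^ 2 + T ^ 2) := by nlinarith [sq_nonneg (r η o - T)]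
      nlinarith [abs_nonneg η]
  have h0 : |X| ≤ 0 := by
    refine le_of_forall_pos_le_add fun δ hδ => ?_
    have := key (δ / (C + 1)) (by positivity)
    have h2 : C * (δ / (C + 1)) ≤ δ := by
      rw [← mul_div_assoc, div_le_iff₀ (by positivity)]
      nlinarith
    linarith
  exact abs_eq_zero.1 (le_antisymm h0 (abs_nonneg _))

/-! ### The law of the observed data -/

variable {n q d : ℕ} {M : Model n q d} {θ : Param q d}

lemma measurable_likelihood (hθ : θ ∈ M.Θ) (ω : Nuisance M) : Measurable (likelihood θ ω) :=
  (measurable_completeDensity hθ ω).stronglyMeasurable.integral_prod_right'.measurable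

lemma likelihood_nonneg (hθ : θ ∈ M.Θ) (ω : Nuisance M) : ∀ᵐ o ∂M.base, 0 ≤ likelihood θ ω o := by
  filter_upwards [base_pos (M := M)] with o ho
  exact integral_nonneg fun a => completeDensity_nonneg hθ ω ho a

lemma integrable_completeDensity (hθ : θ ∈ M.Θ) (ω : Nuisance M) :
    Integrable (fun z : Obs n d × ℝ => completeDensity θ ω z.1 z.2) (M.base.prod volume) := by
  have : Fact (θ ∈ M.Θ) := ⟨hθ⟩
  refine ⟨(measurable_completeDensity hθ ω).aestronglyMeasurable, ?_⟩
  rw [hasFiniteIntegral_iff_ofReal]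
  · have h := measure_univ (μ := completeLaw θ ω)
    rw [completeLaw, withDensity_apply _ MeasurableSet.univ, setLIntegral_univ] at h
    rw [h]
    exact ENNReal.one_lt_top
  · filter_upwards [Measure.quasiMeasurePreserving_fst.ae (base_pos (M := M))] with z hz
    exact completeDensity_nonneg hθ ω hz z.2

lemma ae_integrable_completeDensity (hθ : θ ∈ M.Θ) (ω : Nuisance M) :
    ∀ᵐ o ∂M.base, Integrable (fun a => completeDensity θ ω o a) :=
  (integrable_completeDensity hθ ω).prod_right_ae

lemma obsLaw_eq (hθ : θ ∈ M.Θ) (ω : Nuisance M) :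
    obsLaw θ ω = M.base.withDensity fun o => ENNReal.ofReal (likelihood θ ω o) := by
  ext A hA
  rw [obsLaw, Measure.map_apply measurable_fst hA, completeLaw,
    withDensity_apply _ (measurable_fst hA), withDensity_apply _ hA,
    show (Prod.fst ⁻¹' A : Set (Obs n d × ℝ)) = A ×ˢ univ by ext; simp,
    setLIntegral_prod _ (measurable_completeDensity hθ ω).ennreal_ofReal.aemeasurable,
    Measure.restrict_univ]
  refine setLIntegral_congr_fun_ae hA ?_
  filter_upwards [base_pos (M := M), ae_integrable_completeDensity hθ ω] with o ho hi _
  rw [likelihood, ofReal_integral_eq_lintegral_ofReal hi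
    (ae_of_all _ fun a => completeDensity_nonneg hθ ω ho a)]

instance isProbabilityMeasure_obsLaw [Fact (θ ∈ M.Θ)] (ω : Nuisance M) :
    IsProbabilityMeasure (obsLaw θ ω) :=
  Measure.isProbabilityMeasure_map measurable_fst.aemeasurable

lemma integral_obsLaw (hθ : θ ∈ M.Θ) (ω : Nuisance M) (f : Obs n d → ℝ) :
    ∫ o, f o ∂(obsLaw θ ω) = ∫ o, f o * likelihood θ ω o ∂M.base := by
  rw [obsLaw_eq hθ, integral_withDensity_eq_integral_toReal_smul
    (measurable_likelihood hθ ω).ennreal_ofReal (by simp)]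
  refine integral_congr_ae ?_
  filter_upwards [likelihood_nonneg hθ ω] with o ho
  rw [ENNReal.toReal_ofReal ho, smul_eq_mul, mul_comm]

lemma integrable_obsLaw_iff (hθ : θ ∈ M.Θ) (ω : Nuisance M) (f : Obs n d → ℝ) :
    Integrable f (obsLaw θ ω) ↔ Integrable (fun o => f o * likelihood θ ω o) M.base := by
  rw [obsLaw_eq hθ, integrable_withDensity_iff_integrable_smul'
    (measurable_likelihood hθ ω).ennreal_ofReal (by simp)]
  refine integrable_congr ?_
  filter_upwards [likelihood_nonneg hθ ω] with o ho
  rw [ENNReal.toReal_ofReal ho, smul_eq_mul, mul_comm]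

lemma integral_completeLaw (hθ : θ ∈ M.Θ) (ω : Nuisance M) (f : Obs n d × ℝ → ℝ) :
    ∫ z, f z ∂(completeLaw θ ω)
      = ∫ z, f z * completeDensity θ ω z.1 z.2 ∂(M.base.prod volume) := by
  rw [completeLaw, integral_withDensity_eq_integral_toReal_smul
    (measurable_completeDensity hθ ω).ennreal_ofReal (by simp)]
  refine integral_congr_ae ?_
  filter_upwards [Measure.quasiMeasurePreserving_fst.ae (base_pos (M := M))] with z hz
  rw [ENNReal.toReal_ofReal (completeDensity_nonneg hθ ω hz z.2), smul_eq_mul, mul_comm]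

lemma integrable_completeLaw_iff (hθ : θ ∈ M.Θ) (ω : Nuisance M) (f : Obs n d × ℝ → ℝ) :
    Integrable f (completeLaw θ ω)
      ↔ Integrable (fun z => f z * completeDensity θ ω z.1 z.2) (M.base.prod volume) := by
  rw [completeLaw, integrable_withDensity_iff_integrable_smul'
    (measurable_completeDensity hθ ω).ennreal_ofReal (by simp)]
  refine integrable_congr ?_
  filter_upwards [Measure.quasiMeasurePreserving_fst.ae (base_pos (M := M))] with z hz
  rw [ENNReal.toReal_ofReal (completeDensity_nonneg hθ ω hz z.2), smul_eq_mul, mul_comm]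

end MPH

namespace MPH
open scoped ENNReal

/-! ### Tilted densities -/

/-- The identity on `[-1/2, 1/2]`, zero elsewhere. -/
noncomputable def cut (η : ℝ) : ℝ := if |η| ≤ 1 / 2 then η else 0

lemma abs_cut_le (η : ℝ) : |cut η| ≤ 1 / 2 := by
  unfold cut; split_ifs with h
  · exact h
  · simp

lemma cut_zero : cut 0 = 0 := by simp [cut]

lemma cut_of_le {η : ℝ} (h : |η| ≤ 1 / 2) : cut η = η := if_pos h

/-- A submodel must be defined for every real η and keep the common support. The truncation makes
the tilting factor at least 1/2 everywhere while leaving the path linear near η = 0. -/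
lemma one_add_cut_mul_pos (η : ℝ) {h : ℝ} (hh : |h| ≤ 1) : 0 < 1 + cut η * h := by
  have h1 : |cut η * h| ≤ 1 / 2 * 1 := by
    rw [abs_mul]; exact mul_le_mul (abs_cut_le η) hh (abs_nonneg _) (by norm_num)
  have := neg_abs_le (cut η * h)
  linarith

section Tilt

variable {X : Type*} [MeasurableSpace X] {μ : Measure X} {f k : X → ℝ}

lemma integrable_of_lintegral_eq_one (hf : Measurable f) (h0 : ∀ x, 0 ≤ f x)
    (h1 : ∫⁻ x, ENNReal.ofReal (f x) ∂μ = 1) : Integrable f μ :=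
  ⟨hf.aestronglyMeasurable, by
    rw [hasFiniteIntegral_iff_ofReal (ae_of_all _ h0), h1]; exact ENNReal.one_lt_top⟩

lemma integral_of_lintegral_eq_one (hf : Measurable f) (h0 : ∀ x, 0 ≤ f x)
    (h1 : ∫⁻ x, ENNReal.ofReal (f x) ∂μ = 1) : ∫ x, f x ∂μ = 1 := by
  rw [integral_eq_lintegral_of_nonneg_ae (ae_of_all _ h0) hf.aestronglyMeasurable, h1]; rfl

lemma integrable_mul_of_mem_Icc (hf : Measurable f) (h0 : ∀ x, 0 ≤ f x)
    (h1 : ∫⁻ x, ENNReal.ofReal (f x) ∂μ = 1) (hk : Measurable k) (hk1 : ∀ x, k x ∈ Icc (0 : ℝ) 1) :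
    Integrable (fun x => k x * f x) μ :=
  (integrable_of_lintegral_eq_one hf h0 h1).bdd_mul (c := 1) hk.aestronglyMeasurable
    (ae_of_all _ fun x => by
      rw [Real.norm_eq_abs, abs_of_nonneg (hk1 x).1]; exact (hk1 x).2)

lemma integral_mul_mem_Icc (hf : Measurable f) (h0 : ∀ x, 0 ≤ f x)
    (h1 : ∫⁻ x, ENNReal.ofReal (f x) ∂μ = 1) (hk : Measurable k) (hk1 : ∀ x, k x ∈ Icc (0 : ℝ) 1) :
    ∫ x, k x * f x ∂μ ∈ Icc (0 : ℝ) 1 := by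
  refine ⟨integral_nonneg fun x => mul_nonneg (hk1 x).1 (h0 x), ?_⟩
  rw [← integral_of_lintegral_eq_one hf h0 h1]
  exact integral_mono (integrable_mul_of_mem_Icc hf h0 h1 hk hk1)
    (integrable_of_lintegral_eq_one hf h0 h1)
    fun x => mul_le_of_le_one_left (h0 x) (hk1 x).2

lemma abs_sub_le_one_of_mem_Icc {a b : ℝ} (ha : a ∈ Icc (0 : ℝ) 1) (hb : b ∈ Icc (0 : ℝ) 1) :
    |a - b| ≤ 1 := by
  rw [abs_le]; constructor <;> linarith [ha.1, ha.2, hb.1, hb.2]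

/-- Centring k at its mean under f keeps the total mass equal to one. -/
lemma lintegral_tilt (hf : Measurable f) (h0 : ∀ x, 0 ≤ f x)
    (h1 : ∫⁻ x, ENNReal.ofReal (f x) ∂μ = 1) (hk : Measurable k) (hk1 : ∀ x, k x ∈ Icc (0 : ℝ) 1)
    (η : ℝ) : ∫⁻ x, ENNReal.ofReal (f x * (1 + cut η * (k x - ∫ x', k x' * f x' ∂μ))) ∂μ = 1 := by
  have hkm := integral_mul_mem_Icc hf h0 h1 hk hk1
  have i1 := integrable_of_lintegral_eq_one hf h0 h1
  have i2 := integrable_mul_of_mem_Icc hf h0 h1 hk hk1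
  set c := ∫ x', k x' * f x' ∂μ with hc
  have e : ∀ x, f x * (1 + cut η * (k x - c)) = f x + cut η * (k x * f x - c * f x) := by
    intro x; ring
  have i3 : Integrable (fun x => k x * f x - c * f x) μ := i2.sub (i1.const_mul c)
  have i4 : Integrable (fun x => cut η * (k x * f x - c * f x)) μ := i3.const_mul _
  rw [← ofReal_integral_eq_lintegral_ofReal]
  · simp only [e]
    rw [integral_add i1 i4, integral_const_mul, integral_sub i2 (i1.const_mul c),
      integral_const_mul, integral_of_lintegral_eq_one hf h0 h1, ← hc]
    simp
  · simp only [e]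
    exact i1.add i4
  · exact ae_of_all _ fun x => mul_nonneg (h0 x)
      (one_add_cut_mul_pos η (abs_sub_le_one_of_mem_Icc (hk1 x) hkm)).le

end Tilt

/-! ### Scores of tilted submodels -/

variable {n q d : ℕ} {M : Model n q d} {θ : Param q d}

/-- Orthogonality to the scores of all regular submodels through `ω`. -/
def OrthScores (θ : Param q d) (ω : Nuisance M) (s : Obs n d → ℝ) : Prop :=
  ∀ (path : ℝ → Nuisance M) (S : Obs n d → ℝ), path 0 = ω → IsRegularSubmodel θ path S →
    ∫ o, s o * S o ∂(obsLaw θ ω) = 0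

/-- With u = √(1 + x) the remainder is exactly -(u - 1)²/2, while x = (u - 1)(u + 1) and u + 1 ≥ 1.
-/
lemma abs_sqrt_one_add_sub_le {x : ℝ} (hx : |x| ≤ 1 / 2) : |√(1 + x) - 1 - x / 2| ≤ x ^ 2 := by
  have h1 : 0 ≤ 1 + x := by linarith [neg_abs_le x]
  set u := √(1 + x) with hu
  have hu0 : 0 ≤ u := Real.sqrt_nonneg _
  have hu2 : u ^ 2 = 1 + x := Real.sq_sqrt h1
  have hx' : x = (u - 1) * (u + 1) := by ring_nf; linarith
  have e : u - 1 - x / 2 = -((u - 1) ^ 2 / 2) := by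
    have : x = u ^ 2 - 1 := by linarith
    rw [this]; ring
  rw [e, abs_neg, abs_of_nonneg (by positivity), hx', mul_pow]
  have h2 : 1 ≤ (u + 1) ^ 2 := by nlinarith
  nlinarith [sq_nonneg (u - 1)]

/-- The score in the observed data of a path tilting the complete density by 1 + η h is S = E[h |
data], and for small η the likelihood is exactly ℓ (1 + η S) with |S| ≤ 1. The expansion of the
square root then bounds the squared quadratic-mean error by η², so the path is regular, and E[s S] =
E[s h]. -/
lemma orthScores_integral_mul_eq_zero (hθ : θ ∈ M.Θ) {ω : Nuisance M} {path : ℝ → Nuisance M}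
    (hp0 : path 0 = ω) {h : Obs n d × ℝ → ℝ} (hh : Measurable h) (hh1 : ∀ z, |h z| ≤ 1)
    (hden : ∀ η o a, completeDensity θ (path η) o a
      = completeDensity θ ω o a * (1 + cut η * h (o, a)))
    {s : Obs n d → ℝ} (hs : MemLp s 2 (obsLaw θ ω)) (hso : OrthScores θ ω s) :
    ∫ z, s z.1 * h z ∂(completeLaw θ ω) = 0 := by
  have : Fact (θ ∈ M.Θ) := ⟨hθ⟩
  set D := completeDensity θ ω with hD
  set N : Obs n d → ℝ := fun o => ∫ a, h (o, a) * D o a with hN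
  set S : Obs n d → ℝ := fun o => N o / likelihood θ ω o with hS
  have hNm : Measurable N :=
    (hh.mul (measurable_completeDensity hθ ω)).stronglyMeasurable.integral_prod_right'.measurable
  have hSm : Measurable S := hNm.div (measurable_likelihood hθ ω)
  have hDi : ∀ᵐ o ∂M.base, (∀ a, 0 ≤ D o a) ∧ Integrable (fun a => D o a)
      ∧ Integrable (fun a => h (o, a) * D o a) := by
    filter_upwards [base_pos (M := M), ae_integrable_completeDensity hθ ω] with o ho hi
    refine ⟨fun a => completeDensity_nonneg hθ ω ho a, hi, ?_⟩
    exact hi.bdd_mul (c := 1) (hh.comp measurable_prodMk_left).aestronglyMeasurable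
      (ae_of_all _ fun a => hh1 (o, a))
  have hNle : ∀ᵐ o ∂M.base, |N o| ≤ likelihood θ ω o := by
    filter_upwards [hDi] with o ⟨h0, hi, hi2⟩
    rw [← Real.norm_eq_abs]
    refine norm_integral_le_of_norm_le hi (ae_of_all _ fun a => ?_)
    rw [norm_mul, Real.norm_eq_abs, Real.norm_eq_abs, abs_of_nonneg (h0 a)]
    exact mul_le_of_le_one_left (h0 a) (hh1 _)
  have hSl : ∀ᵐ o ∂M.base, S o * likelihood θ ω o = N o := by
    filter_upwards [hNle] with o ho
    by_cases h0 : likelihood θ ω o = 0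
    · rw [h0] at ho
      rw [h0, mul_zero, abs_eq_zero.1 (le_antisymm ho (abs_nonneg _))]
    · simp only [hS]; field_simp
  have hS1 : ∀ᵐ o ∂M.base, |S o| ≤ 1 := by
    filter_upwards [hNle, likelihood_nonneg hθ ω] with o ho h0
    rw [hS, abs_div, abs_of_nonneg h0]
    exact div_le_one_of_le₀ ho h0
  have hS1' : ∀ᵐ o ∂(obsLaw θ ω), |S o| ≤ 1 := (obsLaw_absolutelyContinuous ω).ae_le hS1
  have hSL : MemLp S 2 (obsLaw θ ω) := MemLp.of_bound hSm.aestronglyMeasurable 1 hS1'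
  have hsi : Integrable s (obsLaw θ ω) := hs.integrable one_le_two
  have hsh : Integrable (fun z : Obs n d × ℝ => s z.1 * h z) (completeLaw θ ω) := by
    have h1 : Integrable (fun z : Obs n d × ℝ => s z.1) (completeLaw θ ω) :=
      hsi.comp_measurable measurable_fst
    exact h1.mul_bdd (c := 1) hh.aestronglyMeasurable (ae_of_all _ hh1)
  have hexp : ∫ z, s z.1 * h z ∂(completeLaw θ ω) = ∫ o, s o * S o ∂(obsLaw θ ω) := by
    rw [integral_completeLaw hθ, integral_obsLaw hθ,
      integral_prod _ ((integrable_completeLaw_iff hθ ω _).1 hsh)]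
    refine integral_congr_ae ?_
    filter_upwards [hSl] with o ho
    simp only [mul_assoc]
    rw [integral_const_mul, ho]
  rw [hexp]
  -- Regularity demands positive information. If the information is zero then S vanishes almost
  -- surely and there is nothing to prove.
  by_cases hpos : 0 < ∫ o, S o ^ 2 ∂(obsLaw θ ω)
  swap
  · have h0 : ∫ o, S o ^ 2 ∂(obsLaw θ ω) = 0 :=
      le_antisymm (not_lt.1 hpos) (integral_nonneg fun o => sq_nonneg _)
    have h1 := (integral_eq_zero_iff_of_nonneg (fun o => sq_nonneg (S o)) hSL.integrable_sq).1 h0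
    refine integral_eq_zero_of_ae ?_
    filter_upwards [h1] with o ho
    have : S o = 0 := by simpa using ho
    simp [this]
  refine hso path S hp0 ⟨by rwa [hp0], ?_, by rwa [hp0]⟩
  rw [hp0]
  have hub : ∀ᶠ η in 𝓝[≠] (0 : ℝ), ∫⁻ o, ENNReal.ofReal
      (((√(likelihood θ (path η) o) - √(likelihood θ ω o)
        - η / 2 * S o * √(likelihood θ ω o)) / η) ^ 2) ∂M.base ≤ ENNReal.ofReal (η ^ 2) := by
    have hball : ∀ᶠ η in 𝓝[≠] (0 : ℝ), |η| ≤ 1 / 2 := by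
      refine nhdsWithin_le_nhds ?_
      filter_upwards [Metric.closedBall_mem_nhds (0 : ℝ) (by norm_num : (0 : ℝ) < 1 / 2)] with η hη
      simpa using hη
    filter_upwards [hball, self_mem_nhdsWithin] with η hη hη0
    have hη0 : η ≠ 0 := hη0
    have hone : ∫⁻ o, ENNReal.ofReal (likelihood θ ω o) ∂M.base = 1 := by
      have := measure_univ (μ := obsLaw θ ω)
      rwa [obsLaw_eq hθ, withDensity_apply _ MeasurableSet.univ, setLIntegral_univ] at this
    calc _ ≤ ∫⁻ o, ENNReal.ofReal (η ^ 2) * ENNReal.ofReal (likelihood θ ω o) ∂M.base := by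
          refine lintegral_mono_ae ?_
          filter_upwards [hDi, hSl, hS1, likelihood_nonneg hθ ω] with o ⟨h0, hi, hi2⟩ hSo hS1o hlo
          rw [← ENNReal.ofReal_mul (sq_nonneg _)]
          refine ENNReal.ofReal_le_ofReal ?_
          have hl : likelihood θ (path η) o = likelihood θ ω o * (1 + η * S o) := by
            unfold likelihood
            have e : ∀ a, completeDensity θ (path η) o a
                = D o a + η * (h (o, a) * D o a) := by
              intro a; rw [hden, cut_of_le hη]; ring
            simp only [e]
            rw [integral_add hi (hi2.const_mul η), integral_const_mul]
            change likelihood θ ω o + η * N o = likelihood θ ω o * _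
            rw [← hSo]; ring
          have hx : |η * S o| ≤ 1 / 2 := by
            rw [abs_mul]
            calc _ ≤ 1 / 2 * 1 := mul_le_mul hη hS1o (abs_nonneg _) (by norm_num)
              _ = _ := by norm_num
          have hb := abs_sqrt_one_add_sub_le hx
          rw [hl, Real.sqrt_mul hlo]
          have e1 : √(likelihood θ ω o) * √(1 + η * S o) - √(likelihood θ ω o)
              - η / 2 * S o * √(likelihood θ ω o)
              = √(likelihood θ ω o) * (√(1 + η * S o) - 1 - η * S o / 2) := by ring
          rw [e1, div_pow, mul_pow, Real.sq_sqrt hlo, div_le_iff₀ (by positivity)]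
          have h3 : (√(1 + η * S o) - 1 - η * S o / 2) ^ 2 ≤ η ^ 2 * η ^ 2 := by
            rw [← sq_abs]
            have h4 : |√(1 + η * S o) - 1 - η * S o / 2| ≤ η ^ 2 := by
              refine hb.trans ?_
              rw [mul_pow]
              have : S o ^ 2 ≤ 1 := by rw [← sq_abs]; nlinarith [abs_nonneg (S o)]
              nlinarith [sq_nonneg η]
            nlinarith [abs_nonneg (√(1 + η * S o) - 1 - η * S o / 2)]
          calc _ ≤ likelihood θ ω o * (η ^ 2 * η ^ 2) := mul_le_mul_of_nonneg_left h3 hlo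
            _ = _ := by ring
      _ = ENNReal.ofReal (η ^ 2) := by
          rw [lintegral_const_mul _ (measurable_likelihood hθ ω).ennreal_ofReal, hone, mul_one]
  have hlim : Tendsto (fun η : ℝ => ENNReal.ofReal (η ^ 2)) (𝓝[≠] 0) (𝓝 0) := by
    have : Continuous fun η : ℝ => ENNReal.ofReal (η ^ 2) :=
      ENNReal.continuous_ofReal.comp (continuous_pow 2)
    have h := this.tendsto 0
    simp only [ne_eq, OfNat.ofNat_ne_zero, not_false_eq_true, zero_pow, ENNReal.ofReal_zero] at h
    exact h.mono_left nhdsWithin_le_nhds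
  exact tendsto_of_tendsto_of_tendsto_of_le_of_le' tendsto_const_nhds hlim
    (Eventually.of_forall fun _ => zero_le) hub

/-- Tilting the distribution of the initial condition. -/
noncomputable def Nuisance.tiltInit (ω : Nuisance M) (k : ℝ × Cov d → ℝ) (hk : Measurable k)
    (hk1 : ∀ c, k c ∈ Icc (0 : ℝ) 1) (η : ℝ) : Nuisance M :=
  have hb : ∀ c, |k c - ∫ c', k c' * ω.ν c' ∂M.m₀| ≤ 1 := fun c =>
    abs_sub_le_one_of_mem_Icc (hk1 c) (integral_mul_mem_Icc ω.ν_meas ω.ν_nonneg ω.ν_one hk hk1)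
  { ω with
    ν := fun c => ω.ν c * (1 + cut η * (k c - ∫ c', k c' * ω.ν c' ∂M.m₀))
    ν_meas := ω.ν_meas.mul (measurable_const.add ((hk.sub measurable_const).const_mul _))
    ν_nonneg := fun c => mul_nonneg (ω.ν_nonneg c) (one_add_cut_mul_pos η (hb c)).le
    ν_pos_iff := fun c => by
      rw [mul_pos_iff_of_pos_right (one_add_cut_mul_pos η (hb c))]; exact ω.ν_pos_iff c
    ν_one := lintegral_tilt ω.ν_meas ω.ν_nonneg ω.ν_one hk hk1 η }

lemma Nuisance.tiltInit_zero (ω : Nuisance M) {k : ℝ × Cov d → ℝ} (hk : Measurable k)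
    (hk1 : ∀ c, k c ∈ Icc (0 : ℝ) 1) : ω.tiltInit k hk hk1 0 = ω := by
  cases ω
  simp [Nuisance.tiltInit, cut_zero]

/-- Tilting the distribution of the heterogeneity. -/
noncomputable def Nuisance.tiltHet (ω : Nuisance M) (k : (ℝ × Cov d) × ℝ → ℝ) (hk : Measurable k)
    (hk1 : ∀ c, k c ∈ Icc (0 : ℝ) 1) (η : ℝ) : Nuisance M :=
  have hm : ∀ c, Measurable fun a => k (c, a) := fun c => hk.comp measurable_prodMk_left
  have hπ : ∀ c, Measurable (ω.π c) := fun c => ω.π_meas.comp measurable_prodMk_left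
  have hb : ∀ c a, |k (c, a) - ∫ a', k (c, a') * ω.π c a'| ≤ 1 := fun c a =>
    abs_sub_le_one_of_mem_Icc (hk1 _)
      (integral_mul_mem_Icc (hπ c) (ω.π_nonneg c) (ω.π_one c) (hm c) fun a => hk1 _)
  { ω with
    π := fun c a => ω.π c a * (1 + cut η * (k (c, a) - ∫ a', k (c, a') * ω.π c a'))
    π_meas := ω.π_meas.mul (measurable_const.add ((hk.sub
      ((hk.mul ω.π_meas).stronglyMeasurable.integral_prod_right'.measurable.comp
        measurable_fst)).const_mul _))
    π_nonneg := fun c a => mul_nonneg (ω.π_nonneg c a) (one_add_cut_mul_pos η (hb c a)).le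
    π_pos_iff := fun c a => by
      rw [mul_pos_iff_of_pos_right (one_add_cut_mul_pos η (hb c a))]; exact ω.π_pos_iff c a
    π_one := fun c =>
      lintegral_tilt (hπ c) (ω.π_nonneg c) (ω.π_one c) (hm c) (fun a => hk1 _) η }

lemma Nuisance.tiltHet_zero (ω : Nuisance M) {k : (ℝ × Cov d) × ℝ → ℝ} (hk : Measurable k)
    (hk1 : ∀ c, k c ∈ Icc (0 : ℝ) 1) : ω.tiltHet k hk hk1 0 = ω := by
  cases ω
  simp [Nuisance.tiltHet, cut_zero]

/-- Tilting the feedback process in one period. -/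
noncomputable def Nuisance.tiltCov (ω : Nuisance M) (j : Fin n)
    (k : (Past d j.val × ℝ) × Cov d → ℝ) (hk : Measurable k)
    (hk1 : ∀ c, k c ∈ Icc (0 : ℝ) 1) (η : ℝ) : Nuisance M :=
  have hm : ∀ p, Measurable fun x => k (p, x) := fun p => hk.comp measurable_prodMk_left
  have hg : ∀ p, Measurable (ω.g j p) := fun p => (ω.g_meas j).comp measurable_prodMk_left
  have hb : ∀ p x, |k (p, x) - ∫ x', k (p, x') * ω.g j p x' ∂(M.mX j)| ≤ 1 := fun p x =>
    abs_sub_le_one_of_mem_Icc (hk1 _)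
      (integral_mul_mem_Icc (hg p) (ω.g_nonneg j p) (ω.g_one j p) (hm p) fun x => hk1 _)
  { ω with
    g := Function.update ω.g j fun p x =>
      ω.g j p x * (1 + cut η * (k (p, x) - ∫ x', k (p, x') * ω.g j p x' ∂(M.mX j)))
    g_meas := fun i => by
      by_cases h : i = j
      · subst h
        simp only [Function.update_self]
        exact (ω.g_meas i).mul (measurable_const.add ((hk.sub
          ((hk.mul (ω.g_meas i)).stronglyMeasurable.integral_prod_right'.measurable.comp
            measurable_fst)).const_mul _))
      · simp only [Function.update_of_ne h]
        exact ω.g_meas i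
    g_nonneg := fun i p x => by
      by_cases h : i = j
      · subst h
        simp only [Function.update_self]
        exact mul_nonneg (ω.g_nonneg i p x) (one_add_cut_mul_pos η (hb p x)).le
      · simp only [Function.update_of_ne h]
        exact ω.g_nonneg i p x
    g_pos_iff := fun i p x => by
      by_cases h : i = j
      · subst h
        simp only [Function.update_self]
        rw [mul_pos_iff_of_pos_right (one_add_cut_mul_pos η (hb p x))]
        exact ω.g_pos_iff i p x
      · simp only [Function.update_of_ne h]
        exact ω.g_pos_iff i p x
    g_one := fun i p => by
      by_cases h : i = j
      · subst h
        simp only [Function.update_self]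
        exact lintegral_tilt (hg p) (ω.g_nonneg i p) (ω.g_one i p) (hm p) (fun a => hk1 _) η
      · simp only [Function.update_of_ne h]
        exact ω.g_one i p }

lemma Nuisance.tiltCov_zero (ω : Nuisance M) (j : Fin n)
    {k : (Past d j.val × ℝ) × Cov d → ℝ} (hk : Measurable k)
    (hk1 : ∀ c, k c ∈ Icc (0 : ℝ) 1) : ω.tiltCov j k hk hk1 0 = ω := by
  cases ω
  simp [Nuisance.tiltCov, cut_zero, Function.update_eq_self]

/-! ### Consequences of orthogonality to the tilted scores. -/

variable {ω : Nuisance M} {s : Obs n d → ℝ}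

/-- The tilt gives orthogonality to k centred at its mean, and E[s] = 0 removes the centring
constant. -/
lemma orthScores_init (hθ : θ ∈ M.Θ) (hs : MemLp s 2 (obsLaw θ ω)) (hso : OrthScores θ ω s)
    (hs0 : ∫ o, s o ∂(obsLaw θ ω) = 0) {k : ℝ × Cov d → ℝ} (hk : Measurable k)
    (hk1 : ∀ c, k c ∈ Icc (0 : ℝ) 1) : ∫ z, s z.1 * k z.1.1 ∂(completeLaw θ ω) = 0 := by
  have : Fact (θ ∈ M.Θ) := ⟨hθ⟩
  have h := orthScores_integral_mul_eq_zero hθ (ω.tiltInit_zero hk hk1)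
    (h := fun z => k z.1.1 - ∫ c', k c' * ω.ν c' ∂M.m₀)
    ((hk.comp (measurable_fst.comp measurable_fst)).sub measurable_const)
    (fun z => abs_sub_le_one_of_mem_Icc (hk1 _)
      (integral_mul_mem_Icc ω.ν_meas ω.ν_nonneg ω.ν_one hk hk1))
    (fun η o a => by simp only [completeDensity, Nuisance.tiltInit]; ring) hs hso
  have hsi : Integrable (fun z : Obs n d × ℝ => s z.1) (completeLaw θ ω) :=
    (hs.integrable one_le_two).comp_measurable measurable_fst
  have hs0' : ∫ z, s z.1 ∂(completeLaw θ ω) = 0 := by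
    rw [obsLaw, integral_map measurable_fst.aemeasurable
      hs.aestronglyMeasurable] at hs0
    exact hs0
  have i1 : Integrable (fun z : Obs n d × ℝ => s z.1 * k z.1.1) (completeLaw θ ω) :=
    hsi.mul_bdd (c := 1) (hk.comp (measurable_fst.comp measurable_fst)).aestronglyMeasurable
      (ae_of_all _ fun z => by
        rw [Real.norm_eq_abs]; exact abs_le.2 ⟨by linarith [(hk1 z.1.1).1], (hk1 z.1.1).2⟩)
  simp only [mul_sub] at h
  rw [integral_sub i1 (hsi.mul_const _), integral_mul_const, hs0'] at h
  linarith

/-- The centring term of the tilt of π is a function of (y₀, x₁), to which s is already orthogonal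
by the tilts of ν. Since k is arbitrary, the conclusion reads E[s | A, Y₀, X_1] = 0. -/
lemma orthScores_het (hθ : θ ∈ M.Θ) (hs : MemLp s 2 (obsLaw θ ω)) (hso : OrthScores θ ω s)
    (hs0 : ∫ o, s o ∂(obsLaw θ ω) = 0) {k : (ℝ × Cov d) × ℝ → ℝ} (hk : Measurable k)
    (hk1 : ∀ c, k c ∈ Icc (0 : ℝ) 1) : ∫ z, s z.1 * k (z.1.1, z.2) ∂(completeLaw θ ω) = 0 := by
  have : Fact (θ ∈ M.Θ) := ⟨hθ⟩
  set kb : ℝ × Cov d → ℝ := fun c => ∫ a', k (c, a') * ω.π c a' with hkb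
  have hkbm : Measurable kb :=
    (hk.mul ω.π_meas).stronglyMeasurable.integral_prod_right'.measurable
  have hkb1 : ∀ c, kb c ∈ Icc (0 : ℝ) 1 := fun c =>
    integral_mul_mem_Icc (ω.π_meas.comp measurable_prodMk_left) (ω.π_nonneg c) (ω.π_one c)
      (hk.comp measurable_prodMk_left) fun a => hk1 _
  have hkm' : Measurable fun z : Obs n d × ℝ => k (z.1.1, z.2) := hk.comp (by fun_prop)
  have hkbm' : Measurable fun z : Obs n d × ℝ => kb z.1.1 := hkbm.comp (by fun_prop)
  have h := orthScores_integral_mul_eq_zero hθ (ω.tiltHet_zero hk hk1)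
    (h := fun z => k (z.1.1, z.2) - kb z.1.1)
    (hkm'.sub hkbm')
    (fun z => abs_sub_le_one_of_mem_Icc (hk1 _) (hkb1 _))
    (fun η o a => by simp only [completeDensity, Nuisance.tiltHet]; ring) hs hso
  have hsi : Integrable (fun z : Obs n d × ℝ => s z.1) (completeLaw θ ω) :=
    (hs.integrable one_le_two).comp_measurable measurable_fst
  have i1 : Integrable (fun z : Obs n d × ℝ => s z.1 * k (z.1.1, z.2)) (completeLaw θ ω) :=
    hsi.mul_bdd (c := 1) hkm'.aestronglyMeasurable (ae_of_all _ fun z => by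
      rw [Real.norm_eq_abs]; exact abs_le.2 ⟨by linarith [(hk1 (z.1.1, z.2)).1], (hk1 _).2⟩)
  have i2 : Integrable (fun z : Obs n d × ℝ => s z.1 * kb z.1.1) (completeLaw θ ω) :=
    hsi.mul_bdd (c := 1) hkbm'.aestronglyMeasurable (ae_of_all _ fun z => by
      rw [Real.norm_eq_abs]; exact abs_le.2 ⟨by linarith [(hkb1 z.1.1).1], (hkb1 _).2⟩)
  simp only [mul_sub] at h
  rw [integral_sub i1 i2, orthScores_init hθ hs hso hs0 hkbm hkb1, sub_zero] at h
  exact h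

/-- Here the centring term stays: orthogonality to the feedback scores only says that E[s | A, past,
X_{j+2}] does not vary with X_{j+2}. -/
lemma orthScores_cov (hθ : θ ∈ M.Θ) (hs : MemLp s 2 (obsLaw θ ω)) (hso : OrthScores θ ω s)
    (j : Fin n) {k : (Past d j.val × ℝ) × Cov d → ℝ} (hk : Measurable k)
    (hk1 : ∀ c, k c ∈ Icc (0 : ℝ) 1) :
    ∫ z, s z.1 * (k ((z.1.past j, z.2), z.1.x j.succ)
      - ∫ x', k ((z.1.past j, z.2), x') * ω.g j (z.1.past j, z.2) x' ∂(M.mX j))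
      ∂(completeLaw θ ω) = 0 := by
  have hm : Measurable fun z : Obs n d × ℝ => (z.1.past j, z.2) := by fun_prop
  have hkm' : Measurable fun z : Obs n d × ℝ => k ((z.1.past j, z.2), z.1.x j.succ) :=
    hk.comp (f := fun z : Obs n d × ℝ => ((z.1.past j, z.2), z.1.x j.succ)) (by fun_prop)
  have hkb : Measurable fun p : Past d j.val × ℝ => ∫ x', k (p, x') * ω.g j p x' ∂(M.mX j) :=
    (hk.mul (ω.g_meas j)).stronglyMeasurable.integral_prod_right'.measurable
  refine orthScores_integral_mul_eq_zero hθ (ω.tiltCov_zero j hk hk1)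
    (h := fun z => k ((z.1.past j, z.2), z.1.x j.succ)
      - ∫ x', k ((z.1.past j, z.2), x') * ω.g j (z.1.past j, z.2) x' ∂(M.mX j))
    (hkm'.sub (hkb.comp hm))
    (fun z => abs_sub_le_one_of_mem_Icc (hk1 _)
      (integral_mul_mem_Icc ((ω.g_meas j).comp measurable_prodMk_left) (ω.g_nonneg j _)
        (ω.g_one j _) (hk.comp measurable_prodMk_left) fun a => hk1 _)) ?_ hs hso
  intro η o a
  unfold completeDensity
  rw [← Finset.mul_prod_erase _ (fun i => (ω.tiltCov j k hk hk1 η).g i (o.past i, a) (o.x i.succ))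
    (Finset.mem_univ j), ← Finset.mul_prod_erase _ (fun i => ω.g i (o.past i, a) (o.x i.succ))
    (Finset.mem_univ j)]
  have e1 : ∀ i ∈ Finset.univ.erase j, (ω.tiltCov j k hk hk1 η).g i (o.past i, a) (o.x i.succ)
      = ω.g i (o.past i, a) (o.x i.succ) := by
    intro i hi
    simp only [Nuisance.tiltCov, Function.update_of_ne (Finset.ne_of_mem_erase hi)]
  rw [Finset.prod_congr rfl e1]
  simp only [Nuisance.tiltCov, Function.update_self]
  ring

end MPH

namespace MPH
open scoped ENNReal

variable {n q d : ℕ} {M : Model n q d} {θ : Param q d}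

/-! ### The information sets -/

/-- Values of `(Y₀, P̃_1, …, P̃_k, P̄, X_1, …, X_m)`. -/
abbrev InfoSpace (n d k m : ℕ) : Type :=
  ℝ × ({s : Fin (n + 1) // s.val < k} → ℝ) × ℝ × ({s : Fin (n + 1) // s.val < m} → Cov d)

/-- The variables `(Y₀, P̃_1, …, P̃_k, P̄, X_1, …, X_m)`. -/
noncomputable def infoVar (M : Model n q d) (θ : Param q d) (k m : ℕ) (o : Obs n d) :
    InfoSpace n d k m :=
  (o.y 0, (fun s => M.Ptilde θ o s), M.Pbar θ o, fun s => o.x s)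

lemma info_eq_comap (M : Model n q d) (θ : Param q d) (k m : ℕ) :
    M.info θ k m = MeasurableSpace.comap (infoVar M θ k m) inferInstance := rfl

lemma measurable_infoVar (hθ : θ ∈ M.Θ) (k m : ℕ) : Measurable (infoVar M θ k m) := by
  have h1 := fun t => measurable_Ptilde (M := M) hθ t
  have h2 : Measurable fun o => M.Pbar θ o :=
    Finset.measurable_fun_sum _ fun t _ => Model.measurable_P hθ t
  unfold infoVar
  fun_prop

lemma info_le (hθ : θ ∈ M.Θ) (k m : ℕ) :
    M.info θ k m ≤ (inferInstance : MeasurableSpace (Obs n d)) :=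
  (measurable_infoVar hθ k m).comap_le

lemma measurable_infoVar_info (M : Model n q d) (θ : Param q d) (k m : ℕ) :
    Measurable[M.info θ k m] (infoVar M θ k m) := comap_measurable _

lemma info_mono (M : Model n q d) (θ : Param q d) {k m k' m' : ℕ} (hk : k ≤ k') (hm : m ≤ m') :
    M.info θ k m ≤ M.info θ k' m' := by
  have h : infoVar M θ k m = (fun w : InfoSpace n d k' m' =>
      ((w.1, (fun s => w.2.1 ⟨s.1, s.2.trans_le hk⟩), w.2.2.1,
        fun s => w.2.2.2 ⟨s.1, s.2.trans_le hm⟩) : InfoSpace n d k m)) ∘ infoVar M θ k' m' := rfl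
  rw [info_eq_comap, h, ← MeasurableSpace.comap_comp]
  exact MeasurableSpace.comap_mono (Measurable.comap_le (by fun_prop))

/-- Adds one transformed duration to the information. -/
def consInfo (j : ℕ) (v : InfoSpace n d j (j + 1) × ℝ) : InfoSpace n d (j + 1) (j + 1) :=
  (v.1.1, (fun s => if h : s.1.val < j then v.1.2.1 ⟨s.1, h⟩ else v.2), v.1.2.2.1, v.1.2.2.2)

lemma measurable_consInfo (j : ℕ) : Measurable (consInfo (n := n) (d := d) j) := by
  unfold consInfo
  refine Measurable.prodMk (by fun_prop) (Measurable.prodMk ?_ (by fun_prop))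
  refine measurable_pi_lambda _ fun s => ?_
  by_cases h : s.1.val < j
  · simp only [dif_pos h]; fun_prop
  · simp only [dif_neg h]; fun_prop

lemma infoVar_succ {j : ℕ} (hj : j < n + 1) (o : Obs n d) :
    infoVar M θ (j + 1) (j + 1) o
      = consInfo j (infoVar M θ j (j + 1) o, M.Ptilde θ o ⟨j, hj⟩) := by
  unfold infoVar consInfo
  refine Prod.ext rfl (Prod.ext (funext fun s => ?_) rfl)
  by_cases h : s.1.val < j
  · simp only [dif_pos h]
  · simp only [dif_neg h]
    congr 1
    ext
    have := s.2
    simp only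
    omega

lemma tailP_eq_sum_add (o : Obs n d) {k j : ℕ} (hkj : k ≤ j) :
    tailP M θ k o = (∑ r ∈ Finset.univ.filter
      (fun r : Fin (n + 1) => k ≤ r.val ∧ r.val < j), M.P θ o r) + tailP M θ j o := by
  unfold tailP
  rw [← Finset.sum_union]
  · congr 1
    ext r
    simp only [Finset.mem_filter, Finset.mem_univ, true_and, Finset.mem_union]
    omega
  · rw [Finset.disjoint_left]
    intro r
    simp only [Finset.mem_filter, Finset.mem_univ, true_and]
    omega

/-- `(Y₀, P̃_1, …, P̃_j, P̄, X_1, …, X_{j+1})` is a function of the past and of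
`P_{j+1} + ⋯ + P_T`. -/
lemma exists_infoVar_eq (hθ : θ ∈ M.Θ) (j : ℕ) :
    ∃ w : Obs n d × ℝ → InfoSpace n d j (j + 1), Measurable w ∧
      ∀ o, infoVar M θ j (j + 1) o = w (tau j j o, tailP M θ j o) := by
  have hP := fun t => Model.measurable_P (M := M) hθ t
  -- The partial sums of P over periods k + 1, ..., j are known from the past; adding the remaining
  -- sum gives each denominator of P̃, and P̄ for k = 0.
  let psum : ℕ → Obs n d → ℝ := fun k o => ∑ r ∈ Finset.univ.filter
      (fun r : Fin (n + 1) => k ≤ r.val ∧ r.val < j), M.P θ o r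
  have hps : ∀ k, Measurable (psum k) := fun k => Finset.measurable_fun_sum _ fun t _ => hP t
  have hpst : ∀ k o, psum k (tau j j o) = psum k o := by
    intro k o
    refine Finset.sum_congr rfl fun r hr => ?_
    simp only [Finset.mem_filter, Finset.mem_univ, true_and] at hr
    exact P_tau r (by omega) (by omega) o
  refine ⟨fun v => (v.1.y 0, (fun s => M.P θ v.1 s / (psum s.1.val v.1 + v.2)), psum 0 v.1 + v.2,
    fun s => v.1.x s), ?_, fun o => ?_⟩
  · refine Measurable.prodMk (by fun_prop) (Measurable.prodMk ?_ (Measurable.prodMk ?_ ?_))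
    · refine measurable_pi_lambda _ fun s => ?_
      have := hps s.1.val
      have := hP s.1
      fun_prop
    · have := hps 0
      fun_prop
    · refine measurable_pi_lambda _ fun s => (measurable_x s.1).comp measurable_fst
  · refine Prod.ext rfl (Prod.ext (funext fun s => ?_) (Prod.ext ?_ (funext fun s => ?_)))
    · simp only [infoVar]
      have hs := s.2
      rw [hpst, P_tau s.1 (by omega) (by omega), Ptilde_eq, tailP_eq_sum_add o hs.le]
    · simp only [infoVar]
      rw [hpst, ← tailP_zero, tailP_eq_sum_add o (Nat.zero_le j)]
    · simp only [infoVar]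
      rw [tau_x o (by have := s.2; omega)]

/-! ### Functions that are almost surely determined by a sub-σ-algebra -/

/-- Almost everywhere equal to a function measurable with respect to `m`. -/
def AEDetermined {Ω β : Type*} [MeasurableSpace β] (m : MeasurableSpace Ω)
    {m₀ : MeasurableSpace Ω} (μ : Measure Ω) (f : Ω → β) : Prop :=
  ∃ g : Ω → β, Measurable[m] g ∧ f =ᵐ[μ] g

namespace AEDetermined

variable {Ω β γ : Type*} [MeasurableSpace β] [MeasurableSpace γ] {m m₀ : MeasurableSpace Ω}
  {μ : Measure Ω} {f : Ω → β}

lemma of_measurable (hf : Measurable[m] f) : AEDetermined m μ f := ⟨f, hf, ae_eq_rfl⟩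

lemma comp (hf : AEDetermined m μ f) {φ : β → γ} (hφ : Measurable φ) :
    AEDetermined m μ fun o => φ (f o) := by
  obtain ⟨g, hg, hfg⟩ := hf
  exact ⟨fun o => φ (g o), hφ.comp hg, hfg.mono fun o ho => congrArg φ ho⟩

lemma prodMk (hf : AEDetermined m μ f) {f' : Ω → γ} (hf' : AEDetermined m μ f') :
    AEDetermined m μ fun o => (f o, f' o) := by
  obtain ⟨g, hg, hfg⟩ := hf
  obtain ⟨g', hg', hfg'⟩ := hf'
  exact ⟨fun o => (g o, g' o), hg.prodMk hg', by
    filter_upwards [hfg, hfg'] with o h1 h2; rw [h1, h2]⟩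

lemma pi {ι : Type*} [Countable ι] {β : ι → Type*} [∀ i, MeasurableSpace (β i)]
    {f : ∀ i, Ω → β i} (hf : ∀ i, AEDetermined m μ (f i)) :
    AEDetermined m μ fun o i => f i o := by
  choose g hg hfg using hf
  exact ⟨fun o i => g i o, @measurable_pi_lambda _ _ _ m _ _ hg, by
    filter_upwards [ae_all_iff.2 hfg] with o h; exact funext h⟩

lemma congr (hf : AEDetermined m μ f) {f' : Ω → β} (h : f' =ᵐ[μ] f) : AEDetermined m μ f' := by
  obtain ⟨g, hg, hfg⟩ := hf
  exact ⟨g, hg, h.trans hfg⟩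

lemma aestronglyMeasurable {f : Ω → ℝ} (hf : AEDetermined m μ f) :
    AEStronglyMeasurable[m] f μ := by
  obtain ⟨g, hg, hfg⟩ := hf
  exact ⟨g, hg.stronglyMeasurable, hfg⟩

end AEDetermined

lemma aeDetermined_x (ω : Nuisance M) {k m : ℕ} (s : Fin (n + 1)) (hs : s.val < m) :
    AEDetermined (M.info θ k m) (obsLaw θ ω) fun o => o.x s :=
  .of_measurable ((show Measurable fun w : InfoSpace n d k m => w.2.2.2 ⟨s, hs⟩ by
    fun_prop).comp (measurable_infoVar_info M θ k m))

/-- Divide P_t by the known factor exp(γ y_{t-1} + x_t'β) and invert the integrated hazard. The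
inversion is valid for positive durations, hence almost surely. -/
lemma aeDetermined_y_of_P (hθ : θ ∈ M.Θ) (ω : Nuisance M) {m : MeasurableSpace (Obs n d)}
    (t : Fin (n + 1)) (hP : AEDetermined m (obsLaw θ ω) fun o => M.P θ o t)
    (hy : AEDetermined m (obsLaw θ ω) fun o => o.y t.castSucc)
    (hx : AEDetermined m (obsLaw θ ω) fun o => o.x t) :
    AEDetermined m (obsLaw θ ω) fun o => o.y t.succ := by
  obtain ⟨v, hv, hvy⟩ := (Model.isHazard hθ).exists_leftInverse
  have hφ : Measurable fun p : (ℝ × ℝ) × Cov d =>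
      v (p.1.1 * Real.exp (-(θ.gamma * p.1.2 + p.2 ⬝ᵥ θ.beta))) := by
    unfold dotProduct
    fun_prop
  refine (((hP.prodMk hy).prodMk hx).comp hφ).congr ?_
  filter_upwards [obsLaw_pos ω] with o ho
  have h1 : M.P θ o t * Real.exp (-(θ.gamma * o.y t.castSucc + o.x t ⬝ᵥ θ.beta))
      = ∫ u in (0 : ℝ)..o.y t.succ, M.haz θ.alpha u := by
    rw [Model.P, Model.rho, mul_assoc, ← Real.exp_add, add_neg_cancel, Real.exp_zero, mul_one]
    rfl
  rw [h1, Obs.y_succ, hvy _ (ho t).le]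

/-- The durations and remaining sums are recovered together, forwards in time: P_{s+1} is P̃_{s+1}
times the remaining sum, it yields y_{s+1} through x_{s+1} and y_s, and subtracting it yields the
next remaining sum. Starting values are Y₀ and P̄; the condition k ≤ m supplies the covariates. -/
lemma aeDetermined_y_tailP (hθ : θ ∈ M.Θ) (ω : Nuisance M) {k m : ℕ} (hk : k ≤ n) (hm : k ≤ m)
    {s : ℕ} (hs : s ≤ k) :
    (AEDetermined (M.info θ k m) (obsLaw θ ω) fun o => o.y ⟨s, by omega⟩) ∧
      AEDetermined (M.info θ k m) (obsLaw θ ω) fun o => tailP M θ s o := by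
  induction s with
  | zero =>
    refine ⟨.of_measurable ((show Measurable fun w : InfoSpace n d k m => w.1 by
      fun_prop).comp (measurable_infoVar_info M θ k m)), ?_⟩
    simp only [tailP_zero]
    exact .of_measurable ((show Measurable fun w : InfoSpace n d k m => w.2.2.1 by
      fun_prop).comp (measurable_infoVar_info M θ k m))
  | succ s ih =>
    obtain ⟨hy, hQ⟩ := ih (by omega)
    set t : Fin (n + 1) := ⟨s, by omega⟩ with ht
    have hPt : AEDetermined (M.info θ k m) (obsLaw θ ω) fun o => M.Ptilde θ o t :=
      .of_measurable ((show Measurable fun w : InfoSpace n d k m => w.2.1 ⟨t, hs⟩ by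
        fun_prop).comp (measurable_infoVar_info M θ k m))
    have hP : AEDetermined (M.info θ k m) (obsLaw θ ω) fun o => M.P θ o t := by
      refine ((hPt.prodMk hQ).comp (φ := fun p : ℝ × ℝ => p.1 * p.2) (by fun_prop)).congr ?_
      filter_upwards [obsLaw_pos ω] with o ho
      have := (tailP_pos hθ ho (show s ≤ n by omega)).ne'
      rw [Ptilde_eq, div_mul_cancel₀ _ this]
    refine ⟨aeDetermined_y_of_P hθ ω t hP hy (aeDetermined_x ω t (by simp only [ht]; omega)), ?_⟩
    refine ((hQ.prodMk hP).comp (φ := fun p : ℝ × ℝ => p.1 - p.2) (by fun_prop)).congr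
      (ae_of_all _ fun o => ?_)
    have := tailP_eq_add (M := M) (θ := θ) t o
    simp only [ht] at this ⊢
    rw [this]
    ring

lemma aeDetermined_tau (hθ : θ ∈ M.Θ) (ω : Nuisance M) {k m l : ℕ} (hk : k ≤ n) (hm : k ≤ m)
    (hl : l < m) : AEDetermined (M.info θ k m) (obsLaw θ ω) (tau k l : Obs n d → Obs n d) := by
  refine .prodMk (.prodMk ?_ ?_) (.prodMk (.pi fun i => ?_) (.pi fun j => ?_))
  · exact (aeDetermined_y_tailP hθ ω hk hm (Nat.zero_le k)).1
  · exact aeDetermined_x ω 0 (by simp only [Fin.val_zero]; omega)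
  · by_cases h : i.val < k
    · simp only [if_pos h]
      exact (aeDetermined_y_tailP hθ ω hk hm (s := i.val + 1) h).1
    · simp only [if_neg h]
      exact .of_measurable measurable_const
  · by_cases h : j.val < l
    · simp only [if_pos h]
      exact aeDetermined_x ω j.succ (by simp only [Fin.val_succ]; omega)
    · simp only [if_neg h]
      exact .of_measurable measurable_const

lemma tailP_last_eq (o : Obs n d) : tailP M θ n o = M.P θ o (Fin.last n) := by
  have := tailP_eq_add (M := M) (θ := θ) (Fin.last n) o
  simpa [tailP_last] using this

/-- The observed data are determined by `(Y₀, P̃_1, …, P̃_{T-1}, P̄, X_1, …, X_T)`. -/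
lemma aeDetermined_id (hθ : θ ∈ M.Θ) (ω : Nuisance M) :
    AEDetermined (M.info θ n (n + 1)) (obsLaw θ ω) fun o : Obs n d => o := by
  have hQ := (aeDetermined_y_tailP (M := M) hθ ω (m := n + 1) le_rfl (Nat.le_succ n) le_rfl).2
  simp only [tailP_last_eq] at hQ
  have hyn := (aeDetermined_y_tailP (M := M) hθ ω (m := n + 1) le_rfl (Nat.le_succ n) le_rfl).1
  have hlast := aeDetermined_y_of_P hθ ω (Fin.last n) hQ hyn
    (aeDetermined_x ω _ (Nat.lt_succ_self n))
  refine .prodMk (.prodMk ?_ ?_) (.prodMk (.pi fun i => ?_) (.pi fun j => ?_))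
  · exact (aeDetermined_y_tailP hθ ω le_rfl (Nat.le_succ n) (Nat.zero_le n)).1
  · exact aeDetermined_x ω 0 (by simp)
  · by_cases h : i.val < n
    · exact (aeDetermined_y_tailP hθ ω le_rfl (Nat.le_succ n) (s := i.val + 1) h).1
    · have : i = Fin.last n := by ext; have := i.2; simp only [Fin.val_last]; omega
      subst this
      exact hlast
  · exact aeDetermined_x ω j.succ (by simp)

end MPH

namespace MPH
open scoped ENNReal

variable {n q d : ℕ} {M : Model n q d} {θ : Param q d}

/-! ### Conditional expectations given the information sets -/

lemma integral_condExp_mul_comm {Ω : Type*} {m m₀ : MeasurableSpace Ω} {μ : Measure Ω}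
    [IsFiniteMeasure μ] (hm : m ≤ m₀) {f g : Ω → ℝ} (hf : Integrable f μ)
    (hg : AEStronglyMeasurable g μ) {C : ℝ} (hgC : ∀ o, |g o| ≤ C) :
    ∫ o, (μ[f | m]) o * g o ∂μ = ∫ o, f o * (μ[g | m]) o ∂μ := by
  have hgi : Integrable g μ := Integrable.of_bound hg C (ae_of_all _ hgC)
  have hgC' : ∀ᵐ o ∂μ, ‖(μ[g | m]) o‖ ≤ C :=
     ae_bdd_abs_condExp_of_ae_bdd_abs (ae_of_all _ hgC)
  have h1 : Integrable (μ[f | m] * g) μ := integrable_condExp.mul_bdd hg (ae_of_all _ hgC)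
  have h2 : Integrable (f * μ[g | m]) μ :=
    hf.mul_bdd integrable_condExp.aestronglyMeasurable hgC'
  have e1 := condExp_mul_of_stronglyMeasurable_left (m := m) stronglyMeasurable_condExp h1 hgi
  have e2 := condExp_mul_of_stronglyMeasurable_right (m := m) stronglyMeasurable_condExp h2 hf
  calc ∫ o, (μ[f | m]) o * g o ∂μ = ∫ o, (μ[μ[f | m] * g | m]) o ∂μ := (integral_condExp hm).symm
    _ = ∫ o, (μ[f * μ[g | m] | m]) o ∂μ := integral_congr_ae (e1.trans e2.symm)
    _ = ∫ o, f o * (μ[g | m]) o ∂μ := integral_condExp hm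

lemma obsLaw_eq_map (θ : Param q d) (ω : Nuisance M) :
    obsLaw θ ω = (completeLaw θ ω).map Prod.fst := rfl

lemma integral_obsLaw_fst (ω : Nuisance M) {f : Obs n d → ℝ}
    (hf : AEStronglyMeasurable f (obsLaw θ ω)) :
    ∫ o, f o ∂(obsLaw θ ω) = ∫ z, f z.1 ∂(completeLaw θ ω) :=
  integral_map measurable_fst.aemeasurable hf

lemma integrable_obsLaw_fst (ω : Nuisance M) {f : Obs n d → ℝ}
    (hf : AEStronglyMeasurable f (obsLaw θ ω)) :
    Integrable f (obsLaw θ ω) ↔ Integrable (fun z : Obs n d × ℝ => f z.1) (completeLaw θ ω) :=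
  integrable_map_measure hf measurable_fst.aemeasurable

/-- The past durations and covariates, the heterogeneity and the sum of the remaining `P_t`. -/
noncomputable def pastTail (M : Model n q d) (θ : Param q d) (k : ℕ) (z : Obs n d × ℝ) :
    (Obs n d × ℝ) × ℝ := ((tau k k z.1, z.2), tailP M θ k z.1)

lemma measurable_pastTail (hθ : θ ∈ M.Θ) (k : ℕ) : Measurable (pastTail M θ k) := by
  have h1 := measurable_tau (n := n) (d := d) k k
  have h2 := measurable_tailP (M := M) hθ k
  unfold pastTail
  fun_prop

/-- `P̃_{k+1}` is independent of the past, the heterogeneity and the sum of the remaining `P_t`. -/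
lemma map_pastTail_Ptilde (hθ : θ ∈ M.Θ) (ω : Nuisance M) {k : ℕ} (hk : k < n) :
    (completeLaw θ ω).map (fun z => (pastTail M θ k z, M.Ptilde θ z.1 ⟨k, hk.trans (Nat.lt_succ_self n)⟩))
      = ((completeLaw θ ω).map (pastTail M θ k)).prod (betaLaw (n - (k + 1))) := by
  have hX := measurable_pastTail (M := M) hθ k
  have hB := measurable_Ptilde (M := M) hθ ⟨k, hk.trans (Nat.lt_succ_self n)⟩
  have : Fact (θ ∈ M.Θ) := ⟨hθ⟩
  have : IsProbabilityMeasure ((completeLaw θ ω).map (pastTail M θ k)) :=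
    Measure.isProbabilityMeasure_map hX.aemeasurable
  refine Measure.ext_of_lintegral _ fun F hF => ?_
  rw [lintegral_map hF (by fun_prop), lintegral_prod _ hF.aemeasurable,
    lintegral_map hF.lintegral_prod_right' hX]
  exact lintegral_tau_tailP_Ptilde hθ ω hk hF

lemma integral_pastTail_Ptilde (hθ : θ ∈ M.Θ) (ω : Nuisance M) {k : ℕ} (hk : k < n)
    {f : ((Obs n d × ℝ) × ℝ) × ℝ → ℝ} (hf : Measurable f)
    (hfi : Integrable (fun z => f (pastTail M θ k z,
      M.Ptilde θ z.1 ⟨k, hk.trans (Nat.lt_succ_self n)⟩)) (completeLaw θ ω)) :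
    Integrable (fun z => ∫ b, f (pastTail M θ k z, b) ∂(betaLaw (n - (k + 1)))) (completeLaw θ ω) ∧
    ∫ z, f (pastTail M θ k z, M.Ptilde θ z.1 ⟨k, hk.trans (Nat.lt_succ_self n)⟩) ∂(completeLaw θ ω)
      = ∫ z, (∫ b, f (pastTail M θ k z, b) ∂(betaLaw (n - (k + 1)))) ∂(completeLaw θ ω) := by
  have hX := measurable_pastTail (M := M) hθ k
  have hB := measurable_Ptilde (M := M) hθ ⟨k, hk.trans (Nat.lt_succ_self n)⟩
  have : Fact (θ ∈ M.Θ) := ⟨hθ⟩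
  have : IsProbabilityMeasure ((completeLaw θ ω).map (pastTail M θ k)) :=
    Measure.isProbabilityMeasure_map hX.aemeasurable
  have hXB : Measurable fun z : Obs n d × ℝ => (pastTail M θ k z,
      M.Ptilde θ z.1 ⟨k, hk.trans (Nat.lt_succ_self n)⟩) := by fun_prop
  have hm := map_pastTail_Ptilde hθ ω hk
  have hfi' : Integrable f (((completeLaw θ ω).map (pastTail M θ k)).prod
      (betaLaw (n - (k + 1)))) := by
    rw [← hm]
    exact (integrable_map_measure hf.aestronglyMeasurable hXB.aemeasurable).2 hfi
  have h1 := hfi'.integral_prod_left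
  have hme : AEStronglyMeasurable (fun x => ∫ b, f (x, b) ∂(betaLaw (n - (k + 1))))
      ((completeLaw θ ω).map (pastTail M θ k)) :=
    hf.stronglyMeasurable.integral_prod_right'.aestronglyMeasurable
  refine ⟨(integrable_map_measure hme hX.aemeasurable).1 h1, ?_⟩
  rw [← integral_map hXB.aemeasurable hf.aestronglyMeasurable, hm, integral_prod _ hfi',
    integral_map hX.aemeasurable hme]

/-- Integrates the last transformed duration with respect to its beta law. -/
noncomputable def betaAvg (j : ℕ) (ψ : InfoSpace n d (j + 1) (j + 1) → ℝ)
    (v : InfoSpace n d j (j + 1)) : ℝ :=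
  ∫ b, ψ (consInfo j (v, b)) ∂(betaLaw (n - (j + 1)))

lemma measurable_betaAvg {j : ℕ} {ψ : InfoSpace n d (j + 1) (j + 1) → ℝ} (hψ : Measurable ψ) :
    Measurable (betaAvg j ψ) :=
  ((hψ.comp (measurable_consInfo j)).stronglyMeasurable.integral_prod_right').measurable

lemma betaAvg_mem_Icc {j : ℕ} {ψ : InfoSpace n d (j + 1) (j + 1) → ℝ} (hψ : Measurable ψ)
    (hψ1 : ∀ v, ψ v ∈ Icc (0 : ℝ) 1) (v : InfoSpace n d j (j + 1)) :
    betaAvg j ψ v ∈ Icc (0 : ℝ) 1 := by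
  have hm : Measurable fun b => ψ (consInfo j (v, b)) :=
    (hψ.comp (measurable_consInfo j)).comp measurable_prodMk_left
  refine ⟨integral_nonneg fun b => (hψ1 _).1, ?_⟩
  have h : Integrable (fun b => ψ (consInfo j (v, b))) (betaLaw (n - (j + 1))) :=
    Integrable.of_bound hm.aestronglyMeasurable 1 (ae_of_all _ fun b => by
      rw [Real.norm_eq_abs, abs_of_nonneg (hψ1 _).1]; exact (hψ1 _).2)
  calc betaAvg j ψ v ≤ ∫ _, (1 : ℝ) ∂(betaLaw (n - (j + 1))) :=
        integral_mono h (integrable_const _) fun b => (hψ1 _).2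
    _ = 1 := by simp

/-- I(j+1, j+1) adds P̃_{j+1} to I(j, j+1), and the latter is a function of the past and of the
remaining sum, of which P̃_{j+1} is independent. The weight K may involve the latent A because the
independence holds jointly with A. -/
lemma integral_infoVar_succ_mul (hθ : θ ∈ M.Θ) (ω : Nuisance M) {j : ℕ} (hj : j < n)
    {ψ : InfoSpace n d (j + 1) (j + 1) → ℝ} (hψ : Measurable ψ)
    (hψi : Integrable (fun o => ψ (infoVar M θ (j + 1) (j + 1) o)) (obsLaw θ ω))
    {K : (Obs n d × ℝ) × ℝ → ℝ} (hK : Measurable K) (hK1 : ∀ x, |K x| ≤ 1) :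
    Integrable (fun z => betaAvg j ψ (infoVar M θ j (j + 1) z.1) * K (pastTail M θ j z))
      (completeLaw θ ω) ∧
    ∫ z, ψ (infoVar M θ (j + 1) (j + 1) z.1) * K (pastTail M θ j z) ∂(completeLaw θ ω)
      = ∫ z, betaAvg j ψ (infoVar M θ j (j + 1) z.1) * K (pastTail M θ j z) ∂(completeLaw θ ω) := by
  obtain ⟨w, hw, hwt⟩ := exists_infoVar_eq hθ j
  have hψc := hψ.comp (measurable_consInfo (n := n) (d := d) j)
  let f : ((Obs n d × ℝ) × ℝ) × ℝ → ℝ := fun v =>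
    ψ (consInfo j (w (v.1.1.1, v.1.2), v.2)) * K v.1
  have hf : Measurable f :=
    (hψc.comp (f := fun v : ((Obs n d × ℝ) × ℝ) × ℝ => (w (v.1.1.1, v.1.2), v.2))
      (by fun_prop)).mul (hK.comp measurable_fst)
  have hL : ∀ z : Obs n d × ℝ, f (pastTail M θ j z,
      M.Ptilde θ z.1 ⟨j, hj.trans (Nat.lt_succ_self n)⟩)
      = ψ (infoVar M θ (j + 1) (j + 1) z.1) * K (pastTail M θ j z) := by
    intro z
    simp only [f, pastTail]
    rw [← hwt, infoVar_succ (hj.trans (Nat.lt_succ_self n))]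
  have hR : ∀ z : Obs n d × ℝ, ∫ b, f (pastTail M θ j z, b) ∂(betaLaw (n - (j + 1)))
      = betaAvg j ψ (infoVar M θ j (j + 1) z.1) * K (pastTail M θ j z) := by
    intro z
    simp only [f, pastTail, betaAvg]
    rw [← hwt, integral_mul_const]
  have hi : Integrable (fun z => ψ (infoVar M θ (j + 1) (j + 1) z.1) * K (pastTail M θ j z))
      (completeLaw θ ω) := by
    have h1 := (integrable_obsLaw_fst ω
      (hψ.comp (measurable_infoVar hθ _ _)).aestronglyMeasurable).1 hψi
    refine h1.mul_bdd (c := 1) (hK.comp (measurable_pastTail hθ j)).aestronglyMeasurable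
      (ae_of_all _ fun z => hK1 _)
  have := integral_pastTail_Ptilde hθ ω hj hf (by simpa only [hL] using hi)
  simpa only [hL, hR] using this

lemma integrable_betaAvg (hθ : θ ∈ M.Θ) (ω : Nuisance M) {j : ℕ} (hj : j < n)
    {ψ : InfoSpace n d (j + 1) (j + 1) → ℝ} (hψ : Measurable ψ)
    (hψi : Integrable (fun o => ψ (infoVar M θ (j + 1) (j + 1) o)) (obsLaw θ ω)) :
    Integrable (fun o => betaAvg j ψ (infoVar M θ j (j + 1) o)) (obsLaw θ ω) := by
  have h := (integral_infoVar_succ_mul hθ ω hj hψ hψi (K := fun _ => 1) measurable_const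
    (fun _ => by simp)).1
  simp only [mul_one] at h
  exact (integrable_obsLaw_fst ω
    ((measurable_betaAvg hψ).comp (measurable_infoVar hθ _ _)).aestronglyMeasurable).2 h

lemma integral_betaAvg (hθ : θ ∈ M.Θ) (ω : Nuisance M) {j : ℕ} (hj : j < n)
    {ψ : InfoSpace n d (j + 1) (j + 1) → ℝ} (hψ : Measurable ψ)
    (hψi : Integrable (fun o => ψ (infoVar M θ (j + 1) (j + 1) o)) (obsLaw θ ω)) :
    ∫ o, betaAvg j ψ (infoVar M θ j (j + 1) o) ∂(obsLaw θ ω)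
      = ∫ o, ψ (infoVar M θ (j + 1) (j + 1) o) ∂(obsLaw θ ω) := by
  have h := (integral_infoVar_succ_mul hθ ω hj hψ hψi (K := fun _ => 1) measurable_const
    (fun _ => by simp)).2
  simp only [mul_one] at h
  rw [integral_obsLaw_fst ω (f := fun o => betaAvg j ψ (infoVar M θ j (j + 1) o))
    ((measurable_betaAvg hψ).comp (measurable_infoVar hθ _ _)).aestronglyMeasurable,
    integral_obsLaw_fst ω (f := fun o => ψ (infoVar M θ (j + 1) (j + 1) o))
    (hψ.comp (measurable_infoVar hθ _ _)).aestronglyMeasurable, h]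

/-- The crucial feature is that the right-hand side involves the nuisance parameter only through ψ:
integrating P̃_{j+1} out uses a fixed beta law. -/
lemma condExp_info (hθ : θ ∈ M.Θ) (ω : Nuisance M) {j : ℕ} (hj : j < n)
    {ψ : InfoSpace n d (j + 1) (j + 1) → ℝ} (hψ : Measurable ψ)
    (hψi : Integrable (fun o => ψ (infoVar M θ (j + 1) (j + 1) o)) (obsLaw θ ω)) :
    (obsLaw θ ω)[fun o => ψ (infoVar M θ (j + 1) (j + 1) o) | M.info θ j (j + 1)]
      =ᵐ[obsLaw θ ω] fun o => betaAvg j ψ (infoVar M θ j (j + 1) o) := by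
  have : Fact (θ ∈ M.Θ) := ⟨hθ⟩
  have hint := integrable_betaAvg hθ ω hj hψ hψi
  refine (ae_eq_condExp_of_forall_setIntegral_eq (info_le hθ j (j + 1)) hψi
    (fun s _ _ => hint.integrableOn) ?_ ?_).symm
  · rintro _ ⟨B, hB, rfl⟩ -
    obtain ⟨w, hw, hwt⟩ := exists_infoVar_eq hθ j
    have hA : MeasurableSet (infoVar M θ j (j + 1) ⁻¹' B) := measurable_infoVar hθ _ _ hB
    let K : (Obs n d × ℝ) × ℝ → ℝ := fun v => B.indicator (fun _ => 1) (w (v.1.1, v.2))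
    have hK : Measurable K := (measurable_const.indicator hB).comp (by fun_prop)
    have hKz : ∀ z : Obs n d × ℝ, K (pastTail M θ j z)
        = (infoVar M θ j (j + 1) ⁻¹' B).indicator (fun _ => 1) z.1 := by
      intro z
      simp only [K, pastTail, ← hwt]
      rfl
    have h := (integral_infoVar_succ_mul hθ ω hj hψ hψi hK (fun x => by
      simp only [K, indicator]; split_ifs <;> simp)).2
    simp only [hKz] at h
    have hind : ∀ f : Obs n d → ℝ, Measurable f →
        ∫ o in infoVar M θ j (j + 1) ⁻¹' B, f o ∂(obsLaw θ ω)
        = ∫ z, f z.1 * (infoVar M θ j (j + 1) ⁻¹' B).indicator (fun _ => 1) z.1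
          ∂(completeLaw θ ω) := by
      intro f hf
      rw [← integral_indicator hA, integral_obsLaw_fst ω (hf.indicator hA).aestronglyMeasurable]
      refine integral_congr_ae (ae_of_all _ fun z => ?_)
      simp only [indicator]
      split_ifs <;> simp
    change ∫ o in infoVar M θ j (j + 1) ⁻¹' B, _ ∂_ = ∫ o in infoVar M θ j (j + 1) ⁻¹' B, _ ∂_
    have h1 := hind (fun o => betaAvg j ψ (infoVar M θ j (j + 1) o))
      ((measurable_betaAvg hψ).comp (measurable_infoVar hθ _ _))
    have h2 := hind (fun o => ψ (infoVar M θ (j + 1) (j + 1) o))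
      (hψ.comp (measurable_infoVar hθ _ _))
    rw [h1, h2]
    exact h.symm
  · exact ((measurable_betaAvg hψ).comp
      (measurable_infoVar_info M θ _ _)).stronglyMeasurable.aestronglyMeasurable

/-! ### Scores of regular submodels -/

lemma integral_mul_submodel_score (hθ : θ ∈ M.Θ) {path : ℝ → Nuisance M} {S : Obs n d → ℝ}
    (hS : IsRegularSubmodel θ path S) {m : Obs n d → ℝ} (hm : Measurable m) (hm1 : ∀ o, |m o| ≤ 1)
    (hmc : ∀ ω ω' : Nuisance M, ∫ o, m o ∂(obsLaw θ ω) = ∫ o, m o ∂(obsLaw θ ω')) :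
    ∫ o, m o * S o ∂(obsLaw θ (path 0)) = 0 := by
  have : Fact (θ ∈ M.Θ) := ⟨hθ⟩
  have hl : ∀ ω : Nuisance M, Integrable (likelihood θ ω) M.base ∧
      ∫ o, likelihood θ ω o ∂M.base = 1 := by
    intro ω
    have h1 := (integrable_obsLaw_iff hθ ω fun _ => 1).1 (integrable_const _)
    have h2 := integral_obsLaw hθ ω fun _ => 1
    simp only [one_mul, integral_const, probReal_univ, smul_eq_mul, mul_one] at h1 h2
    exact ⟨h1, h2.symm⟩
  have hSm : ∃ S' : Obs n d → ℝ, Measurable S' ∧ S =ᵐ[obsLaw θ (path 0)] S' :=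
    ⟨_, hS.memLp.1.stronglyMeasurable_mk.measurable, hS.memLp.1.ae_eq_mk⟩
  obtain ⟨S', hS'm, hSS'⟩ := hSm
  -- A score is measurable only up to null sets of the observed law, not of the dominating measure.
  -- Where the likelihood vanishes the factor √ℓ hides any change of version.
  have hae : ∀ᵐ o ∂M.base, S o * √(likelihood θ (path 0) o) = S' o * √(likelihood θ (path 0) o) := by
    rw [obsLaw_eq hθ, EventuallyEq, ae_withDensity_iff
      (measurable_likelihood hθ _).ennreal_ofReal] at hSS'
    filter_upwards [hSS'] with o ho
    by_cases h : ENNReal.ofReal (likelihood θ (path 0) o) = 0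
    · rw [Real.sqrt_eq_zero_of_nonpos (ENNReal.ofReal_eq_zero.1 h), mul_zero, mul_zero]
    · rw [ho h]
  have hS'2 : MemLp S' 2 (obsLaw θ (path 0)) := hS.memLp.ae_eq hSS'
  have key := integral_mul_score_eq_zero (μ := M.base) (l := fun η => likelihood θ (path η))
    (l₀ := likelihood θ (path 0)) (S := S') (m := m) (C := 1) zero_le_one
    (likelihood_nonneg hθ _) (hl _).1 (hl _).2
    (Eventually.of_forall fun η => ⟨likelihood_nonneg hθ _, (hl _).1, by
      rw [← integral_obsLaw hθ, ← integral_obsLaw hθ]; exact hmc _ _⟩)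
    hS'm.aestronglyMeasurable ((integrable_obsLaw_iff hθ _ _).1 hS'2.integrable_sq)
    hm.aestronglyMeasurable hm1 (by
      refine hS.dqm.congr fun η => lintegral_congr_ae ?_
      filter_upwards [hae] with o ho
      rw [mul_assoc, ho, mul_assoc])
  rw [integral_congr_ae (g := fun o => m o * S' o) (hSS'.mono fun o ho => by
    simp only; rw [ho]), integral_obsLaw hθ]
  exact key

lemma integral_submodel_score (hθ : θ ∈ M.Θ) {path : ℝ → Nuisance M} {S : Obs n d → ℝ}
    (hS : IsRegularSubmodel θ path S) : ∫ o, S o ∂(obsLaw θ (path 0)) = 0 := by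
  have : Fact (θ ∈ M.Θ) := ⟨hθ⟩
  simpa using integral_mul_submodel_score hθ hS (m := fun _ => 1) measurable_const (by simp)
    (by simp)

/-- `P̃_{j+1}` carries no information on the nuisance parameter. -/
lemma condExp_submodel_score (hθ : θ ∈ M.Θ) {path : ℝ → Nuisance M} {S : Obs n d → ℝ}
    (hS : IsRegularSubmodel θ path S) {j : ℕ} (hj : j < n) :
    (obsLaw θ (path 0))[S | M.info θ (j + 1) (j + 1)]
      =ᵐ[obsLaw θ (path 0)] (obsLaw θ (path 0))[S | M.info θ j (j + 1)] := by
  have : Fact (θ ∈ M.Θ) := ⟨hθ⟩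
  have hSi : Integrable S (obsLaw θ (path 0)) := hS.memLp.integrable one_le_two
  have hle := info_le (M := M) hθ (j + 1) (j + 1)
  refine (ae_eq_condExp_of_forall_setIntegral_eq hle hSi
    (fun s _ _ => integrable_condExp.integrableOn) ?_
    ((stronglyMeasurable_condExp.mono
      (info_mono M θ (Nat.le_succ j) le_rfl)).aestronglyMeasurable)).symm
  rintro _ ⟨B, hB, rfl⟩ -
  let ψ : InfoSpace n d (j + 1) (j + 1) → ℝ := B.indicator fun _ => 1
  have hψ : Measurable ψ := measurable_const.indicator hB
  have hψ1 : ∀ v, ψ v ∈ Icc (0 : ℝ) 1 := fun v => by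
    simp only [ψ, indicator]; split_ifs <;> simp
  have hW := measurable_infoVar (M := M) hθ j (j + 1)
  have hW' := measurable_infoVar (M := M) hθ (j + 1) (j + 1)
  have hbd : ∀ ω : Nuisance M, MemLp (fun o => ψ (infoVar M θ (j + 1) (j + 1) o)) 2 (obsLaw θ ω) :=
    fun ω => MemLp.of_bound (hψ.comp hW').aestronglyMeasurable 1 (ae_of_all _ fun o => by
      rw [Real.norm_eq_abs, abs_of_nonneg (hψ1 _).1]; exact (hψ1 _).2)
  have hbd' : ∀ ω : Nuisance M, MemLp (fun o => betaAvg j ψ (infoVar M θ j (j + 1) o)) 2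
      (obsLaw θ ω) :=
    fun ω => MemLp.of_bound ((measurable_betaAvg hψ).comp hW).aestronglyMeasurable 1
      (ae_of_all _ fun o => by
      rw [Real.norm_eq_abs, abs_of_nonneg (betaAvg_mem_Icc hψ hψ1 _).1]
      exact (betaAvg_mem_Icc hψ hψ1 _).2)
  have hi := fun ω => (hbd ω).integrable one_le_two
  -- Mean zero under every nuisance parameter, not only at the base point of the path: this is what
  -- makes the mean constant along the path.
  have hz : ∀ ω : Nuisance M, ∫ o, (ψ (infoVar M θ (j + 1) (j + 1) o)
      - betaAvg j ψ (infoVar M θ j (j + 1) o)) ∂(obsLaw θ ω) = 0 := by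
    intro ω
    rw [integral_sub (hi ω) ((hbd' ω).integrable one_le_two), integral_betaAvg hθ ω hj hψ (hi ω),
      sub_self]
  have key := integral_mul_submodel_score hθ hS
    (m := fun o => ψ (infoVar M θ (j + 1) (j + 1) o) - betaAvg j ψ (infoVar M θ j (j + 1) o))
    ((hψ.comp hW').sub ((measurable_betaAvg hψ).comp hW))
    (fun o => abs_sub_le_one_of_mem_Icc (hψ1 _) (betaAvg_mem_Icc hψ hψ1 _))
    (fun ω ω' => by rw [hz, hz])
  simp only [sub_mul] at key
  have hi1 : Integrable (fun o => ψ (infoVar M θ (j + 1) (j + 1) o) * S o) (obsLaw θ (path 0)) :=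
    (hbd _).integrable_mul hS.memLp
  have hi2 : Integrable (fun o => betaAvg j ψ (infoVar M θ j (j + 1) o) * S o)
      (obsLaw θ (path 0)) := (hbd' _).integrable_mul hS.memLp
  rw [integral_sub hi1 hi2, sub_eq_zero] at key
  have hind : ∀ f : Obs n d → ℝ, ∫ o in infoVar M θ (j + 1) (j + 1) ⁻¹' B, f o ∂(obsLaw θ (path 0))
      = ∫ o, ψ (infoVar M θ (j + 1) (j + 1) o) * f o ∂(obsLaw θ (path 0)) := by
    intro f
    rw [← integral_indicator (hW' hB)]
    refine integral_congr_ae (ae_of_all _ fun o => ?_)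
    have h0 : ∀ (A : Set (Obs n d)) (g : Obs n d → ℝ), A.indicator g o
        = A.indicator (fun _ => 1) o * g o := fun A g => by
      by_cases h : o ∈ A <;> simp [h]
    exact h0 _ f
  change ∫ o in infoVar M θ (j + 1) (j + 1) ⁻¹' B, _ ∂_
    = ∫ o in infoVar M θ (j + 1) (j + 1) ⁻¹' B, _ ∂_
  have hcomm := integral_condExp_mul_comm (info_le hθ j (j + 1)) hSi (hbd (path 0)).1
    (C := 1) fun o => by rw [abs_of_nonneg (hψ1 _).1]; exact (hψ1 _).2
  -- Self-adjointness moves the conditional expectation from S to ψ, where it is the beta average.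
  rw [hind, hind, key, integral_congr_ae (ae_of_all _ fun o => mul_comm _ _), hcomm]
  refine integral_congr_ae ?_
  filter_upwards [condExp_info hθ (path 0) hj hψ (hi _)] with o ho
  rw [ho, mul_comm]

end MPH

namespace MPH
open scoped ENNReal

variable {n q d : ℕ} {M : Model n q d} {θ : Param q d}

/-! ### Functions orthogonal to all scores -/

lemma map_pastTail (hθ : θ ∈ M.Θ) (ω : Nuisance M) {k : ℕ} (hk : k ≤ n) :
    (completeLaw θ ω).map (pastTail M θ k)
      = (((completeLaw θ ω).map fun z => (tau k k z.1, z.2)).prod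
        (volume.restrict (Ioi 0))).withDensity fun v => gden (n - k) v.1.2 v.2 := by
  have hX := measurable_pastTail (M := M) hθ k
  have hT : Measurable fun z : Obs n d × ℝ => (tau k k z.1, z.2) :=
    ((measurable_tau k k).comp measurable_fst).prodMk measurable_snd
  have : Fact (θ ∈ M.Θ) := ⟨hθ⟩
  have : IsProbabilityMeasure ((completeLaw θ ω).map fun z => (tau k k z.1, z.2)) :=
    Measure.isProbabilityMeasure_map hT.aemeasurable
  have hg : Measurable fun v : (Obs n d × ℝ) × ℝ => gden (n - k) v.1.2 v.2 := by fun_prop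
  refine Measure.ext_of_lintegral _ fun F hF => ?_
  rw [lintegral_map hF hX, lintegral_withDensity_eq_lintegral_mul _ hg hF,
    lintegral_prod _ (hg.mul hF).aemeasurable, lintegral_map (hg.mul hF).lintegral_prod_right' hT]
  simp only [pastTail, Pi.mul_apply]
  rw [lintegral_tau_tailP hθ ω hk hF]
  simp only [mul_comm]

lemma integral_pastTail (hθ : θ ∈ M.Θ) (ω : Nuisance M) {k : ℕ} (hk : k ≤ n)
    {f : (Obs n d × ℝ) × ℝ → ℝ} (hf : Measurable f)
    (hfi : Integrable (fun z => f (pastTail M θ k z)) (completeLaw θ ω)) :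
    (∀ᵐ z ∂(completeLaw θ ω), Integrable
      (fun p => f ((tau k k z.1, z.2), p) * (gden (n - k) z.2 p).toReal)
      (volume.restrict (Ioi 0))) ∧
    Integrable (fun z => ∫ p in Ioi 0, f ((tau k k z.1, z.2), p) * (gden (n - k) z.2 p).toReal)
      (completeLaw θ ω) ∧
    ∫ z, f (pastTail M θ k z) ∂(completeLaw θ ω)
      = ∫ z, (∫ p in Ioi 0, f ((tau k k z.1, z.2), p) * (gden (n - k) z.2 p).toReal)
        ∂(completeLaw θ ω) := by
  have hX := measurable_pastTail (M := M) hθ k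
  have hT : Measurable fun z : Obs n d × ℝ => (tau k k z.1, z.2) :=
    ((measurable_tau k k).comp measurable_fst).prodMk measurable_snd
  have : Fact (θ ∈ M.Θ) := ⟨hθ⟩
  have : IsProbabilityMeasure ((completeLaw θ ω).map fun z => (tau k k z.1, z.2)) :=
    Measure.isProbabilityMeasure_map hT.aemeasurable
  have hg : Measurable fun v : (Obs n d × ℝ) × ℝ => gden (n - k) v.1.2 v.2 := by fun_prop
  have hlt : ∀ v : (Obs n d × ℝ) × ℝ, gden (n - k) v.1.2 v.2 < ∞ :=
    fun v => (gden_ne_top _ _ _).lt_top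
  have hfg : Measurable fun v : (Obs n d × ℝ) × ℝ => f v * (gden (n - k) v.1.2 v.2).toReal :=
    hf.mul hg.ennreal_toReal
  have h1 := (integrable_map_measure hf.aestronglyMeasurable hX.aemeasurable).2 hfi
  rw [map_pastTail hθ ω hk, integrable_withDensity_iff hg (ae_of_all _ hlt)] at h1
  have hme : StronglyMeasurable fun x : Obs n d × ℝ =>
      ∫ p in Ioi 0, f (x, p) * (gden (n - k) x.2 p).toReal :=
    hfg.stronglyMeasurable.integral_prod_right'
  refine ⟨ae_of_ae_map hT.aemeasurable h1.prod_right_ae,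
    (integrable_map_measure hme.aestronglyMeasurable hT.aemeasurable).1 h1.integral_prod_left, ?_⟩
  rw [← integral_map hX.aemeasurable hf.aestronglyMeasurable, map_pastTail hθ ω hk,
    integral_withDensity_eq_integral_toReal_smul hg (ae_of_all _ hlt)]
  simp only [smul_eq_mul, mul_comm _ (f _)]
  rw [integral_prod _ h1, integral_map hT.aemeasurable hme.aestronglyMeasurable]

/-- `E[s | A, Y₀, …, Y_j, X_1, …, X_{j+1}]` and `E[s | Y₀, P̃^j, P̄, X^{j+1}]` agree on average
against functions of the past and of the heterogeneity. -/
def MatchesPast (θ : Param q d) (ω : Nuisance M) (s : Obs n d → ℝ) (j : ℕ) : Prop :=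
  ∀ k : Obs n d × ℝ → ℝ, Measurable k → (∀ z, k z ∈ Icc (0 : ℝ) 1) →
    ∫ z, s z.1 * k (tau j j z.1, z.2) ∂(completeLaw θ ω)
      = ∫ z, ((obsLaw θ ω)[s | M.info θ j (j + 1)]) z.1 * k (tau j j z.1, z.2) ∂(completeLaw θ ω)

lemma condExp_info_last (hθ : θ ∈ M.Θ) (ω : Nuisance M) {s : Obs n d → ℝ}
    (hs : Integrable s (obsLaw θ ω)) :
    (obsLaw θ ω)[s | M.info θ n (n + 1)] =ᵐ[obsLaw θ ω] s := by
  have : Fact (θ ∈ M.Θ) := ⟨hθ⟩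
  refine condExp_of_aestronglyMeasurable' (info_le hθ n (n + 1)) ?_ hs
  exact (((aeDetermined_id hθ ω).comp hs.1.measurable_mk).congr
    hs.1.ae_eq_mk).aestronglyMeasurable

lemma matchesPast_last (hθ : θ ∈ M.Θ) (ω : Nuisance M) {s : Obs n d → ℝ}
    (hs : Integrable s (obsLaw θ ω)) : MatchesPast θ ω s n := by
  intro k _ _
  refine integral_congr_ae ?_
  filter_upwards [completeLaw_ae_of_obsLaw (condExp_info_last hθ ω hs)] with z hz
  rw [hz]

/-- A version of an almost surely determined function. -/
lemma AEDetermined.exists_infoVar {ω : Nuisance M} {k m : ℕ} {f : Obs n d → ℝ}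
    (hf : AEDetermined (M.info θ k m) (obsLaw θ ω) f) :
    ∃ ψ : InfoSpace n d k m → ℝ, Measurable ψ ∧ f =ᵐ[obsLaw θ ω] fun o => ψ (infoVar M θ k m o) := by
  obtain ⟨g, hg, hfg⟩ := hf
  obtain ⟨ψ, hψ, rfl⟩ := hg.exists_eq_measurable_comp
  exact ⟨ψ, hψ, hfg⟩

/-- If E[s | I(j+1, j+2)] does not use X_{j+2}, it is a function of I(j+1, j+1). Conditioning it
further on I(j, j+1), or on the past and A, integrates P̃_{j+1} against the same beta law, so the
agreement passes from j + 1 to j. -/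
lemma matchesPast_of_succ (hθ : θ ∈ M.Θ) (ω : Nuisance M) {s : Obs n d → ℝ} {j : ℕ} (hj : j < n)
    (hC : MatchesPast θ ω s (j + 1))
    (hu : AEDetermined (M.info θ (j + 1) (j + 1)) (obsLaw θ ω)
      ((obsLaw θ ω)[s | M.info θ (j + 1) (j + 2)])) : MatchesPast θ ω s j := by
  have : Fact (θ ∈ M.Θ) := ⟨hθ⟩
  obtain ⟨ψ, hψ, hψu⟩ := hu.exists_infoVar
  have hψi : Integrable (fun o => ψ (infoVar M θ (j + 1) (j + 1) o)) (obsLaw θ ω) :=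
    (integrable_congr hψu).1 integrable_condExp
  have huj : (obsLaw θ ω)[s | M.info θ j (j + 1)] =ᵐ[obsLaw θ ω]
      fun o => betaAvg j ψ (infoVar M θ j (j + 1) o) :=
    (condExp_condExp_of_le (info_mono M θ (Nat.le_succ j) (Nat.le_succ (j + 1)))
      (info_le hθ (j + 1) (j + 2))).symm.trans
      ((condExp_congr_ae hψu).trans (condExp_info hθ ω hj hψ hψi))
  intro k hk hk1
  have h1 := hC (fun z => k (tau j j z.1, z.2))
    (hk.comp (((measurable_tau j j).comp measurable_fst).prodMk measurable_snd)) fun z => hk1 _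
  simp only [tau_tau (Nat.le_succ j) (Nat.le_succ j)] at h1
  have h2 := (integral_infoVar_succ_mul hθ ω hj hψ hψi (K := fun v => k v.1)
    (hk.comp measurable_fst) fun v => by
      rw [abs_of_nonneg (hk1 _).1]; exact (hk1 _).2).2
  simp only [pastTail] at h2
  rw [h1]
  calc _ = ∫ z, ψ (infoVar M θ (j + 1) (j + 1) z.1) * k (tau j j z.1, z.2) ∂(completeLaw θ ω) := by
        refine integral_congr_ae ?_
        filter_upwards [completeLaw_ae_of_obsLaw hψu] with z hz
        rw [hz]
    _ = _ := by
        rw [h2]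
        refine integral_congr_ae ?_
        filter_upwards [completeLaw_ae_of_obsLaw huj] with z hz
        rw [hz]

lemma ae_eq_zero_of_integral_mul_eq_zero {Ω X : Type*} [MeasurableSpace Ω] [MeasurableSpace X]
    {μ : Measure Ω} {T : Ω → X} (hT : Measurable T) {D : X → ℝ} (hD : Measurable D)
    (hDi : Integrable (fun z => D (T z)) μ)
    (h : ∀ k : X → ℝ, Measurable k → (∀ x, k x ∈ Icc (0 : ℝ) 1) → ∫ z, D (T z) * k (T z) ∂μ = 0) :
    ∀ᵐ z ∂μ, D (T z) = 0 := by
  refine ae_of_ae_map hT.aemeasurable (p := fun x => D x = 0) ?_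
  refine Integrable.ae_eq_zero_of_forall_setIntegral_eq_zero
    ((integrable_map_measure hD.aestronglyMeasurable hT.aemeasurable).2 hDi) fun s hs _ => ?_
  rw [← integral_indicator hs, integral_map hT.aemeasurable (hD.indicator hs).aestronglyMeasurable,
    ← h (s.indicator fun _ => 1) (measurable_const.indicator hs) fun x => by
      by_cases hx : x ∈ s <;> simp [hx]]
  refine integral_congr_ae (ae_of_all _ fun z => ?_)
  by_cases hx : T z ∈ s <;> simp [hx]

/-- Given the past and A, the remaining sum has a density on (0, ∞), so Lebesgue-null exceptional
sets of its values do not matter. -/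
lemma ae_tailP (hθ : θ ∈ M.Θ) (ω : Nuisance M) {k : ℕ} (hk : k ≤ n) {E : Set (Obs n d × ℝ)}
    (hE : MeasurableSet E)
    (h : ∀ᵐ o ∂(obsLaw θ ω), ∀ᵐ p ∂(volume.restrict (Ioi (0 : ℝ))), (tau k k o, p) ∈ E) :
    ∀ᵐ o ∂(obsLaw θ ω), (tau k k o, tailP M θ k o) ∈ E := by
  have hm : Measurable fun o : Obs n d => (tau k k o, tailP M θ k o) :=
    (measurable_tau k k).prodMk (measurable_tailP hθ k)
  rw [obsLaw_eq_map, ae_map_iff measurable_fst.aemeasurable (hm hE)]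
  have hF : Measurable fun v : (Obs n d × ℝ) × ℝ => Eᶜ.indicator (fun _ => (1 : ℝ≥0∞)) (v.1.1, v.2) :=
    (measurable_const.indicator hE.compl).comp (by fun_prop)
  have h1 := lintegral_tau_tailP hθ ω hk hF
  have h2 : ∫⁻ z, (∫⁻ p in Ioi 0, Eᶜ.indicator (fun _ => (1 : ℝ≥0∞)) (tau k k z.1, p)
      * gden (n - k) z.2 p) ∂(completeLaw θ ω) = 0 := by
    refine (lintegral_congr_ae ?_).trans lintegral_zero
    filter_upwards [completeLaw_ae_of_obsLaw h] with z hz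
    refine (lintegral_congr_ae ?_).trans lintegral_zero
    filter_upwards [hz] with p hp
    simp [hp]
  rw [h2, lintegral_eq_zero_iff] at h1
  · filter_upwards [h1] with z hz
    by_contra hcon
    simp [hcon] at hz
  · exact (measurable_const.indicator hE.compl).comp (hm.comp measurable_fst)

end MPH

namespace MPH
open scoped ENNReal

variable {n q d : ℕ} {M : Model n q d} {θ : Param q d}

/-! ### Averages over the gamma law of the remaining sum. -/

lemma exists_condExp_eq (hθ : θ ∈ M.Θ) (ω : Nuisance M) (s : Obs n d → ℝ) (j : ℕ) :
    ∃ u : Obs n d × ℝ → ℝ, Measurable u ∧ ∀ o,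
      ((obsLaw θ ω)[s | M.info θ j (j + 1)]) o = u (tau j j o, tailP M θ j o) := by
  obtain ⟨w, hw, hwt⟩ := exists_infoVar_eq hθ j
  obtain ⟨ψ, hψ, hψe⟩ := (stronglyMeasurable_condExp (μ := obsLaw θ ω) (f := s)
    (m := M.info θ j (j + 1))).measurable.exists_eq_measurable_comp
  refine ⟨fun v => ψ (w v), hψ.comp hw, fun o => ?_⟩
  beta_reduce
  rw [hψe, ← hwt]
  rfl

/-- Integrates a function of the sum of `m + 1` of the `P_t`, given the heterogeneity. -/
noncomputable def gammaAvg (m : ℕ) (u : Obs n d × ℝ → ℝ) (x : Obs n d × ℝ) : ℝ :=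
  ∫ p in Ioi 0, u (x.1, p) * (gden m x.2 p).toReal

lemma measurable_mul_gden (m : ℕ) {u : Obs n d × ℝ → ℝ} (hu : Measurable u) :
    Measurable fun v : (Obs n d × ℝ) × ℝ => u (v.1.1, v.2) * (gden m v.1.2 v.2).toReal := by
  have hg : Measurable fun v : (Obs n d × ℝ) × ℝ => gden m v.1.2 v.2 := by fun_prop
  exact (hu.comp (f := fun v : (Obs n d × ℝ) × ℝ => (v.1.1, v.2)) (by fun_prop)).mul
    hg.ennreal_toReal

lemma measurable_gammaAvg (m : ℕ) {u : Obs n d × ℝ → ℝ} (hu : Measurable u) :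
    Measurable (gammaAvg m u) :=
  ((measurable_mul_gden m hu).stronglyMeasurable.integral_prod_right').measurable

lemma measurable_tau_fst (k m : ℕ) : Measurable fun z : Obs n d × ℝ => (tau k m z.1, z.2) :=
  ((measurable_tau k m).comp measurable_fst).prodMk measurable_snd

/-- For a function of the past and of the remaining sum, `gammaAvg` is a version of its conditional
expectation given the past and A. -/
lemma integral_mul_gammaAvg (hθ : θ ∈ M.Θ) (ω : Nuisance M) {j : ℕ} (hj : j ≤ n)
    {u : Obs n d × ℝ → ℝ} (hu : Measurable u)
    (hui : Integrable (fun o => u (tau j j o, tailP M θ j o)) (obsLaw θ ω))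
    {k : Obs n d × ℝ → ℝ} (hk : Measurable k) (hk1 : ∀ x, k x ∈ Icc (0 : ℝ) 1) :
    ∫ z, u (tau j j z.1, tailP M θ j z.1) * k (tau j j z.1, z.2) ∂(completeLaw θ ω)
      = ∫ z, gammaAvg (n - j) u (tau j j z.1, z.2) * k (tau j j z.1, z.2) ∂(completeLaw θ ω) := by
  have hum : Measurable fun v : (Obs n d × ℝ) × ℝ => u (v.1.1, v.2) := hu.comp (by fun_prop)
  have hi : Integrable (fun z : Obs n d × ℝ => u (tau j j z.1, tailP M θ j z.1)
      * k (tau j j z.1, z.2)) (completeLaw θ ω) := by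
    refine ((integrable_obsLaw_fst ω hui.1).1 hui).mul_bdd (c := 1)
      (hk.comp (measurable_tau_fst j j)).aestronglyMeasurable (ae_of_all _ fun z => ?_)
    rw [Real.norm_eq_abs, abs_of_nonneg (hk1 _).1]
    exact (hk1 _).2
  have h := (integral_pastTail hθ ω hj (f := fun v => u (v.1.1, v.2) * k v.1)
    (hum.mul (hk.comp measurable_fst)) hi).2.2
  simp only [pastTail] at h
  rw [h]
  refine integral_congr_ae (ae_of_all _ fun z => ?_)
  simp only [gammaAvg]
  rw [← integral_mul_const]
  refine integral_congr_ae (ae_of_all _ fun p => ?_)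
  ring

lemma integrable_gammaAvg (hθ : θ ∈ M.Θ) (ω : Nuisance M) {j : ℕ} (hj : j ≤ n)
    {u : Obs n d × ℝ → ℝ} (hu : Measurable u)
    (hui : Integrable (fun o => u (tau j j o, tailP M θ j o)) (obsLaw θ ω)) :
    (∀ᵐ z ∂(completeLaw θ ω), Integrable
      (fun p => u (tau j j z.1, p) * (gden (n - j) z.2 p).toReal) (volume.restrict (Ioi 0))) ∧
    Integrable (fun z => gammaAvg (n - j) u (tau j j z.1, z.2)) (completeLaw θ ω) := by
  have hum : Measurable fun v : (Obs n d × ℝ) × ℝ => u (v.1.1, v.2) := hu.comp (by fun_prop)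
  have h := integral_pastTail hθ ω hj (f := fun v => u (v.1.1, v.2)) hum
    ((integrable_obsLaw_fst ω hui.1).1 hui)
  exact ⟨h.1, h.2.1⟩

/-- The heterogeneity is identified by the sum of the remaining `P_t`. -/
lemma ae_eq_of_gammaAvg_eq {m : ℕ} {A : Set ℝ} (hA : volume A ≠ 0) {f g : ℝ → ℝ}
    (hf : Measurable f) (hg : Measurable g)
    (h : ∀ᵐ a, a ∈ A →
      Integrable (fun p => f p * (gden m a p).toReal) (volume.restrict (Ioi 0)) ∧
      Integrable (fun p => g p * (gden m a p).toReal) (volume.restrict (Ioi 0)) ∧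
      ∫ p in Ioi 0, f p * (gden m a p).toReal = ∫ p in Ioi 0, g p * (gden m a p).toReal) :
    ∀ᵐ p ∂(volume.restrict (Ioi 0)), f p = g p := by
  have := ae_eq_zero_of_integral_gden_eq_zero (m := m) (hf.sub hg) hA (by
    filter_upwards [h] with a ha haA
    obtain ⟨h1, h2, h3⟩ := ha haA
    simp only [Pi.sub_apply, sub_mul]
    exact ⟨h1.sub h2, by rw [integral_sub h1 h2, h3, sub_self]⟩)
  filter_upwards [this] with p hp
  exact sub_eq_zero.1 hp

/-! ### Averaging over the last covariate -/

/-- The observed data with the given past. -/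
def ofPast (i : Fin n) (p : Past d i.val) : Obs n d :=
  ((p.1 0, p.2 0), (fun t => if h : t.val < i.val + 1 then p.1 ⟨t.val + 1, by omega⟩ else 0),
    fun l => if h : l.val < i.val then p.2 ⟨l.val + 1, by omega⟩ else 0)

lemma measurable_ofPast (i : Fin n) : Measurable (ofPast (d := d) i) := by
  unfold ofPast
  refine Measurable.prodMk (by fun_prop) (Measurable.prodMk ?_ ?_)
  · refine measurable_pi_lambda _ fun t => ?_
    by_cases h : t.val < i.val + 1
    · simp only [dif_pos h]; fun_prop
    · simp only [dif_neg h]; fun_prop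
  · refine measurable_pi_lambda _ fun t => ?_
    by_cases h : t.val < i.val
    · simp only [dif_pos h]; fun_prop
    · simp only [dif_neg h]; fun_prop

lemma ofPast_past (i : Fin n) (o : Obs n d) : ofPast i (o.past i) = tau (i.val + 1) i.val o := by
  unfold ofPast tau
  refine Prod.ext rfl (Prod.ext (funext fun t => ?_) (funext fun l => ?_))
  · by_cases h : t.val < i.val + 1
    · simp only [dif_pos h, if_pos h]
      exact Obs.y_succ o t
    · simp only [dif_neg h, if_neg h]
  · by_cases h : l.val < i.val
    · simp only [dif_pos h, if_pos h]
      exact Obs.x_succ o l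
    · simp only [dif_neg h, if_neg h]

lemma tau_updX_tau (i : Fin n) {m : ℕ} (hm : i.val ≤ m) (o : Obs n d) (x : Cov d) :
    tau (i.val + 1) (i.val + 1) (updX (tau (i.val + 1) m o) i x)
      = tau (i.val + 1) (i.val + 1) (updX o i x) := by
  unfold tau updX
  refine Prod.ext rfl (Prod.ext (funext fun t => ?_) (funext fun l => ?_))
  · by_cases h : t.val < i.val + 1 <;> simp [h]
  · by_cases h : l.val < i.val + 1
    · by_cases hl : l = i
      · simp [hl]
      · have : l.val < m := lt_of_lt_of_le (by have := fun h => hl (Fin.ext h); omega) hm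
        simp [h, hl, this]
    · simp [h]

lemma measurable_g_right (ω : Nuisance M) (i : Fin n) (p : Past d i.val × ℝ) :
    Measurable (ω.g i p) := (ω.g_meas i).comp measurable_prodMk_left

/-- Integrates the covariate of period `i + 2`, given its past and the heterogeneity. -/
noncomputable def covAvg (ω : Nuisance M) (i : Fin n) (K : Obs n d × ℝ → ℝ) (z : Obs n d × ℝ) : ℝ :=
  ∫ x, K (tau (i.val + 1) (i.val + 1) (updX z.1 i x), z.2) * ω.g i (z.1.past i, z.2) x ∂(M.mX i)

lemma measurable_comp_updX (i : Fin n) {K : Obs n d × ℝ → ℝ} (hK : Measurable K) :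
    Measurable fun v : (Obs n d × ℝ) × Cov d =>
      K (tau (i.val + 1) (i.val + 1) (updX v.1.1 i v.2), v.1.2) := by
  have h := measurable_updX (n := n) (d := d) i
  have h1 : Measurable fun v : (Obs n d × ℝ) × Cov d => updX v.1.1 i v.2 :=
    h.comp (f := fun v : (Obs n d × ℝ) × Cov d => (v.1.1, v.2)) (by fun_prop)
  exact hK.comp (((measurable_tau _ _).comp h1).prodMk (by fun_prop))

lemma measurable_covAvg (ω : Nuisance M) (i : Fin n) {K : Obs n d × ℝ → ℝ} (hK : Measurable K) :
    Measurable (covAvg ω i K) := by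
  have h2 : Measurable fun v : (Obs n d × ℝ) × Cov d => ω.g i (v.1.1.past i, v.1.2) v.2 :=
    (ω.g_meas i).comp (f := fun v : (Obs n d × ℝ) × Cov d => ((v.1.1.past i, v.1.2), v.2))
      ((((measurable_past i).comp (measurable_fst.comp measurable_fst)).prodMk
        (measurable_snd.comp measurable_fst)).prodMk measurable_snd)
  exact ((measurable_comp_updX i hK).mul h2).stronglyMeasurable.integral_prod_right'.measurable

lemma covAvg_mem_Icc (ω : Nuisance M) (i : Fin n) {K : Obs n d × ℝ → ℝ} (hK : Measurable K)
    (hK1 : ∀ x, K x ∈ Icc (0 : ℝ) 1) (z : Obs n d × ℝ) : covAvg ω i K z ∈ Icc (0 : ℝ) 1 :=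
  integral_mul_mem_Icc (measurable_g_right ω i _) (ω.g_nonneg i _) (ω.g_one i _)
    ((measurable_comp_updX i hK).comp measurable_prodMk_left) fun _ => hK1 _

lemma covAvg_tau (ω : Nuisance M) (i : Fin n) (K : Obs n d × ℝ → ℝ) {m : ℕ} (hm : i.val ≤ m)
    (z : Obs n d × ℝ) : covAvg ω i K (tau (i.val + 1) m z.1, z.2) = covAvg ω i K z := by
  unfold covAvg
  simp only [tau_updX_tau i hm, tau_past z.1 (Nat.lt_succ_self i.val) hm]

/-- `covAvg` depends only on the data before x_{i+2} and on A, and integrating that covariate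
against g is precisely what the complete law does. -/
lemma condExp_covAvg (hθ : θ ∈ M.Θ) (ω : Nuisance M) (i : Fin n) {K : Obs n d × ℝ → ℝ}
    (hK : Measurable K) (hK1 : ∀ x, K x ∈ Icc (0 : ℝ) 1) :
    (completeLaw θ ω)[fun z => K (tau (i.val + 1) (i.val + 1) z.1, z.2) |
        MeasurableSpace.comap (fun z : Obs n d × ℝ => (tau (i.val + 1) i.val z.1, z.2)) inferInstance]
      =ᵐ[completeLaw θ ω] covAvg ω i K := by
  have : Fact (θ ∈ M.Θ) := ⟨hθ⟩
  have hT := measurable_tau_fst (n := n) (d := d) (i.val + 1) i.val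
  have hT1 := measurable_tau_fst (n := n) (d := d) (i.val + 1) (i.val + 1)
  have habs : ∀ {r : ℝ}, r ∈ Icc (0 : ℝ) 1 → ‖r‖ ≤ 1 := fun hr => by
    rw [Real.norm_eq_abs, abs_of_nonneg hr.1]; exact hr.2
  have hKi : Integrable (fun z : Obs n d × ℝ => K (tau (i.val + 1) (i.val + 1) z.1, z.2))
      (completeLaw θ ω) :=
    Integrable.of_bound (hK.comp hT1).aestronglyMeasurable 1 (ae_of_all _ fun z => habs (hK1 _))
  have hAm := measurable_covAvg ω i hK
  have hA1 := covAvg_mem_Icc ω i hK hK1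
  have hAi : Integrable (covAvg ω i K) (completeLaw θ ω) :=
    Integrable.of_bound hAm.aestronglyMeasurable 1 (ae_of_all _ fun z => habs (hA1 _))
  refine (ae_eq_condExp_of_forall_setIntegral_eq hT.comap_le hKi
    (fun s _ _ => hAi.integrableOn) ?_ ?_).symm
  · rintro _ ⟨B, hB, rfl⟩ -
    have hBm := hT hB
    rw [integral_eq_lintegral_of_nonneg_ae (ae_of_all _ fun z => (hA1 z).1)
      hAm.aestronglyMeasurable,
      integral_eq_lintegral_of_nonneg_ae (ae_of_all _ fun z => (hK1 _).1)
      (hK.comp hT1).aestronglyMeasurable]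
    congr 1
    rw [← lintegral_indicator hBm, ← lintegral_indicator hBm]
    let c : Obs n d × ℝ → ℝ≥0∞ := fun z => B.indicator (fun _ => 1) (tau (i.val + 1) i.val z.1, z.2)
    have hc : Measurable c := (measurable_const.indicator hB).comp hT
    have hcc : ∀ f : Obs n d × ℝ → ℝ≥0∞,
        ((fun z : Obs n d × ℝ => (tau (i.val + 1) i.val z.1, z.2)) ⁻¹' B).indicator f
        = fun z => c z * f z := by
      intro f
      ext z
      by_cases h : (tau (i.val + 1) i.val z.1, z.2) ∈ B <;> simp [c, h]
    rw [hcc, hcc]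
    have hKm := (hK.comp hT1).ennreal_ofReal
    refine lintegral_completeLaw_congr_cov hθ ω i (hc.mul hAm.ennreal_ofReal) (hc.mul hKm) ?_ ?_ ?_
    · intro a o
      have h1 := covAvg_tau ω i K (Nat.le_succ i.val) (o, a)
      simp only at h1
      simp only [c]
      rw [tau_tau le_rfl (Nat.le_succ _), h1]
    · intro a o
      simp only [c]
      rw [tau_tau le_rfl (Nat.le_succ _), tau_tau le_rfl le_rfl]
    · intro o a
      have hcu : ∀ x, c (updX o i x, a) = c (o, a) := fun x => by
        simp only [c]; rw [tau_updX le_rfl]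
      have hau : ∀ x, covAvg ω i K (updX o i x, a) = covAvg ω i K (o, a) := fun x => by
        have h1 := covAvg_tau ω i K le_rfl (updX o i x, a)
        have h2 := covAvg_tau ω i K le_rfl (o, a)
        simp only at h1 h2
        rw [← h1, tau_updX le_rfl, h2]
      have hgm := measurable_g ω i (o.past i, a)
      have hKx : Measurable fun x => K (tau (i.val + 1) (i.val + 1) (updX o i x), a) :=
        (measurable_comp_updX i hK).comp (measurable_prodMk_left (x := (o, a)))
      have hm1 : Measurable fun x => ENNReal.ofReal (covAvg ω i K (o, a))
          * ENNReal.ofReal (ω.g i (o.past i, a) x) := hgm.const_mul _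
      have hm2 : Measurable fun x => ENNReal.ofReal (K (tau (i.val + 1) (i.val + 1)
          (updX o i x), a)) * ENNReal.ofReal (ω.g i (o.past i, a) x) := hKx.ennreal_ofReal.mul hgm
      simp only [hcu, hau, mul_assoc]
      rw [lintegral_const_mul _ hm1, lintegral_const_mul _ hgm,
        ω.g_one, mul_one, lintegral_const_mul _ hm2]
      congr 1
      rw [covAvg, ofReal_integral_eq_lintegral_ofReal
        (integrable_mul_of_mem_Icc (measurable_g_right ω i _) (ω.g_nonneg i _) (ω.g_one i _) hKx
          fun x => hK1 _)
        (ae_of_all _ fun x => mul_nonneg (hK1 _).1 (ω.g_nonneg i _ _))]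
      refine lintegral_congr fun x => ?_
      rw [ENNReal.ofReal_mul (hK1 _).1]
  · have h : covAvg ω i K = (covAvg ω i K) ∘
        fun z : Obs n d × ℝ => (tau (i.val + 1) i.val z.1, z.2) :=
      funext fun z => (covAvg_tau ω i K le_rfl z).symm
    rw [h]
    exact (hAm.comp (comap_measurable _)).stronglyMeasurable.aestronglyMeasurable

end MPH

namespace MPH
open scoped ENNReal

variable {n q d : ℕ} {M : Model n q d} {θ : Param q d}

/-! ### Removing the last covariate from the conditional expectation. -/

lemma measurableSet_suppX (ω : Nuisance M) (i : Fin n) (p : Past d i.val) :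
    MeasurableSet (M.suppX i p) := by
  have h : M.suppX i p = {x | 0 < ω.g i (p, 0) x} := by
    ext x
    exact (ω.g_pos_iff i (p, 0) x).symm
  rw [h]
  exact measurableSet_lt measurable_const (measurable_g_right ω i _)

/-- `E[s (K - E[K | past]) ] = 0` for functions `K` of the past, the covariate and the
heterogeneity. -/
lemma integral_mul_sub_covAvg (hθ : θ ∈ M.Θ) {ω : Nuisance M} {s : Obs n d → ℝ}
    (hs : MemLp s 2 (obsLaw θ ω)) (hso : OrthScores θ ω s) (i : Fin n)
    {K : Obs n d × ℝ → ℝ} (hK : Measurable K) (hK1 : ∀ x, K x ∈ Icc (0 : ℝ) 1) :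
    ∫ z, s z.1 * (K (tau (i.val + 1) (i.val + 1) z.1, z.2) - covAvg ω i K z)
      ∂(completeLaw θ ω) = 0 := by
  let k : (Past d i.val × ℝ) × Cov d → ℝ := fun v =>
    K (tau (i.val + 1) (i.val + 1) (updX (ofPast i v.1.1) i v.2), v.1.2)
  have hk : Measurable k := (measurable_comp_updX i hK).comp
    (f := fun v : (Past d i.val × ℝ) × Cov d => ((ofPast i v.1.1, v.1.2), v.2))
    ((((measurable_ofPast i).comp (measurable_fst.comp measurable_fst)).prodMk
      (measurable_snd.comp measurable_fst)).prodMk measurable_snd)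
  have h := orthScores_cov hθ hs hso i hk fun v => hK1 _
  have hkz : ∀ (z : Obs n d × ℝ) (x : Cov d), k ((z.1.past i, z.2), x)
      = K (tau (i.val + 1) (i.val + 1) (updX z.1 i x), z.2) := by
    intro z x
    simp only [k]
    rw [ofPast_past, tau_updX_tau i le_rfl]
  simp only [hkz, updX_self] at h
  exact h

/-- The average over the sum of the remaining `P_t` does not depend on the last covariate. -/
lemma exists_gammaAvg_eq (hθ : θ ∈ M.Θ) {ω : Nuisance M} {s : Obs n d → ℝ}
    (hs : MemLp s 2 (obsLaw θ ω)) (hso : OrthScores θ ω s) (i : Fin n)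
    (hC : MatchesPast θ ω s (i.val + 1)) {u : Obs n d × ℝ → ℝ} (hu : Measurable u)
    (hus : ∀ o, ((obsLaw θ ω)[s | M.info θ (i.val + 1) (i.val + 1 + 1)]) o
      = u (tau (i.val + 1) (i.val + 1) o, tailP M θ (i.val + 1) o)) :
    ∃ V : Obs n d × ℝ → ℝ, Measurable V ∧ ∀ᵐ z ∂(completeLaw θ ω),
      gammaAvg (n - (i.val + 1)) u (tau (i.val + 1) (i.val + 1) z.1, z.2)
        = V (tau (i.val + 1) i.val z.1, z.2) := by
  have : Fact (θ ∈ M.Θ) := ⟨hθ⟩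
  have hj : i.val + 1 ≤ n := i.2
  set j := i.val + 1 with hjdef
  have hT := measurable_tau_fst (n := n) (d := d) j i.val
  have hX := measurable_tau_fst (n := n) (d := d) j j
  have hui : Integrable (fun o => u (tau j j o, tailP M θ j o)) (obsLaw θ ω) := by
    simp only [← hus]
    exact integrable_condExp
  set U := gammaAvg (n - j) u with hU
  have hUm : Measurable U := measurable_gammaAvg _ hu
  have hUi : Integrable (fun z : Obs n d × ℝ => U (tau j j z.1, z.2)) (completeLaw θ ω) :=
    (integrable_gammaAvg hθ ω hj hu hui).2
  -- V is the conditional expectation of the gamma average U given A and the past without the last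
  -- covariate; the claim is that conditioning changed nothing.
  obtain ⟨V, hV, hVe⟩ := (stronglyMeasurable_condExp (μ := completeLaw θ ω)
    (f := fun z : Obs n d × ℝ => U (tau j j z.1, z.2))
    (m := MeasurableSpace.comap (fun z : Obs n d × ℝ => (tau j i.val z.1, z.2))
      inferInstance)).measurable.exists_eq_measurable_comp
  have hVi : Integrable (fun z : Obs n d × ℝ => V (tau j i.val z.1, z.2)) (completeLaw θ ω) := by
    have : Integrable (V ∘ fun z : Obs n d × ℝ => (tau j i.val z.1, z.2)) (completeLaw θ ω) := by
      rw [← hVe]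
      exact integrable_condExp
    exact this
  refine ⟨V, hV, ?_⟩
  have hVt : ∀ z : Obs n d × ℝ, V (tau j i.val (tau j j z.1), z.2) = V (tau j i.val z.1, z.2) :=
    fun z => by rw [tau_tau le_rfl (Nat.le_succ _)]
  have hkey : ∀ᵐ z ∂(completeLaw θ ω),
      (fun x : Obs n d × ℝ => U x - V (tau j i.val x.1, x.2)) (tau j j z.1, z.2) = 0 := by
    refine ae_eq_zero_of_integral_mul_eq_zero (D := fun x => U x - V (tau j i.val x.1, x.2)) hX
      (hUm.sub (hV.comp hT)) ?_ ?_
    · simp only [hVt]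
      exact hUi.sub hVi
    · intro K hK hK1
      simp only [hVt, sub_mul]
      have habs : ∀ {r : ℝ}, r ∈ Icc (0 : ℝ) 1 → ‖r‖ ≤ 1 := fun hr => by
        rw [Real.norm_eq_abs, abs_of_nonneg hr.1]; exact hr.2
      have hKm := (hK.comp hX).aestronglyMeasurable (μ := completeLaw θ ω)
      have hAm := measurable_covAvg ω i hK
      have hA1 := covAvg_mem_Icc ω i hK hK1
      have hi1 : Integrable (fun z : Obs n d × ℝ => U (tau j j z.1, z.2) * K (tau j j z.1, z.2))
          (completeLaw θ ω) := hUi.mul_bdd (c := 1) hKm (ae_of_all _ fun z => habs (hK1 _))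
      have hi2 : Integrable (fun z : Obs n d × ℝ => V (tau j i.val z.1, z.2)
          * K (tau j j z.1, z.2)) (completeLaw θ ω) :=
        hVi.mul_bdd (c := 1) hKm (ae_of_all _ fun z => habs (hK1 _))
      -- Testing U - V against K is testing U against K minus its conditional expectation. Against
      -- functions of the past and A, U may be replaced by s because of the invariant, and s is
      -- orthogonal to such centred functions by the feedback tilts.
      have hVK : ∫ z, V (tau j i.val z.1, z.2) * K (tau j j z.1, z.2) ∂(completeLaw θ ω)
          = ∫ z, U (tau j j z.1, z.2) * covAvg ω i K z ∂(completeLaw θ ω) := by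
        have h1 := integral_condExp_mul_comm (hT.comap_le) hUi hKm (C := 1)
          fun z => habs (hK1 _)
        rw [hVe] at h1
        refine h1.trans (integral_congr_ae ?_)
        filter_upwards [condExp_covAvg hθ ω i hK hK1] with z hz
        exact congrArg _ hz
      rw [integral_sub hi1 hi2, hVK]
      have hAX : ∀ z : Obs n d × ℝ, covAvg ω i K z = covAvg ω i K (tau j j z.1, z.2) :=
        fun z => (covAvg_tau ω i K (Nat.le_succ _) z).symm
      have e1 := integral_mul_gammaAvg hθ ω hj hu hui hK hK1
      have e2 := integral_mul_gammaAvg hθ ω hj hu hui hAm hA1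
      simp only [← hus] at e1 e2
      rw [← hC K hK hK1] at e1
      rw [← hC _ hAm hA1] at e2
      simp only [← hAX] at e2
      rw [← hU] at e1 e2
      rw [← e1, ← e2]
      have hsi := (integrable_obsLaw_fst ω hs.1).1 (hs.integrable one_le_two)
      have hi3 : Integrable (fun z : Obs n d × ℝ => s z.1 * K (tau j j z.1, z.2))
          (completeLaw θ ω) := hsi.mul_bdd (c := 1) hKm (ae_of_all _ fun z => habs (hK1 _))
      have hi4 : Integrable (fun z : Obs n d × ℝ => s z.1 * covAvg ω i K z) (completeLaw θ ω) :=
        hsi.mul_bdd (c := 1) hAm.aestronglyMeasurable (ae_of_all _ fun z => habs (hA1 _))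
      rw [← integral_sub hi3 hi4]
      simp only [← mul_sub]
      exact integral_mul_sub_covAvg hθ hs hso i hK hK1
  filter_upwards [hkey] with z hz
  rw [hVt] at hz
  exact sub_eq_zero.1 hz

/-- The conditional expectation does not depend on the last covariate. -/
lemma ae_ae_ae_updX_eq (hθ : θ ∈ M.Θ) {ω : Nuisance M} {s : Obs n d → ℝ}
    (hs : MemLp s 2 (obsLaw θ ω)) (hso : OrthScores θ ω s) (i : Fin n)
    (hC : MatchesPast θ ω s (i.val + 1)) {u : Obs n d × ℝ → ℝ} (hu : Measurable u)
    (hus : ∀ o, ((obsLaw θ ω)[s | M.info θ (i.val + 1) (i.val + 1 + 1)]) o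
      = u (tau (i.val + 1) (i.val + 1) o, tailP M θ (i.val + 1) o)) :
    ∀ᵐ o ∂(obsLaw θ ω), ∀ᵐ x ∂(M.mX i), x ∈ M.suppX i (o.past i) →
      ∀ᵐ p ∂(volume.restrict (Ioi (0 : ℝ))),
        u (tau (i.val + 1) (i.val + 1) (updX o i x), p) = u (tau (i.val + 1) (i.val + 1) o, p) := by
  have : Fact (θ ∈ M.Θ) := ⟨hθ⟩
  obtain ⟨V, hV, hVe⟩ := exists_gammaAvg_eq hθ hs hso i hC hu hus
  have hj : i.val + 1 ≤ n := i.2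
  set j := i.val + 1 with hjdef
  have hui : Integrable (fun o => u (tau j j o, tailP M θ j o)) (obsLaw θ ω) := by
    simp only [← hus]
    exact integrable_condExp
  -- Points where the gamma average converges and equals V. Almost every point is in N, and it
  -- remains so after the last covariate is redrawn anywhere in its support.
  let N : Set (Obs n d × ℝ) := {x | Integrable (fun p => u (x.1, p) * (gden (n - j) x.2 p).toReal)
    (volume.restrict (Ioi 0))} ∩ {x | gammaAvg (n - j) u x = V (tau j i.val x.1, x.2)}
  have hN : MeasurableSet N :=
    (measurableSet_integrable (measurable_mul_gden (n - j) hu).stronglyMeasurable).inter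
      (measurableSet_eq_fun (measurable_gammaAvg _ hu) (hV.comp (measurable_tau_fst j i.val)))
  have hNae : ∀ᵐ z ∂(completeLaw θ ω), (tau j j z.1, z.2) ∈ N := by
    filter_upwards [hVe, (integrable_gammaAvg hθ ω hj hu hui).1] with z h1 h2
    refine ⟨h2, ?_⟩
    simp only [mem_ofPred_eq]
    rw [h1, tau_tau le_rfl (Nat.le_succ _)]
  have hae := ae_ae_suppA hθ ω (hNae.and (ae_updX hθ ω i hN hNae))
  filter_upwards [hae] with o ho
  have hA := measurableSet_suppA ω o.1
  have hNx : Measurable fun v : ℝ × Cov d => (tau j j (updX o i v.2), v.1) :=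
    ((measurable_tau j j).comp ((measurable_updX_right o i).comp measurable_snd)).prodMk
      measurable_fst
  have hswap : ∀ᵐ x ∂(M.mX i), ∀ᵐ a, a ∈ M.suppA o.1 → x ∈ M.suppX i (o.past i) →
      (tau j j (updX o i x), a) ∈ N := by
    have hmeas : MeasurableSet {v : ℝ × Cov d | v.1 ∈ M.suppA o.1 →
        v.2 ∈ M.suppX i (o.past i) → (tau j j (updX o i v.2), v.1) ∈ N} := by
      have e : {v : ℝ × Cov d | v.1 ∈ M.suppA o.1 →
          v.2 ∈ M.suppX i (o.past i) → (tau j j (updX o i v.2), v.1) ∈ N}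
          = (Prod.fst ⁻¹' M.suppA o.1)ᶜ ∪ ((Prod.snd ⁻¹' M.suppX i (o.past i))ᶜ ∪
            (fun v : ℝ × Cov d => (tau j j (updX o i v.2), v.1)) ⁻¹' N) := by
        ext v
        simp only [mem_ofPred_eq, mem_union, mem_compl_iff, mem_preimage]
        tauto
      rw [e]
      exact (measurable_fst hA).compl.union
        ((measurable_snd (measurableSet_suppX ω i _)).compl.union (hNx hN))
    refine (Measure.ae_ae_comm (μ := volume) (ν := M.mX i) (p := fun a x => a ∈ M.suppA o.1 →
      x ∈ M.suppX i (o.past i) → (tau j j (updX o i x), a) ∈ N) hmeas).1 ?_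
    filter_upwards [ho] with a ha
    by_cases haA : a ∈ M.suppA o.1
    · filter_upwards [(ha haA).2] with x hx _ using hx
    · exact ae_of_all _ fun x h => absurd h haA
  filter_upwards [hswap] with x hx hxs
  -- For almost every a in the support of the heterogeneity, both functions of the remaining sum
  -- have the same average, V, since V does not see the redrawn covariate. Completeness of the gamma
  -- family makes them equal.
  refine ae_eq_of_gammaAvg_eq (m := n - j) (volume_suppA_ne_zero ω o.1)
    (hu.comp measurable_prodMk_left) (hu.comp measurable_prodMk_left) ?_
  filter_upwards [hx, ho] with a h1 h2 haA
  obtain ⟨h3, h4⟩ := h1 haA hxs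
  obtain ⟨h5, h6⟩ := (h2 haA).1
  refine ⟨h3, h5, h4.trans (Eq.trans ?_ h6.symm)⟩
  simp only
  rw [tau_tau le_rfl (Nat.le_succ _), tau_tau le_rfl (Nat.le_succ _), tau_updX le_rfl]

/-- A function that is almost everywhere constant in x over the support equals its average over x.
The average no longer involves x_{j+2}, only the earlier past and the remaining sum, and I(j+1, j+1)
determines these. -/
lemma aeDetermined_condExp (hθ : θ ∈ M.Θ) {ω : Nuisance M} {s : Obs n d → ℝ}
    (hs : MemLp s 2 (obsLaw θ ω)) (hso : OrthScores θ ω s) {j : ℕ} (hj : j < n)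
    (hC : MatchesPast θ ω s (j + 1)) :
    AEDetermined (M.info θ (j + 1) (j + 1)) (obsLaw θ ω)
      ((obsLaw θ ω)[s | M.info θ (j + 1) (j + 2)]) := by
  obtain ⟨u, hu, hus⟩ := exists_condExp_eq (M := M) hθ ω s (j + 1)
  let i : Fin n := ⟨j, hj⟩
  -- Any probability density concentrated on the support would do as a weight; the feedback density
  -- at a = 0 does, since the support is the same for all a.
  let v : Obs n d × ℝ → ℝ := fun z =>
    ∫ x, u (tau (j + 1) (j + 1) (updX z.1 i x), z.2) * ω.g i (z.1.past i, 0) x ∂(M.mX i)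
  have hv : Measurable v := by
    have h2 : Measurable fun v : (Obs n d × ℝ) × Cov d => ω.g i (v.1.1.past i, 0) v.2 :=
      (ω.g_meas i).comp (f := fun v : (Obs n d × ℝ) × Cov d => ((v.1.1.past i, (0 : ℝ)), v.2))
        ((((measurable_past i).comp (measurable_fst.comp measurable_fst)).prodMk
          measurable_const).prodMk measurable_snd)
    exact ((measurable_comp_updX i hu).mul h2).stronglyMeasurable.integral_prod_right'.measurable
  have hvt : ∀ {m : ℕ}, j ≤ m → ∀ z : Obs n d × ℝ, v (tau (j + 1) m z.1, z.2) = v z := by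
    intro m hm z
    simp only [v]
    have h1 := tau_updX_tau i (m := m) hm z.1
    have h2 := tau_past (k := j + 1) (m := m) (j := i) z.1 (Nat.lt_succ_self j) hm
    simp only [i] at h1 h2 ⊢
    simp only [h1, h2]
  have hE : MeasurableSet {x : Obs n d × ℝ | u x = v x} := measurableSet_eq_fun hu hv
  have hae : ∀ᵐ o ∂(obsLaw θ ω), ∀ᵐ p ∂(volume.restrict (Ioi (0 : ℝ))),
      (tau (j + 1) (j + 1) o, p) ∈ {x : Obs n d × ℝ | u x = v x} := by
    filter_upwards [ae_ae_ae_updX_eq hθ hs hso i hC hu hus] with o ho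
    have hswap : ∀ᵐ p ∂(volume.restrict (Ioi (0 : ℝ))), ∀ᵐ x ∂(M.mX i),
        x ∈ M.suppX i (o.past i) →
        u (tau (j + 1) (j + 1) (updX o i x), p) = u (tau (j + 1) (j + 1) o, p) := by
      have hmeas : MeasurableSet {w : Cov d × ℝ | w.1 ∈ M.suppX i (o.past i) →
          u (tau (j + 1) (j + 1) (updX o i w.1), w.2) = u (tau (j + 1) (j + 1) o, w.2)} := by
        have e : {w : Cov d × ℝ | w.1 ∈ M.suppX i (o.past i) →
            u (tau (j + 1) (j + 1) (updX o i w.1), w.2) = u (tau (j + 1) (j + 1) o, w.2)}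
            = (Prod.fst ⁻¹' M.suppX i (o.past i))ᶜ ∪ {w : Cov d × ℝ |
              u (tau (j + 1) (j + 1) (updX o i w.1), w.2) = u (tau (j + 1) (j + 1) o, w.2)} := by
          ext w
          simp only [mem_ofPred_eq, mem_union, mem_compl_iff, mem_preimage]
          tauto
        rw [e]
        refine (measurable_fst (measurableSet_suppX ω i _)).compl.union (measurableSet_eq_fun ?_ ?_)
        · exact hu.comp (((measurable_tau _ _).comp
            ((measurable_updX_right o i).comp measurable_fst)).prodMk measurable_snd)
        · exact hu.comp (measurable_const.prodMk measurable_snd)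
      refine (Measure.ae_ae_comm (μ := M.mX i) (ν := volume.restrict (Ioi (0 : ℝ)))
        (p := fun x p => x ∈ M.suppX i (o.past i) →
        u (tau (j + 1) (j + 1) (updX o i x), p) = u (tau (j + 1) (j + 1) o, p)) hmeas).1 ?_
      filter_upwards [ho] with x hx
      by_cases hxs : x ∈ M.suppX i (o.past i)
      · filter_upwards [hx hxs] with p hp _ using hp
      · exact ae_of_all _ fun p h => absurd h hxs
    filter_upwards [hswap] with p hp
    have h1 : v (tau (j + 1) (j + 1) o, p) = v (o, p) := hvt (m := j + 1) (Nat.le_succ j) (o, p)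
    rw [h1]
    simp only [v]
    rw [integral_congr_ae (g := fun x => u (tau (j + 1) (j + 1) o, p) * ω.g i (o.past i, 0) x),
      integral_const_mul, integral_of_lintegral_eq_one (measurable_g_right ω i _)
        (ω.g_nonneg i _) (ω.g_one i _), mul_one]
    filter_upwards [hp] with x hx
    by_cases hxs : x ∈ M.suppX i (o.past i)
    · rw [hx hxs]
    · have h0 : ω.g i (o.past i, 0) x = 0 :=
        le_antisymm (not_lt.1 fun h => hxs ((ω.g_pos_iff i _ x).1 h)) (ω.g_nonneg i _ x)
      rw [h0, mul_zero, mul_zero]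
  have hfin := ae_tailP hθ ω (show j + 1 ≤ n from hj) hE hae
  refine (((aeDetermined_tau hθ ω (show j + 1 ≤ n from hj) le_rfl (Nat.lt_succ_self j)).prodMk
    (aeDetermined_y_tailP hθ ω (show j + 1 ≤ n from hj) le_rfl le_rfl).2).comp hv).congr ?_
  filter_upwards [hfin] with o ho
  rw [hus o, ho]
  exact (hvt (m := j + 1) (Nat.le_succ j) (o, tailP M θ (j + 1) o)).trans
    (hvt (m := j) le_rfl (o, tailP M θ (j + 1) o)).symm

/-- The heterogeneity tilts give E[s | A, Y₀, X_1] = 0. By the invariant at j = 0 this is the gamma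
average of E[s | I(0, 1)], and completeness makes the latter zero. -/
lemma condExp_info_zero (hθ : θ ∈ M.Θ) {ω : Nuisance M} {s : Obs n d → ℝ}
    (hs : MemLp s 2 (obsLaw θ ω)) (hso : OrthScores θ ω s) (hs0 : ∫ o, s o ∂(obsLaw θ ω) = 0)
    (hC : MatchesPast θ ω s 0) :
    (obsLaw θ ω)[s | M.info θ 0 1] =ᵐ[obsLaw θ ω] 0 := by
  have : Fact (θ ∈ M.Θ) := ⟨hθ⟩
  obtain ⟨u, hu, hus⟩ := exists_condExp_eq (M := M) hθ ω s 0
  have hui : Integrable (fun o => u (tau 0 0 o, tailP M θ 0 o)) (obsLaw θ ω) := by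
    simp only [← hus]
    exact integrable_condExp
  have hg := integrable_gammaAvg hθ ω (Nat.zero_le n) hu hui
  have hU0 : ∀ᵐ z ∂(completeLaw θ ω), gammaAvg (n - 0) u (tau 0 0 z.1, z.2) = 0 := by
    refine ae_eq_zero_of_integral_mul_eq_zero (measurable_tau_fst 0 0)
      (measurable_gammaAvg (n - 0) hu) hg.2 fun k hk hk1 => ?_
    rw [← integral_mul_gammaAvg hθ ω (Nat.zero_le n) hu hui hk hk1]
    simp only [← hus]
    rw [← hC k hk hk1]
    exact orthScores_het hθ hs hso hs0 (k := fun v => k ((v.1, fun _ => 0, fun _ => 0), v.2))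
      (hk.comp (by fun_prop)) fun v => hk1 _
  have hae := ae_ae_suppA hθ ω (hU0.and hg.1)
  have hfin := ae_tailP hθ ω (Nat.zero_le n) (E := {x | u x = 0})
    (measurableSet_eq_fun hu measurable_const) (by
      filter_upwards [hae] with o ho
      refine ae_eq_zero_of_integral_gden_eq_zero (m := n - 0) (hu.comp measurable_prodMk_left)
        (volume_suppA_ne_zero ω o.1) ?_
      filter_upwards [ho] with a ha haA
      exact ⟨(ha haA).2, (ha haA).1⟩)
  filter_upwards [hfin] with o ho
  rw [hus o, ho]
  rfl

lemma matchesPast (hθ : θ ∈ M.Θ) {ω : Nuisance M} {s : Obs n d → ℝ}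
    (hs : MemLp s 2 (obsLaw θ ω)) (hso : OrthScores θ ω s) {j : ℕ} (hj : j ≤ n) :
    MatchesPast θ ω s j := by
  have : Fact (θ ∈ M.Θ) := ⟨hθ⟩
  induction hj using Nat.decreasingInduction with
  | self => exact matchesPast_last hθ ω (hs.integrable one_le_two)
  | of_succ j hj ih =>
    exact matchesPast_of_succ hθ ω hj ih (aeDetermined_condExp hθ hs hso hj ih)

/-- A mean-zero function orthogonal to all scores is the sum of its projections. -/
lemma eq_sum_of_orthScores (hθ : θ ∈ M.Θ) {ω : Nuisance M} {s : Obs n d → ℝ}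
    (hs : MemLp s 2 (obsLaw θ ω)) (hso : OrthScores θ ω s) (hs0 : ∫ o, s o ∂(obsLaw θ ω) = 0) :
    s =ᵐ[obsLaw θ ω] fun o => ∑ j : Fin n,
      (((obsLaw θ ω)[s | M.info θ (j.val + 1) (j.val + 1)]) o
        - ((obsLaw θ ω)[s | M.info θ j.val (j.val + 1)]) o) := by
  have : Fact (θ ∈ M.Θ) := ⟨hθ⟩
  have hstep : ∀ j : Fin n, (obsLaw θ ω)[s | M.info θ (j.val + 1) (j.val + 1)]
      =ᵐ[obsLaw θ ω] (obsLaw θ ω)[s | M.info θ (j.val + 1) (j.val + 1 + 1)] := by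
    intro j
    have h1 := condExp_of_aestronglyMeasurable' (info_le hθ (j.val + 1) (j.val + 1))
      (aeDetermined_condExp hθ hs hso j.2 (matchesPast hθ hs hso j.2)).aestronglyMeasurable
      integrable_condExp
    exact (condExp_condExp_of_le (info_mono M θ le_rfl (Nat.le_succ _))
      (info_le hθ (j.val + 1) (j.val + 1 + 1))).symm.trans h1
  filter_upwards [ae_all_iff.2 hstep, condExp_info_zero hθ hs hso hs0
    (matchesPast hθ hs hso (Nat.zero_le n)), condExp_info_last hθ ω (hs.integrable one_le_two)]
    with o h1 h2 h3
  simp only [h1]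
  -- With I(j+1, j+1) upgraded to I(j+1, j+2), the sum telescopes from E[s | I(0, 1)] = 0 to E[s |
  -- I(n, n+1)] = s.
  rw [Fin.sum_univ_eq_sum_range (fun j => ((obsLaw θ ω)[s | M.info θ (j + 1) (j + 1 + 1)]) o
    - ((obsLaw θ ω)[s | M.info θ j (j + 1)]) o) n,
    Finset.sum_range_sub (fun j => ((obsLaw θ ω)[s | M.info θ j (j + 1)]) o), h3, h2]
  simp

end MPH

namespace MPH
open scoped ENNReal

variable {n q d : ℕ} {M : Model n q d} {θ : Param q d}

/-! ### The projection -/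

variable {ι : Type} [Fintype ι]

/-- The `ℝ^ι`-valued scores of regular submodels. -/
def scoreSet (ι : Type) [Fintype ι] (θ : Param q d) (ω : Nuisance M) : Set (L2 ι θ ω) :=
  {f : L2 ι θ ω | ∃ (path : ℝ → Nuisance M) (S : Obs n d → ℝ)
      (c : EuclideanSpace ℝ ι), path 0 = ω ∧ IsRegularSubmodel θ path S ∧
        f =ᵐ[obsLaw θ ω] fun o => S o • c}

lemma mem_tangentOrtho_iff {ω : Nuisance M} {h : L2 ι θ ω} :
    h ∈ tangentOrtho ι θ ω ↔
      (∀ f ∈ constants ι θ ω, inner ℝ f h = 0) ∧ ∀ f ∈ scoreSet ι θ ω, inner ℝ f h = 0 := by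
  have h1 : (tangentSet ι θ ω)ᗮ = (Submodule.span ℝ (scoreSet ι θ ω))ᗮ :=
    Submodule.orthogonal_closure _
  rw [tangentOrtho, ← Submodule.inf_orthogonal, Submodule.mem_inf, h1, Submodule.mem_orthogonal,
    Submodule.mem_orthogonal]
  refine and_congr_right fun _ => ⟨fun hs f hf => hs f (Submodule.subset_span hf), fun hs f hf => ?_⟩
  induction hf using Submodule.span_induction with
  | mem f hf => exact hs f hf
  | zero => exact inner_zero_left _
  | add f g _ _ hf hg => rw [inner_add_left, hf, hg, add_zero]
  | smul r f _ hf => rw [inner_smul_left, hf, mul_zero]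

variable (ι) in
/-- The conditional expectation given an information set, as an operator on `L2`. -/
noncomputable def infoOp (hθ : θ ∈ M.Θ) (ω : Nuisance M) (k m : ℕ) (f : L2 ι θ ω) : L2 ι θ ω :=
  (condExpL2 (EuclideanSpace ℝ ι) ℝ (μ := obsLaw θ ω) (info_le hθ k m) f :
    Lp (EuclideanSpace ℝ ι) 2 (obsLaw θ ω))

variable (ι) in
/-- The operator `f ↦ ∑ₜ (E[f | Y₀, P̃^t, P̄, X^t] - E[f | Y₀, P̃^{t-1}, P̄, X^t])`. -/
noncomputable def projOp (hθ : θ ∈ M.Θ) (ω : Nuisance M) (f : L2 ι θ ω) : L2 ι θ ω :=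
  ∑ j : Fin n, (infoOp ι hθ ω (j.val + 1) (j.val + 1) f - infoOp ι hθ ω j.val (j.val + 1) f)

lemma inner_projOp (hθ : θ ∈ M.Θ) (ω : Nuisance M) (f g : L2 ι θ ω) :
    inner ℝ (projOp ι hθ ω f) g = inner ℝ f (projOp ι hθ ω g) := by
  unfold projOp
  rw [sum_inner, inner_sum]
  refine Finset.sum_congr rfl fun j _ => ?_
  rw [inner_sub_left, inner_sub_right]
  exact congrArg₂ _ (inner_condExpL2_left_eq_right _) (inner_condExpL2_left_eq_right _)

lemma projOp_toLp (hθ : θ ∈ M.Θ) {ω : Nuisance M} {φ : Obs n d → EuclideanSpace ℝ ι}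
    (hφ : MemLp φ 2 (obsLaw θ ω)) :
    projOp ι hθ ω (hφ.toLp φ) =ᵐ[obsLaw θ ω] projFormula θ ω φ := by
  have : Fact (θ ∈ M.Θ) := ⟨hθ⟩
  have h1 : ∀ k m, infoOp ι hθ ω k m (hφ.toLp φ) =ᵐ[obsLaw θ ω] (obsLaw θ ω)[φ | M.info θ k m] :=
    fun k m => hφ.condExpL2_ae_eq_condExp (𝕜 := ℝ) (info_le hθ k m)
  have h2 : ∀ j : Fin n, ⇑(infoOp ι hθ ω (j.val + 1) (j.val + 1) (hφ.toLp φ)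
      - infoOp ι hθ ω j.val (j.val + 1) (hφ.toLp φ)) =ᵐ[obsLaw θ ω] fun o =>
        ((obsLaw θ ω)[φ | M.info θ (j.val + 1) (j.val + 1)]) o
          - ((obsLaw θ ω)[φ | M.info θ j.val (j.val + 1)]) o := by
    intro j
    filter_upwards [Lp.coeFn_sub (infoOp ι hθ ω (j.val + 1) (j.val + 1) (hφ.toLp φ))
      (infoOp ι hθ ω j.val (j.val + 1) (hφ.toLp φ)), h1 (j.val + 1) (j.val + 1),
      h1 j.val (j.val + 1)] with o e1 e2 e3
    rw [e1, Pi.sub_apply, e2, e3]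
  filter_upwards [Lp.coeFn_fun_finsetSum Finset.univ fun j : Fin n =>
      infoOp ι hθ ω (j.val + 1) (j.val + 1) (hφ.toLp φ) - infoOp ι hθ ω j.val (j.val + 1) (hφ.toLp φ),
    ae_all_iff.2 h2] with o e1 e2
  rw [projOp, e1, projFormula]
  exact Finset.sum_congr rfl fun j _ => e2 j

lemma projOp_congr (hθ : θ ∈ M.Θ) {ω : Nuisance M} {φ : Obs n d → EuclideanSpace ℝ ι}
    (hφ : MemLp φ 2 (obsLaw θ ω)) {f : L2 ι θ ω} (hf : f =ᵐ[obsLaw θ ω] φ) :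
    projOp ι hθ ω f =ᵐ[obsLaw θ ω] projFormula θ ω φ := by
  have : f = hφ.toLp φ := Lp.ext (hf.trans hφ.coeFn_toLp.symm)
  rw [this]
  exact projOp_toLp hθ hφ

lemma projOp_eq_zero (hθ : θ ∈ M.Θ) {ω : Nuisance M} {φ : Obs n d → EuclideanSpace ℝ ι}
    (hφ : MemLp φ 2 (obsLaw θ ω)) {f : L2 ι θ ω} (hf : f =ᵐ[obsLaw θ ω] φ)
    (h0 : ∀ j < n, (obsLaw θ ω)[φ | M.info θ (j + 1) (j + 1)]
      =ᵐ[obsLaw θ ω] (obsLaw θ ω)[φ | M.info θ j (j + 1)]) :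
    projOp ι hθ ω f = 0 := by
  refine Lp.ext ((projOp_congr hθ hφ hf).trans (EventuallyEq.trans ?_ (Lp.coeFn_zero _ _ _).symm))
  filter_upwards [ae_all_iff.2 fun j : Fin n => h0 j.val j.2] with o ho
  rw [projFormula, Finset.sum_eq_zero fun j _ => sub_eq_zero.2 (ho j)]
  rfl

lemma projOp_constants (hθ : θ ∈ M.Θ) {ω : Nuisance M} {f : L2 ι θ ω} (hf : f ∈ constants ι θ ω) :
    projOp ι hθ ω f = 0 := by
  have : Fact (θ ∈ M.Θ) := ⟨hθ⟩
  obtain ⟨c, hc⟩ := hf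
  refine projOp_eq_zero hθ (memLp_const c) hc fun j _ => ?_
  rw [condExp_const (info_le hθ _ _), condExp_const (info_le hθ _ _)]

lemma projOp_score (hθ : θ ∈ M.Θ) {ω : Nuisance M} {f : L2 ι θ ω} (hf : f ∈ scoreSet ι θ ω) :
    projOp ι hθ ω f = 0 := by
  have : Fact (θ ∈ M.Θ) := ⟨hθ⟩
  obtain ⟨path, S, c, rfl, hS, hfS⟩ := hf
  have hSi := hS.memLp.integrable one_le_two
  let T : ℝ →L[ℝ] EuclideanSpace ℝ ι := (ContinuousLinearMap.id ℝ ℝ).smulRight c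
  have hT : ∀ k m, (obsLaw θ (path 0))[fun o => S o • c | M.info θ k m]
      =ᵐ[obsLaw θ (path 0)] fun o => T (((obsLaw θ (path 0))[S | M.info θ k m]) o) :=
    fun k m => (T.comp_condExp_comm hSi).symm
  refine projOp_eq_zero hθ (T.comp_memLp' hS.memLp) hfS fun j hj => (hT _ _).trans ?_
  refine EventuallyEq.trans ?_ (hT _ _).symm
  filter_upwards [condExp_submodel_score hθ hS hj] with o ho
  rw [ho]

/-- A self-adjoint operator has range orthogonal to its kernel, and the kernel contains constants
and scores. -/
lemma projOp_mem_tangentOrtho (hθ : θ ∈ M.Θ) (ω : Nuisance M) (f : L2 ι θ ω) :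
    projOp ι hθ ω f ∈ tangentOrtho ι θ ω := by
  refine mem_tangentOrtho_iff.2 ⟨fun g hg => ?_, fun g hg => ?_⟩
  · rw [← inner_projOp, projOp_constants hθ hg, inner_zero_left]
  · rw [← inner_projOp, projOp_score hθ hg, inner_zero_left]

lemma inner_eq_integral_of_ae_eq {ω : Nuisance M} {f h : L2 ι θ ω} {φ : Obs n d → EuclideanSpace ℝ ι}
    (hf : f =ᵐ[obsLaw θ ω] φ) : inner ℝ f h = ∫ o, inner ℝ (φ o) (h o) ∂(obsLaw θ ω) := by
  rw [L2.inner_def]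
  refine integral_congr_ae ?_
  filter_upwards [hf] with o ho
  rw [ho]

/-- Reduction to real-valued functions: pairing with constants and scores in each coordinate
direction shows that every coordinate has mean zero and is orthogonal to all scalar scores.
Conditional expectation acts coordinatewise. -/
lemma projOp_of_mem_tangentOrtho (hθ : θ ∈ M.Θ) {ω : Nuisance M} {h : L2 ι θ ω}
    (hh : h ∈ tangentOrtho ι θ ω) : projOp ι hθ ω h = h := by
  classical
  have : Fact (θ ∈ M.Θ) := ⟨hθ⟩
  obtain ⟨hc, hsc⟩ := mem_tangentOrtho_iff.1 hh
  have hh2 : MemLp h 2 (obsLaw θ ω) := Lp.memLp h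
  have hhi : Integrable h (obsLaw θ ω) := hh2.integrable one_le_two
  have hcomp : ∀ i, MemLp (fun o => h o i) 2 (obsLaw θ ω) := fun i =>
    (EuclideanSpace.proj i : EuclideanSpace ℝ ι →L[ℝ] ℝ).comp_memLp' hh2
  have hi0 : ∀ i, ∫ o, h o i ∂(obsLaw θ ω) = 0 := by
    intro i
    have hm : MemLp (fun _ : Obs n d => EuclideanSpace.single i (1 : ℝ)) 2 (obsLaw θ ω) :=
      memLp_const _
    have h1 := hc (hm.toLp _) ⟨_, hm.coeFn_toLp⟩
    rw [inner_eq_integral_of_ae_eq hm.coeFn_toLp] at h1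
    simpa [EuclideanSpace.inner_single_left] using h1
  have hort : ∀ i, OrthScores θ ω fun o => h o i := by
    rintro i path S rfl hS
    have hm : MemLp (fun o => S o • EuclideanSpace.single i (1 : ℝ)) 2 (obsLaw θ (path 0)) :=
      ((ContinuousLinearMap.id ℝ ℝ).smulRight (EuclideanSpace.single i (1 : ℝ))).comp_memLp'
        hS.memLp
    have h1 := hsc (hm.toLp _) ⟨path, S, _, rfl, hS, hm.coeFn_toLp⟩
    rw [inner_eq_integral_of_ae_eq hm.coeFn_toLp] at h1
    refine Eq.trans ?_ h1
    refine integral_congr_ae (ae_of_all _ fun o => ?_)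
    simp [inner_smul_left, EuclideanSpace.inner_single_left, mul_comm]
  refine Lp.ext ((projOp_congr hθ hh2 ae_eq_rfl).trans ?_)
  have hce : ∀ k m, ∀ i, (fun o => ((obsLaw θ ω)[h | M.info θ k m]) o i) =ᵐ[obsLaw θ ω]
      (obsLaw θ ω)[fun o => h o i | M.info θ k m] := fun k m i =>
    (EuclideanSpace.proj i : EuclideanSpace ℝ ι →L[ℝ] ℝ).comp_condExp_comm hhi
  filter_upwards [ae_all_iff.2 fun i => eq_sum_of_orthScores hθ (hcomp i) (hort i) (hi0 i),
    ae_all_iff.2 fun k => ae_all_iff.2 fun m => ae_all_iff.2 fun i => hce k m i] with o e1 e2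
  ext i
  rw [e1 i, projFormula]
  simp only [← e2]
  simp

/-- The projection on the orthocomplement of the tangent set is given by the projection formula. -/
lemma projOrtho_eq (hθ : θ ∈ M.Θ) {ω : Nuisance M} {φ : Obs n d → EuclideanSpace ℝ ι}
    (hφ : MemLp φ 2 (obsLaw θ ω)) : projOrtho hφ = projOp ι hθ ω (hφ.toLp φ) := by
  refine Submodule.eq_starProjection_of_mem_of_inner_eq_zero (projOp_mem_tangentOrtho hθ ω _)
    fun h hh => ?_
  rw [inner_sub_left, inner_projOp, projOp_of_mem_tangentOrtho hθ hh, sub_self]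

/-! ### The score for `θ` -/

/-- Along each coordinate line through θ the likelihood integrates to one, so the constant 1 has
constant mean and is orthogonal to the directional score. Interiority of θ keeps the line in the
parameter set near θ, in both directions. -/
lemma integral_thetaScore (hΘ : M.Θ ∈ 𝓝 θ) {ω : Nuisance M} {S : Obs n d → Param q d}
    (hS : IsThetaScore θ ω S) : ∫ o, S o ∂(obsLaw θ ω) = 0 := by
  have hθ : θ ∈ M.Θ := mem_of_mem_nhds hΘ
  have : Fact (θ ∈ M.Θ) := ⟨hθ⟩
  have hl : ∀ θ' ∈ M.Θ, Integrable (likelihood θ' ω) M.base ∧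
      ∫ o, likelihood θ' ω o ∂M.base = 1 := by
    intro θ' hθ'
    have : Fact (θ' ∈ M.Θ) := ⟨hθ'⟩
    have h1 := (integrable_obsLaw_iff hθ' ω fun _ => 1).1 (integrable_const _)
    have h2 := integral_obsLaw hθ' ω fun _ => 1
    simp only [one_mul, integral_const, probReal_univ, smul_eq_mul, mul_one] at h1 h2
    exact ⟨h1, h2.symm⟩
  obtain ⟨S', hS'm, hSS'⟩ : ∃ S' : Obs n d → Param q d, Measurable S' ∧ S =ᵐ[obsLaw θ ω] S' :=
    ⟨_, hS.memLp.1.stronglyMeasurable_mk.measurable, hS.memLp.1.ae_eq_mk⟩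
  have hae : ∀ᵐ o ∂M.base, ∀ h : Param q d, inner ℝ h (S o) / 2 * √(likelihood θ ω o)
      = inner ℝ h (S' o) / 2 * √(likelihood θ ω o) := by
    have := hSS'
    rw [obsLaw_eq hθ, EventuallyEq, ae_withDensity_iff
      (measurable_likelihood hθ _).ennreal_ofReal] at this
    filter_upwards [this] with o ho h
    by_cases h0 : ENNReal.ofReal (likelihood θ ω o) = 0
    · rw [Real.sqrt_eq_zero_of_nonpos (ENNReal.ofReal_eq_zero.1 h0), mul_zero, mul_zero]
    · rw [ho h0]
  have hS'2 : MemLp S' 2 (obsLaw θ ω) := hS.memLp.ae_eq hSS'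
  rw [integral_congr_ae hSS']
  classical
  have hi : ∀ i, ∫ o, S' o i ∂(obsLaw θ ω) = 0 := by
    intro i
    have hcomp : MemLp (fun o => S' o i) 2 (obsLaw θ ω) :=
      (EuclideanSpace.proj i : Param q d →L[ℝ] ℝ).comp_memLp' hS'2
    have hcm : Measurable fun o => S' o i :=
      (EuclideanSpace.proj i : Param q d →L[ℝ] ℝ).continuous.measurable.comp
        hS'm
    let e : ℝ → Param q d := fun η => η • EuclideanSpace.single i (1 : ℝ)
    have hec : Continuous e := continuous_id.smul continuous_const
    have he0 : e 0 = 0 := zero_smul _ _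
    have hen : ∀ η, ‖e η‖ = |η| := fun η => by simp [e, norm_smul]
    have het : Tendsto e (𝓝[≠] 0) (𝓝[≠] 0) := by
      refine tendsto_nhdsWithin_iff.2 ⟨?_, ?_⟩
      · have := hec.tendsto 0
        rw [he0] at this
        exact this.mono_left nhdsWithin_le_nhds
      · filter_upwards [self_mem_nhdsWithin] with η hη
        rw [mem_compl_singleton_iff, ← norm_ne_zero_iff, hen]
        exact abs_ne_zero.2 hη
    have hev : ∀ᶠ η in 𝓝[≠] (0 : ℝ), θ + e η ∈ M.Θ := by
      have h1 : Tendsto (fun η => θ + e η) (𝓝 0) (𝓝 θ) := by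
        have : Continuous fun η => θ + e η := continuous_const.add hec
        simpa [he0] using this.tendsto 0
      exact nhdsWithin_le_nhds (h1.eventually_mem hΘ)
    have key := integral_mul_score_eq_zero (μ := M.base) (l := fun η => likelihood (θ + e η) ω)
      (l₀ := likelihood θ ω) (S := fun o => S' o i) (m := fun _ => 1) (C := 1) zero_le_one
      (likelihood_nonneg hθ _) (hl θ hθ).1 (hl θ hθ).2
      (hev.mono fun η hη => ⟨likelihood_nonneg hη _, (hl _ hη).1, by
        simp only [one_mul]; rw [(hl _ hη).2, (hl _ hθ).2]⟩)
      hcm.aestronglyMeasurable ((integrable_obsLaw_iff hθ _ _).1 hcomp.integrable_sq)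
      aestronglyMeasurable_const (by simp) (by
        refine (hS.dqm.comp het).congr fun η => lintegral_congr_ae ?_
        filter_upwards [hae] with o ho
        have h1 : inner ℝ (e η) (S' o) / 2 = η / 2 * S' o i := by
          simp only [e, inner_smul_left, EuclideanSpace.inner_single_left]
          simp
          ring
        rw [ho, h1, hen, div_pow, div_pow, sq_abs])
    rw [integral_obsLaw hθ]
    simpa using key
  ext i
  have h1 := (EuclideanSpace.proj i : Param q d →L[ℝ] ℝ).integral_comp_comm
    (hS'2.integrable one_le_two)
  exact h1.symm.trans (hi i)

end MPH

namespace MPH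
open scoped ENNReal

variable {n q d : ℕ} {M : Model n q d} {θ : Param q d}

/-! ### The average structural hazard -/

lemma measurable_Pbar (hθ : θ ∈ M.Θ) : Measurable fun o => M.Pbar θ o :=
  Finset.measurable_fun_sum _ fun t _ => Model.measurable_P hθ t

lemma Pbar_pos (hθ : θ ∈ M.Θ) {o : Obs n d} (ho : ∀ i, 0 < o.2.1 i) : 0 < M.Pbar θ o := by
  rw [← tailP_zero]
  exact tailP_pos hθ ho (Nat.zero_le n)

lemma lintegral_Pbar (hθ : θ ∈ M.Θ) (ω : Nuisance M) {φ : ℝ → ℝ≥0∞} (hφ : Measurable φ) :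
    ∫⁻ z, φ (M.Pbar θ z.1) ∂(completeLaw θ ω)
      = ∫⁻ z, (∫⁻ p in Ioi 0, φ p * gden n z.2 p) ∂(completeLaw θ ω) := by
  have h := lintegral_tau_tailP hθ ω (Nat.zero_le n) (F := fun v => φ v.2) (hφ.comp measurable_snd)
  simpa only [tailP_zero, Nat.sub_zero] using h

/-- Dividing by p lowers the gamma shape by one. This gives the moments of 1/P̄ and explains the
thresholds: the first inverse moment takes n ≥ 1 and the second, which uses the identity twice, n ≥
2. -/
lemma ofReal_inv_mul_gden (m : ℕ) (a : ℝ) {p : ℝ} (hp : 0 < p) :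
    ENNReal.ofReal p⁻¹ * gden (m + 1) a p = ENNReal.ofReal (Real.exp a / (m + 1)) * gden m a p := by
  unfold gden
  rw [← ENNReal.ofReal_mul (by positivity), ← ENNReal.ofReal_mul (by positivity)]
  congr 1
  rw [Nat.factorial_succ]
  push_cast
  have := hp.ne'
  field_simp
  ring

lemma lintegral_inv_Pbar (hθ : θ ∈ M.Θ) (ω : Nuisance M) (hn : 1 ≤ n) :
    ∫⁻ z, ENNReal.ofReal (M.Pbar θ z.1)⁻¹ ∂(completeLaw θ ω)
      = ∫⁻ z, ENNReal.ofReal (Real.exp z.2 / n) ∂(completeLaw θ ω) := by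
  obtain ⟨m, hm⟩ : ∃ m, n = m + 1 := ⟨n - 1, by omega⟩
  rw [lintegral_Pbar hθ ω (φ := fun p => ENNReal.ofReal p⁻¹) (by fun_prop)]
  refine lintegral_congr fun z => ?_
  have hnm : (n : ℝ) = m + 1 := by rw [hm]; push_cast; rfl
  have hg : Measurable fun p => gden m z.2 p := by fun_prop
  calc ∫⁻ p in Ioi 0, ENNReal.ofReal p⁻¹ * gden n z.2 p
      = ∫⁻ p in Ioi 0, ENNReal.ofReal (Real.exp z.2 / n) * gden m z.2 p := by
        refine setLIntegral_congr_fun measurableSet_Ioi fun p hp => ?_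
        have h := ofReal_inv_mul_gden m z.2 (mem_Ioi.1 hp)
        rw [← hnm] at h
        rw [← h]
        exact congrArg (fun k => ENNReal.ofReal p⁻¹ * gden k z.2 p) hm
    _ = ENNReal.ofReal (Real.exp z.2 / n) := by
        rw [lintegral_const_mul _ hg, lintegral_gden, mul_one]

lemma lintegral_inv_Pbar_sq (hθ : θ ∈ M.Θ) (ω : Nuisance M) (hn : 2 ≤ n) :
    ∫⁻ z, ENNReal.ofReal ((M.Pbar θ z.1)⁻¹ ^ 2) ∂(completeLaw θ ω)
      = ∫⁻ z, ENNReal.ofReal (Real.exp (2 * z.2) / (n * (n - 1))) ∂(completeLaw θ ω) := by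
  obtain ⟨m, hm⟩ : ∃ m, n = m + 1 + 1 := ⟨n - 2, by omega⟩
  rw [lintegral_Pbar hθ ω (φ := fun p => ENNReal.ofReal (p⁻¹ ^ 2)) (by fun_prop)]
  refine lintegral_congr fun z => ?_
  have hnm : (n : ℝ) = m + 1 + 1 := by rw [hm]; push_cast; rfl
  have hg : Measurable fun p => gden m z.2 p := by fun_prop
  have he : Real.exp z.2 / ((m + 1 : ℕ) + 1) * (Real.exp z.2 / (m + 1))
      = Real.exp (2 * z.2) / (n * (n - 1)) := by
    rw [hnm, two_mul, Real.exp_add]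
    push_cast
    rw [add_sub_cancel_right, div_mul_div_comm]
  calc ∫⁻ p in Ioi 0, ENNReal.ofReal (p⁻¹ ^ 2) * gden n z.2 p
      = ∫⁻ p in Ioi 0, ENNReal.ofReal (Real.exp (2 * z.2) / (n * (n - 1))) * gden m z.2 p := by
        refine setLIntegral_congr_fun measurableSet_Ioi fun p hp => ?_
        have h1 := ofReal_inv_mul_gden (m + 1) z.2 (mem_Ioi.1 hp)
        have h2 := ofReal_inv_mul_gden m z.2 (mem_Ioi.1 hp)
        have hp' : 0 ≤ p⁻¹ := inv_nonneg.2 (mem_Ioi.1 hp).le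
        have hg2 : gden n z.2 p = gden (m + 1 + 1) z.2 p := congrArg (fun k => gden k z.2 p) hm
        rw [hg2, pow_two, ENNReal.ofReal_mul hp', mul_assoc, h1, mul_left_comm, h2, ← mul_assoc,
          ← ENNReal.ofReal_mul (by positivity), he]
    _ = ENNReal.ofReal (Real.exp (2 * z.2) / (n * (n - 1))) := by
        rw [lintegral_const_mul _ hg, lintegral_gden, mul_one]

lemma inv_Pbar_nonneg (hθ : θ ∈ M.Θ) (ω : Nuisance M) :
    ∀ᵐ o ∂(obsLaw θ ω), 0 ≤ (M.Pbar θ o)⁻¹ := by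
  filter_upwards [obsLaw_pos ω] with o ho
  exact inv_nonneg.2 (Pbar_pos hθ ho).le

lemma integrable_inv_Pbar (hθ : θ ∈ M.Θ) (ω : Nuisance M) (hn : 1 ≤ n)
    (hA : Integrable (fun z : Obs n d × ℝ => Real.exp z.2) (completeLaw θ ω)) :
    Integrable (fun o => (M.Pbar θ o)⁻¹) (obsLaw θ ω) ∧
      ∫ o, (M.Pbar θ o)⁻¹ ∂(obsLaw θ ω) = (∫ z, Real.exp z.2 ∂(completeLaw θ ω)) / n := by
  have hm : Measurable fun o => (M.Pbar θ o)⁻¹ := (measurable_Pbar hθ).inv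
  have hm' : Measurable fun z : Obs n d × ℝ => (M.Pbar θ z.1)⁻¹ := hm.comp measurable_fst
  have h0 := completeLaw_ae_of_obsLaw (inv_Pbar_nonneg hθ ω)
  have hA' : Integrable (fun z : Obs n d × ℝ => Real.exp z.2 / n) (completeLaw θ ω) := hA.div_const _
  have hA0 : ∀ z : Obs n d × ℝ, 0 ≤ Real.exp z.2 / n := fun z => by positivity
  refine ⟨(integrable_obsLaw_fst ω hm.aestronglyMeasurable).2 ?_, ?_⟩
  · rw [← lintegral_ofReal_ne_top_iff_integrable hm'.aestronglyMeasurable h0,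
      lintegral_inv_Pbar hθ ω hn]
    exact (lintegral_ofReal_ne_top_iff_integrable hA'.1 (ae_of_all _ hA0)).2 hA'
  · rw [integral_obsLaw_fst ω hm.aestronglyMeasurable,
      integral_eq_lintegral_of_nonneg_ae h0 hm'.aestronglyMeasurable,
      lintegral_inv_Pbar hθ ω hn, ← integral_eq_lintegral_of_nonneg_ae (ae_of_all _ hA0) hA'.1,
      integral_div]

lemma memLp_inv_Pbar (hθ : θ ∈ M.Θ) (ω : Nuisance M) (hn : 2 ≤ n)
    (hA : Integrable (fun z : Obs n d × ℝ => Real.exp (2 * z.2)) (completeLaw θ ω)) :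
    MemLp (fun o => (M.Pbar θ o)⁻¹) 2 (obsLaw θ ω) := by
  have hm : Measurable fun o => (M.Pbar θ o)⁻¹ := (measurable_Pbar hθ).inv
  have hm' : Measurable fun z : Obs n d × ℝ => (M.Pbar θ z.1)⁻¹ ^ 2 :=
    (hm.comp measurable_fst).pow_const 2
  have hA' : Integrable (fun z : Obs n d × ℝ => Real.exp (2 * z.2) / (n * (n - 1)))
    (completeLaw θ ω) := hA.div_const _
  have hn' : (0 : ℝ) ≤ n * (n - 1) :=
    mul_nonneg (Nat.cast_nonneg n) (sub_nonneg.2 (by exact_mod_cast (by omega : 1 ≤ n)))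
  have hA0 : ∀ z : Obs n d × ℝ, 0 ≤ Real.exp (2 * z.2) / (n * (n - 1)) :=
    fun z => div_nonneg (Real.exp_pos _).le hn'
  refine (memLp_two_iff_integrable_sq hm.aestronglyMeasurable).2
    ((integrable_obsLaw_fst ω (hm.pow_const 2).aestronglyMeasurable).2 ?_)
  rw [← lintegral_ofReal_ne_top_iff_integrable hm'.aestronglyMeasurable
    (ae_of_all _ fun z => sq_nonneg _), lintegral_inv_Pbar_sq hθ ω hn]
  exact (lintegral_ofReal_ne_top_iff_integrable hA'.1 (ae_of_all _ hA0)).2 hA'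

variable {ι : Type}

/-- The coefficients of `1 / P̄` in the moment functions for the average structural hazards. -/
noncomputable def hazardCoef (M : Model n q d) (θ : Param q d) (y ylag : ι → ℝ) (x : ι → Cov d) :
    EuclideanSpace ℝ ι :=
  WithLp.toLp 2 fun i => M.haz θ.alpha (y i) * Real.exp (x i ⬝ᵥ θ.beta + θ.gamma * ylag i) * n

lemma hazardMoment_eq (M : Model n q d) (θ : Param q d) (y ylag : ι → ℝ) (x : ι → Cov d) :
    M.hazardMoment θ y ylag x = fun o => (M.Pbar θ o)⁻¹ • hazardCoef M θ y ylag x := by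
  ext o i
  simp only [Model.hazardMoment, hazardCoef, PiLp.smul_apply, smul_eq_mul]
  ring

lemma integral_hazardMoment_apply (hθ : θ ∈ M.Θ) (ω : Nuisance M) (hn : 1 ≤ n) (y ylag : ι → ℝ)
    (x : ι → Cov d)
    (hA : Integrable (fun z : Obs n d × ℝ => Real.exp z.2) (completeLaw θ ω)) (i : ι) :
    ∫ o, M.hazardMoment θ y ylag x o i ∂(obsLaw θ ω)
      = averageHazard θ ω (y i) (ylag i) (x i) := by
  have hn' : (n : ℝ) ≠ 0 := by positivity
  simp only [hazardMoment_eq, PiLp.smul_apply, smul_eq_mul]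
  rw [integral_mul_const, (integrable_inv_Pbar hθ ω hn hA).2, averageHazard]
  simp only [Model.hazard, hazardCoef, Real.exp_add _ (_ : ℝ), ← mul_assoc]
  rw [integral_const_mul]
  field_simp

variable [Fintype ι]

lemma condExp_hazardMoment (hθ : θ ∈ M.Θ) (ω : Nuisance M) (y ylag : ι → ℝ) (x : ι → Cov d)
    (hi : Integrable (M.hazardMoment θ y ylag x) (obsLaw θ ω)) (k m : ℕ) :
    (obsLaw θ ω)[M.hazardMoment θ y ylag x | M.info θ k m] = M.hazardMoment θ y ylag x := by
  have : Fact (θ ∈ M.Θ) := ⟨hθ⟩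
  refine condExp_of_stronglyMeasurable (info_le hθ k m) ?_ hi
  rw [hazardMoment_eq]
  have hP : Measurable[M.info θ k m] fun o => (M.Pbar θ o)⁻¹ :=
    (show Measurable fun w : InfoSpace n d k m => w.2.2.1⁻¹ by fun_prop).comp
      (measurable_infoVar_info M θ k m)
  exact hP.stronglyMeasurable.smul_const _

lemma integrable_hazardMoment (hθ : θ ∈ M.Θ) (ω : Nuisance M) (hn : 1 ≤ n) (y ylag : ι → ℝ)
    (x : ι → Cov d)
    (hA : Integrable (fun z : Obs n d × ℝ => Real.exp z.2) (completeLaw θ ω)) :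
    Integrable (M.hazardMoment θ y ylag x) (obsLaw θ ω) := by
  rw [hazardMoment_eq]
  exact (integrable_inv_Pbar hθ ω hn hA).1.smul_const _

lemma integrable_exp_of_sq [Fact (θ ∈ M.Θ)] (ω : Nuisance M)
    (hA : Integrable (fun z : Obs n d × ℝ => Real.exp (2 * z.2)) (completeLaw θ ω)) :
    Integrable (fun z : Obs n d × ℝ => Real.exp z.2) (completeLaw θ ω) := by
  refine (hA.add (integrable_const 1)).mono' (by fun_prop) (ae_of_all _ fun z => ?_)
  rw [Real.norm_eq_abs, Real.abs_exp, Pi.add_apply, two_mul, Real.exp_add]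
  nlinarith [sq_nonneg (Real.exp z.2 - 1)]

lemma memLp_hazardMoment (hθ : θ ∈ M.Θ) (ω : Nuisance M) (hn : 2 ≤ n) (y ylag : ι → ℝ)
    (x : ι → Cov d)
    (hA : Integrable (fun z : Obs n d × ℝ => Real.exp (2 * z.2)) (completeLaw θ ω)) :
    MemLp (M.hazardMoment θ y ylag x) 2 (obsLaw θ ω) := by
  rw [hazardMoment_eq]
  exact ((ContinuousLinearMap.id ℝ ℝ).smulRight (hazardCoef M θ y ylag x)).comp_memLp'
    (memLp_inv_Pbar hθ ω hn hA)

lemma projFormula_hazardMoment (hθ : θ ∈ M.Θ) (ω : Nuisance M) (y ylag : ι → ℝ) (x : ι → Cov d)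
    (hi : Integrable (M.hazardMoment θ y ylag x) (obsLaw θ ω)) :
    projFormula θ ω (M.hazardMoment θ y ylag x) = 0 := by
  ext1 o
  simp only [projFormula, condExp_hazardMoment hθ ω y ylag x hi, sub_self, Finset.sum_const_zero,
    Pi.zero_apply]

/-- A mean-zero function whose projection vanishes belongs to the tangent set. -/
lemma mem_tangentSet_of_projOp_eq_zero (hθ : θ ∈ M.Θ) {ω : Nuisance M} {s : L2 ι θ ω}
    (hs : projOp ι hθ ω s = 0) (hs0 : ∀ f ∈ constants ι θ ω, inner ℝ f s = 0) :
    s ∈ tangentSet ι θ ω := by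
  have : Fact (θ ∈ M.Θ) := ⟨hθ⟩
  change s ∈ (Submodule.span ℝ (scoreSet ι θ ω)).topologicalClosure
  -- It suffices to test against t orthogonal to the scores. Such t need not have mean zero, so its
  -- mean is subtracted; scores have mean zero, hence the centred t is in 𝒯^⊥, where the operator is
  -- the identity and can be moved onto s.
  rw [← Submodule.orthogonal_orthogonal_eq_closure, Submodule.mem_orthogonal]
  intro t ht
  let c : EuclideanSpace ℝ ι := ∫ o, t o ∂(obsLaw θ ω)
  have hcm : MemLp (fun _ : Obs n d => c) 2 (obsLaw θ ω) := memLp_const _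
  have hti : Integrable t (obsLaw θ ω) := (Lp.memLp t).integrable one_le_two
  have hcc : hcm.toLp _ ∈ constants ι θ ω := ⟨c, hcm.coeFn_toLp⟩
  have htc : t - hcm.toLp _ ∈ tangentOrtho ι θ ω := by
    refine mem_tangentOrtho_iff.2 ⟨?_, ?_⟩
    · rintro f ⟨e, he⟩
      rw [inner_sub_right, inner_eq_integral_of_ae_eq he, inner_eq_integral_of_ae_eq he]
      have h1 : ∫ o, inner ℝ e (t o) ∂(obsLaw θ ω) = inner ℝ e c :=
        integral_inner hti e
      have h2 : ∫ o, inner ℝ e (hcm.toLp _ o) ∂(obsLaw θ ω) = inner ℝ e c := by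
        rw [integral_congr_ae (g := fun _ => inner ℝ e c) (hcm.coeFn_toLp.mono fun o ho => by
          simp only [ho])]
        simp
      rw [h1, h2, sub_self]
    · rintro f hf
      have hft : inner ℝ f t = 0 := ht f (Submodule.subset_span hf)
      obtain ⟨path, S, e, rfl, hS, hfS⟩ := hf
      rw [inner_sub_right, hft, inner_eq_integral_of_ae_eq hfS]
      have h2 : ∫ o, inner ℝ (S o • e) (hcm.toLp _ o) ∂(obsLaw θ (path 0))
          = ∫ o, S o * inner ℝ e c ∂(obsLaw θ (path 0)) := by
        refine integral_congr_ae (hcm.coeFn_toLp.mono fun o ho => ?_)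
        simp only [ho, inner_smul_left]
        rfl
      rw [h2, integral_mul_const, integral_submodel_score hθ hS, zero_mul, sub_self]
  have h1 : inner ℝ (t - hcm.toLp _) s = 0 := by
    rw [← projOp_of_mem_tangentOrtho hθ htc, inner_projOp, hs, inner_zero_right]
  rw [inner_sub_left, hs0 _ hcc, sub_zero] at h1
  exact h1

lemma exists_mem_tangentSet_eq (hθ : θ ∈ M.Θ) (ω : Nuisance M) (hn : 1 ≤ n) (y ylag : ι → ℝ)
    (x : ι → Cov d)
    (hA : Integrable (fun z : Obs n d × ℝ => Real.exp z.2) (completeLaw θ ω))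
    (hφ : MemLp (M.hazardMoment θ y ylag x) 2 (obsLaw θ ω)) :
    ∃ s ∈ tangentSet ι θ ω, s =ᵐ[obsLaw θ ω] fun o => M.hazardMoment θ y ylag x o
      - WithLp.toLp 2 fun i => averageHazard θ ω (y i) (ylag i) (x i) := by
  have : Fact (θ ∈ M.Θ) := ⟨hθ⟩
  have hi := integrable_hazardMoment hθ ω hn y ylag x hA
  set μ : EuclideanSpace ℝ ι := WithLp.toLp 2 fun i => averageHazard θ ω (y i) (ylag i) (x i) with hμ
  have hm : MemLp (fun o => M.hazardMoment θ y ylag x o - μ) 2 (obsLaw θ ω) :=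
    hφ.sub (memLp_const μ)
  have hmi : ∫ o, M.hazardMoment θ y ylag x o ∂(obsLaw θ ω) = μ := by
    ext i
    exact ((EuclideanSpace.proj i : EuclideanSpace ℝ ι →L[ℝ] ℝ).integral_comp_comm hi).symm.trans
      (integral_hazardMoment_apply hθ ω hn y ylag x hA i)
  refine ⟨hm.toLp _, mem_tangentSet_of_projOp_eq_zero hθ ?_ ?_, hm.coeFn_toLp⟩
  · refine projOp_eq_zero hθ hm hm.coeFn_toLp fun j _ => ?_
    have h : ∀ k m, (obsLaw θ ω)[fun o => M.hazardMoment θ y ylag x o - μ | M.info θ k m]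
        =ᵐ[obsLaw θ ω] fun o => M.hazardMoment θ y ylag x o - μ := by
      intro k m
      have h1 := condExp_sub hi (integrable_const μ) (M.info θ k m)
      rw [condExp_hazardMoment hθ ω y ylag x hi, condExp_const (info_le hθ k m)] at h1
      exact h1
    exact (h _ _).trans (h _ _).symm
  · rintro f ⟨e, he⟩
    have hsub : Integrable (fun o => M.hazardMoment θ y ylag x o - μ) (obsLaw θ ω) :=
      hi.sub (integrable_const μ)
    rw [inner_eq_integral_of_ae_eq he, integral_congr_ae
      (g := fun o => inner ℝ e (M.hazardMoment θ y ylag x o - μ))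
      (hm.coeFn_toLp.mono fun o ho => by simp only [ho]),
      integral_inner hsub e, integral_sub hi (integrable_const μ), hmi]
    simp

end MPH

/-! ### Assembly of the three statements. -/

theorem mainTheorem9 {n q d : ℕ} (hn : 1 ≤ n) (M : MPH.Model n q d) (θ : MPH.Param q d)
    (hθ : θ ∈ M.Θ) (ω : MPH.Nuisance M) :
    -- projection formula
    (∀ (L : ℕ) (φ : MPH.Obs n d → EuclideanSpace ℝ (Fin L))
      (hφ : MemLp φ 2 (MPH.obsLaw θ ω)), ∫ o, φ o ∂(MPH.obsLaw θ ω) = 0 →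
        MPH.projOrtho hφ =ᵐ[MPH.obsLaw θ ω] MPH.projFormula θ ω φ) ∧
    -- efficient score for θ
    (M.Θ ∈ 𝓝 θ → ∀ (S : MPH.Obs n d → MPH.Param q d) (hS : MPH.IsThetaScore θ ω S),
        ∫ o, S o ∂(MPH.obsLaw θ ω) = 0 ∧
        MPH.efficientScore hS =ᵐ[MPH.obsLaw θ ω] MPH.projFormula θ ω S) ∧
    -- average structural hazard at `L` evaluation points
    (∀ (L : ℕ) (y ylag : Fin L → ℝ) (x : Fin L → MPH.Cov d),
      -- identification, for `T ≥ 2`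
      (Integrable (fun z : MPH.Obs n d × ℝ => Real.exp z.2) (MPH.completeLaw θ ω) →
        Integrable (M.hazardMoment θ y ylag x) (MPH.obsLaw θ ω) ∧
        (∀ i, ∫ o, M.hazardMoment θ y ylag x o i ∂(MPH.obsLaw θ ω)
          = MPH.averageHazard θ ω (y i) (ylag i) (x i)) ∧
        MPH.projFormula θ ω (M.hazardMoment θ y ylag x) =ᵐ[MPH.obsLaw θ ω] 0) ∧
      -- efficiency, for `T ≥ 3`
      (2 ≤ n →
        Integrable (fun z : MPH.Obs n d × ℝ => Real.exp (2 * z.2)) (MPH.completeLaw θ ω) →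
        ∃ hφ : MemLp (M.hazardMoment θ y ylag x) 2 (MPH.obsLaw θ ω),
          MPH.projOrtho hφ = 0 ∧
          MPH.efficientMoment hφ =ᵐ[MPH.obsLaw θ ω] M.hazardMoment θ y ylag x ∧
          ∃ s ∈ MPH.tangentSet (Fin L) θ ω, s =ᵐ[MPH.obsLaw θ ω] fun o =>
            M.hazardMoment θ y ylag x o
              - WithLp.toLp 2 fun i => MPH.averageHazard θ ω (y i) (ylag i) (x i))) := by
  refine ⟨fun L φ hφ _ => ?_, fun hΘ S hS => ⟨MPH.integral_thetaScore hΘ hS, ?_⟩,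
    fun L y ylag x => ⟨fun hA => ?_, fun hn2 hA => ?_⟩⟩
  · rw [MPH.projOrtho_eq hθ hφ]
    exact MPH.projOp_toLp hθ hφ
  · rw [MPH.efficientScore, MPH.projOrtho_eq hθ hS.memLp]
    exact MPH.projOp_toLp hθ hS.memLp
  · have hi := MPH.integrable_hazardMoment hθ ω hn y ylag x hA
    exact ⟨hi, fun i => MPH.integral_hazardMoment_apply hθ ω hn y ylag x hA i,
      (MPH.projFormula_hazardMoment hθ ω y ylag x hi).eventuallyEq⟩
  · have : Fact (θ ∈ M.Θ) := ⟨hθ⟩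
    have hA1 := MPH.integrable_exp_of_sq ω hA
    have hφ := MPH.memLp_hazardMoment hθ ω hn2 y ylag x hA
    have hi := MPH.integrable_hazardMoment hθ ω hn y ylag x hA1
    have h0 : MPH.projOrtho hφ = 0 := by
      rw [MPH.projOrtho_eq hθ hφ]
      refine Lp.ext ((MPH.projOp_toLp hθ hφ).trans ?_)
      rw [MPH.projFormula_hazardMoment hθ ω y ylag x hi]
      exact (Lp.coeFn_zero _ _ _).symm
    refine ⟨hφ, h0, ?_, MPH.exists_mem_tangentSet_eq hθ ω hn y ylag x hA1 hφ⟩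
    rw [MPH.efficientMoment, h0, sub_zero]
    exact hφ.coeFn_toLp
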